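/- **Setting.** Let $m\ge 1$, let $\mathcal X\subset\mathbb R^d$ be nonempty, compact and convex, let $\xi=(\xi_0,\dots,\xi_m)$ be a random vector, and let $F_i(x,\xi_i)$, $i=0,\dots,m$, be integrable in $\xi_i$ and continuous and convex in $x\in\mathcal X$. Put $f_i(x)=\mathbb E[F_i(x,\xi_i)]$ and $f^*=\min\{f_0(x): x\in\mathcal X,\ f_i(x)\le r_i,\ i=1,\dots,m\}$. Assume that some $\tilde x\in\mathcal X$ has $f_i(\tilde x)<r_i$ for all $i\ge 1$ and $f_0(\tilde x)>f^*$. Let $\mathcal P(r,x)=\max\{f_0(x)-r,f_1(x)-r_1,\dots,f_m(x)-r_m\}$ and $H(r)=\min_{x\in\mathcal X}\mathcal P(r,x)$, fix $r^{(0)}>f^*$, and let $\beta=-H(r^{(0)})/(r^{(0)}-f^*)$. Let $\mathcal Y$ be the unit simplex of $\mathbb R^{m+1}$. Let $F_i'(x,\xi_i)\in\partial_xF_i(x,\xi_i)$ be integrable, $\Phi(x,y,\xi)=\sum_iy_i(F_i(x,\xi_i)-r_i)$ with $r_0:=r$ the level, $\phi=\mathbb E\,\Phi$, $G_x=\sum_iy_iF_i'(x,\xi_i)$,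 $G_y=(F_i(x,\xi_i)-r_i)_{i=0}^m$. Let $\omega_x,\omega_y$ be distance generating functions on $\mathcal X,\mathcal Y$ of moduli $\alpha_x,\alpha_y$ with respect to norms $\|\cdot\|_x,\|\cdot\|_y$ (continuous, strongly convex, and continuously differentiable where they have subgradients), $D_x^2=\max_{\mathcal X}\omega_x-\min_{\mathcal X}\omega_x$, $D_y^2=\max_{\mathcal Y}\omega_y-\min_{\mathcal Y}\omega_y$, and $\omega_z(x,y)=\omega_x(x)/(2D_x^2)+\omega_y(y)/(2D_y^2)$. Assume that there are positive $M_x,M_y,Q$ with $\mathbb E\exp(\|G_x\|_{*,x}^2/M_x^2)\le e$, $\mathbb E\exp(\|G_y\|_{*,y}^2/M_y^2)\le e$ and $\mathbb E\exp(|\Phi-\phi|^2/Q^2)\le e$ for all $x\in\mathcal X$, $y\in\mathcal Y$ and all levels $r\in(f^*,r^{(0)}]$. Put $M=\sqrt{2D_x^2M_x^2/\alpha_x+2D_y^2M_y^2/\alpha_y}$, $\gamma_t=1/(M\sqrt{t+1})$, $\Omega(\delta)=\max\{\sqrt{12\ln(24/\delta)},\tfrac43\ln(24/\delta)\}$, $X_\delta=Q\Omega(\delta)+10M\Omega(\delta)+4.5M$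 and $$T(\delta,\epsilon)=\max\Big\{6,\Big(\tfrac{16X_\delta}{\epsilon}\ln\tfrac{8X_\delta}{\epsilon}\Big)^2-2\Big\}\quad\text{(rounded up to an integer)}.$$ **OVSMD** at level $r$ with limit $T$: start at $z^{(0)}=(x^{(0)},y^{(0)})=\arg\min_{\mathcal X\times\mathcal Y}\omega_z$; for $t=0,\dots,T$ draw a fresh sample $\xi^{(t)}$ and set $z^{(t+1)}=\arg\min_{z\in\mathcal X\times\mathcal Y}\{\gamma_t(G_x,-G_y)^\top(z-z^{(t)})+V(z^{(t)},z)\}$ with $G_x,G_y$ evaluated at $(z^{(t)},\xi^{(t)})$ and $V$ the Bregman divergence of $\omega_z$. Return $\bar x=\sum_{s\le T}\gamma_sx^{(s)}/\sum_{s\le T}\gamma_s$ and $\hat u_*=\max_{y\in\mathcal Y}\sum_{s\le T}\gamma_s[\Phi(x^{(s)},y^{(s)},\xi^{(s)})+G_y(x^{(s)},y^{(s)},\xi^{(s)})^\top(y-y^{(s)})]/\sum_{s\le T}\gamma_s$. Each $t$ is one gradient iteration. **Procedure**, for $\bar\alpha>0$, $\delta\in(0,1)$, $\epsilon\in(0,1]$,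 $\theta>1$. *Phase 1:* for $h=0,1,\dots$ run OVSMD at level $r^{(0)}$ with limit $T(\delta/2^{h+1},\alpha^{(h)})$, $\alpha^{(h)}=\bar\alpha/2^h$, obtaining $\hat u^{(h)}$; stop at the first $h$ with $\hat u^{(h)}+\alpha^{(h)}<0$ and $(\hat u^{(h)}-\alpha^{(h)})/(\hat u^{(h)}+\alpha^{(h)})\le\theta$, and put $\bar U=\hat u^{(h)}+\alpha^{(h)}$. *Phase 2 (SFLS):* put $\epsilon_{\rm opt}=-\frac1\theta\bar U\epsilon$, $\epsilon_{\mathcal A}=-\frac{\theta-1}{2\theta^2(\theta+1)}\bar U\epsilon$; for $k=0,1,\dots$ run OVSMD at level $r^{(k)}$ with limit $T(\delta,\epsilon_{\mathcal A})$, obtaining $(U^{(k)},x^{(k)})$; stop and return $x^{(k)}$ at the first $k$ with $U^{(k)}\ge-\epsilon_{\rm opt}$, otherwise $r^{(k+1)}=r^{(k)}+U^{(k)}/(2\theta)$. **Theorem.** With probability at least $1-\delta$ all of the following hold. Phase 1 stops, with $H(r^{(0)})\le\bar U<0$ and $|H(r^{(0)})|/|\bar U|\le\theta$. Phase 2 stops,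 and its output $\hat x$ is feasible ($\hat x\in\mathcal X$, $f_i(\hat x)\le r_i$ for $i\ge 1$) and relative $\epsilon$-optimal: $(f_0(\hat x)-f^*)/(r^{(0)}-f^*)\le\epsilon$. The total number of OVSMD calls is at most $$C_0\,\frac{\theta^2}{\beta}\ln\Big(\frac{\theta^2}{(\theta-1)\beta\epsilon}\Big),$$ where $C_0$ depends only on $\bar\alpha$ and $r^{(0)}-f^*$. The total number of gradient iterations is at most $$C_2\Big[\frac1{\beta^2}\ln^4\Big(\frac1\beta\Big)\ln^2\Big(\frac1\delta\Big)+\frac{\theta^2}{\beta\epsilon^2}\ln\Big(\frac{\theta^2}{\beta\epsilon}\Big)\ln^2\Big(\frac1\delta\Big)\ln^2\Big(\frac1\epsilon\Big)\Big],$$ where $C_2$ depends only on $M,Q,\theta,\bar\alpha,H(r^{(0)})$; and the gradient iterations of Phase 1 number at most $C_1\beta^{-2}\ln^4(1/\beta)\ln^2(1/\delta)$, where $C_1$ depends only on $M,Q,\theta,\bar\alpha,r^{(0)}-f^*$ (and so not on $\beta$). In the two bounds on gradient iterations the $\mathcal O$-regime is as follows: for arbitrary fixed $\kappa\in(0,1)$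 and $p>0$, on which $C_1,C_2$ may also depend, the first is for $\epsilon,\delta\le\kappa$ and $\ln(1/\delta)\le\epsilon^{-p}$, the second for $\beta,\delta\le\kappa$ and $\ln(1/\delta)\le\beta^{-p}$. The constants depend on nothing else (in particular not on $d$, $m$, the distributions, the functions, the norms or the distance generating functions). -/

import Mathlib

open MeasureTheory ProbabilityTheory

noncomputable section

namespace SFLS

/-- A point at which `f` attains its minimum over `C` (some such point is chosen if there are
several; the minimizers taken below are unique by strong convexity). -/
def argminOn {α : Type*} [Nonempty α] (C : Set α) (f : α → ℝ) : α :=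
  Classical.epsilon fun z => z ∈ C ∧ IsMinOn f C z

/-- The dual norm `‖ζ‖_* = sup {ζᵀ v : ‖v‖ ≤ 1}`. -/
def dualNorm {n : ℕ} (p : Seminorm ℝ (Fin n → ℝ)) (ζ : Fin n → ℝ) : ℝ :=
  sSup ((fun v => ζ ⬝ᵥ v) '' {v | p v ≤ 1})

/-- A norm on `ℝⁿ`, a function `ω`, its gradient map and its modulus of strong convexity. -/
structure DGF (n : ℕ) where
  nrm : Seminorm ℝ (Fin n → ℝ)
  ω : (Fin n → ℝ) → ℝ
  grad : (Fin n → ℝ) → (Fin n → ℝ)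
  α : ℝ

namespace DGF

variable {n : ℕ} (D : DGF n) (C : Set (Fin n → ℝ))

/-- The points of `C` at which `ω`, as a function on `C`, has a subgradient. -/
def core : Set (Fin n → ℝ) :=
  {u | u ∈ C ∧ ∃ g : Fin n → ℝ, ∀ v ∈ C, D.ω u + g ⬝ᵥ (v - u) ≤ D.ω v}

/-- `ω` is a distance generating function on `C`, of modulus `α` with respect to the norm:
it is continuous and `α`-strongly convex on `C`, and continuously differentiable, with gradient
`grad`, on the set of points of `C` where it has a subgradient. -/
structure IsDGFOn : Prop where
  nrm_definite : ∀ v, D.nrm v = 0 → v = 0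
  α_pos : 0 < D.α
  continuousOn : ContinuousOn D.ω C
  strongConvex : ∀ u ∈ C, ∀ v ∈ C, ∀ a b : ℝ, 0 ≤ a → 0 ≤ b → a + b = 1 →
    D.ω (a • u + b • v) ≤ a * D.ω u + b * D.ω v - D.α / 2 * a * b * D.nrm (u - v) ^ 2
  hasGrad : ∀ u ∈ D.core C, HasFDerivWithinAt D.ω
    (∑ i, D.grad u i • (ContinuousLinearMap.proj i : (Fin n → ℝ) →L[ℝ] ℝ)) C u
  grad_continuousOn : ContinuousOn D.grad (D.core C)

/-- The diameter `√(max_C ω - min_C ω)`. -/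
def width : ℝ := √(sSup (D.ω '' C) - sInf (D.ω '' C))

end DGF

/-- The data of a stochastic program with `m` expectation constraints on `ℝᵈ`, together with what
the method is given. Index `0` is the objective, index `i + 1` is the `i`-th constraint. -/
structure SOEC (d m : ℕ) (Ξ : Fin (m + 1) → Type*) [∀ i, MeasurableSpace (Ξ i)] where
  /-- the simple set -/
  X : Set (Fin d → ℝ)
  /-- the integrands -/
  F : (i : Fin (m + 1)) → (Fin d → ℝ) → Ξ i → ℝ
  /-- the subgradients in `x` of the integrands -/
  F' : (i : Fin (m + 1)) → (Fin d → ℝ) → Ξ i → (Fin d → ℝ)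
  /-- the right-hand sides of the constraints -/
  r : Fin m → ℝ
  /-- the joint law of `(ξ₀, …, ξₘ)` -/
  law : Measure (∀ i, Ξ i)
  /-- norm and distance generating function for `X` -/
  dx : DGF d
  /-- norm and distance generating function for the simplex -/
  dy : DGF (m + 1)
  /-- light-tail constant of the `x`-subgradient -/
  Mx : ℝ
  /-- light-tail constant of the `y`-subgradient -/
  My : ℝ
  /-- light-tail constant of the objective value -/
  Q : ℝ

namespace SOEC

variable {d m : ℕ} {Ξ : Fin (m + 1) → Type*} [∀ i, MeasurableSpace (Ξ i)] (S : SOEC d m Ξ)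

/-- `fᵢ(x) = 𝔼[Fᵢ(x, ξᵢ)]`. -/
def f (i : Fin (m + 1)) (x : Fin d → ℝ) : ℝ := ∫ ξ, S.F i x (ξ i) ∂S.law

/-- The feasible set. -/
def feasible : Set (Fin d → ℝ) := {x | x ∈ S.X ∧ ∀ i : Fin m, S.f i.succ x ≤ S.r i}

/-- The optimal value `f^*`. -/
def fstar : ℝ := sInf (S.f 0 '' S.feasible)

/-- The right-hand sides `(r₀, r₁, …, rₘ)` with `r₀ = ρ` the level parameter. -/
def rhs (ρ : ℝ) : Fin (m + 1) → ℝ := Fin.cons ρ S.r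

/-- `𝒫(ρ, x) = max {f₀(x) - ρ, f₁(x) - r₁, …, fₘ(x) - rₘ}`. -/
def P (ρ : ℝ) (x : Fin d → ℝ) : ℝ :=
  Finset.univ.sup' Finset.univ_nonempty fun i => S.f i x - S.rhs ρ i

/-- The level-set function `H(ρ) = min_{x ∈ X} 𝒫(ρ, x)`. -/
def H (ρ : ℝ) : ℝ := sInf (S.P ρ '' S.X)

/-- The condition measure `β = -H(r⁰) / (r⁰ - f^*)`. -/
def beta (r0 : ℝ) : ℝ := -S.H r0 / (r0 - S.fstar)

/-- The simplex `𝒴`. -/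
def Y (_S : SOEC d m Ξ) : Set (Fin (m + 1) → ℝ) := stdSimplex ℝ (Fin (m + 1))

/-- `Φ(x, y, ξ) = ∑ᵢ yᵢ (Fᵢ(x, ξᵢ) - rᵢ)` at the level `r₀ = ρ`. -/
def Phi (ρ : ℝ) (x : Fin d → ℝ) (y : Fin (m + 1) → ℝ) (ξ : ∀ i, Ξ i) : ℝ :=
  ∑ i, y i * (S.F i x (ξ i) - S.rhs ρ i)

/-- `φ(x, y) = 𝔼[Φ(x, y, ξ)]`. -/
def phi (ρ : ℝ) (x : Fin d → ℝ) (y : Fin (m + 1) → ℝ) : ℝ := ∫ ξ, S.Phi ρ x y ξ ∂S.law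

/-- `G_x(x, y, ξ) = ∑ᵢ yᵢ Fᵢ'(x, ξᵢ)`. -/
def Gx (x : Fin d → ℝ) (y : Fin (m + 1) → ℝ) (ξ : ∀ i, Ξ i) : Fin d → ℝ :=
  ∑ i, y i • S.F' i x (ξ i)

/-- `G_y(x, y, ξ) = (F₀(x, ξ₀) - r₀, …, Fₘ(x, ξₘ) - rₘ)` at the level `r₀ = ρ`. -/
def Gy (ρ : ℝ) (x : Fin d → ℝ) (ξ : ∀ i, Ξ i) : Fin (m + 1) → ℝ :=
  fun i => S.F i x (ξ i) - S.rhs ρ i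

/-- Diameter of `X`. -/
def Dx : ℝ := S.dx.width S.X

/-- Diameter of the simplex. -/
def Dy : ℝ := S.dy.width S.Y

/-- `M = √(2 D_x² M_x² / α_x + 2 D_y² M_y² / α_y)`. -/
def M : ℝ := √(2 * S.Dx ^ 2 / S.dx.α * S.Mx ^ 2 + 2 * S.Dy ^ 2 / S.dy.α * S.My ^ 2)

/-- The standing assumptions, for the levels in `(f^*, r⁰]`. -/
structure Standing (r0 : ℝ) : Prop where
  m_pos : 0 < m
  law_prob : IsProbabilityMeasure S.law
  X_nonempty : S.X.Nonempty
  X_compact : IsCompact S.X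
  X_convex : Convex ℝ S.X
  F_continuousOn : ∀ i ξ, ContinuousOn (fun x => S.F i x ξ) S.X
  F_convexOn : ∀ i ξ, ConvexOn ℝ S.X (fun x => S.F i x ξ)
  F_measurable : ∀ i, ∀ x ∈ S.X, Measurable (S.F i x)
  F_integrable : ∀ i, ∀ x ∈ S.X, Integrable (fun ξ => S.F i x (ξ i)) S.law
  /-- strict feasibility -/
  strictly_feasible : ∃ x ∈ S.X, (∀ i : Fin m, S.f i.succ x < S.r i) ∧ S.fstar < S.f 0 x
  dx_dgf : S.dx.IsDGFOn S.X
  dy_dgf : S.dy.IsDGFOn S.Y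
  F'_measurable : ∀ i, Measurable fun q : S.X × Ξ i => S.F' i q.1 q.2
  F'_integrable : ∀ i, ∀ x ∈ S.X, Integrable (fun ξ => S.F' i x (ξ i)) S.law
  F'_subgradient : ∀ i ξ, ∀ x ∈ S.X, ∀ x' ∈ S.X,
    S.F i x ξ + S.F' i x ξ ⬝ᵥ (x' - x) ≤ S.F i x' ξ
  Mx_pos : 0 < S.Mx
  My_pos : 0 < S.My
  Q_pos : 0 < S.Q
  light_x : ∀ x ∈ S.X, ∀ y ∈ S.Y,
    ∫⁻ ξ, ENNReal.ofReal (Real.exp (dualNorm S.dx.nrm (S.Gx x y ξ) ^ 2 / S.Mx ^ 2)) ∂S.law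
      ≤ ENNReal.ofReal (Real.exp 1)
  light_y : ∀ ρ, S.fstar < ρ → ρ ≤ r0 → ∀ x ∈ S.X,
    ∫⁻ ξ, ENNReal.ofReal (Real.exp (dualNorm S.dy.nrm (S.Gy ρ x ξ) ^ 2 / S.My ^ 2)) ∂S.law
      ≤ ENNReal.ofReal (Real.exp 1)
  light_obj : ∀ ρ, S.fstar < ρ → ρ ≤ r0 → ∀ x ∈ S.X, ∀ y ∈ S.Y,
    ∫⁻ ξ, ENNReal.ofReal (Real.exp (|S.Phi ρ x y ξ - S.phi ρ x y| ^ 2 / S.Q ^ 2)) ∂S.law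
      ≤ ENNReal.ofReal (Real.exp 1)

/-! Stochastic mirror descent with online validation. -/

/-- The set `𝒵 = 𝒳 × 𝒴`. -/
def Z : Set ((Fin d → ℝ) × (Fin (m + 1) → ℝ)) := S.X ×ˢ S.Y

/-- `ω_z(z) = ω_x(x) / (2 D_x²) + ω_y(y) / (2 D_y²)`. -/
def omegaZ (z : (Fin d → ℝ) × (Fin (m + 1) → ℝ)) : ℝ :=
  S.dx.ω z.1 / (2 * S.Dx ^ 2) + S.dy.ω z.2 / (2 * S.Dy ^ 2)

/-- The Bregman divergence `V(z', z)` of `ω_z`. -/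
def V (z' z : (Fin d → ℝ) × (Fin (m + 1) → ℝ)) : ℝ :=
  S.omegaZ z - (S.omegaZ z' + (S.dx.grad z'.1 ⬝ᵥ (z.1 - z'.1) / (2 * S.Dx ^ 2)
    + S.dy.grad z'.2 ⬝ᵥ (z.2 - z'.2) / (2 * S.Dy ^ 2)))

/-- The prox-mapping `argmin_{z ∈ 𝒵} {ζᵀ (z - z') + V(z', z)}`. -/
def prox (z' ζ : (Fin d → ℝ) × (Fin (m + 1) → ℝ)) : (Fin d → ℝ) × (Fin (m + 1) → ℝ) :=
  argminOn S.Z fun z => ζ.1 ⬝ᵥ (z.1 - z'.1) + ζ.2 ⬝ᵥ (z.2 - z'.2) + S.V z' z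

/-- The step lengths `γ_t = 1 / (M √(t + 1))`. -/
def γ (t : ℕ) : ℝ := 1 / (S.M * √((t : ℝ) + 1))

/-- The iterates `z⁽ᵗ⁾` of mirror descent at level `ρ` driven by the samples `ξ 0, ξ 1, …`. -/
def iter (ρ : ℝ) (ξ : ℕ → ∀ i, Ξ i) : ℕ → (Fin d → ℝ) × (Fin (m + 1) → ℝ)
  | 0 => argminOn S.Z S.omegaZ
  | t + 1 => S.prox (iter ρ ξ t)
      (S.γ t • S.Gx (iter ρ ξ t).1 (iter ρ ξ t).2 (ξ t), -(S.γ t • S.Gy ρ (iter ρ ξ t).1 (ξ t)))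

/-- The averaged primal solution. -/
def xbar (ρ : ℝ) (ξ : ℕ → ∀ i, Ξ i) (t : ℕ) : Fin d → ℝ :=
  (∑ s ∈ Finset.range (t + 1), S.γ s)⁻¹ •
    ∑ s ∈ Finset.range (t + 1), S.γ s • (S.iter ρ ξ s).1

/-- The online validation bound `û_*`. -/
def uhat (ρ : ℝ) (ξ : ℕ → ∀ i, Ξ i) (t : ℕ) : ℝ :=
  sSup ((fun y => (∑ s ∈ Finset.range (t + 1), S.γ s)⁻¹ *
    ∑ s ∈ Finset.range (t + 1), S.γ s *
      (S.Phi ρ (S.iter ρ ξ s).1 (S.iter ρ ξ s).2 (ξ s)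
        + S.Gy ρ (S.iter ρ ξ s).1 (ξ s) ⬝ᵥ (y - (S.iter ρ ξ s).2))) '' S.Y)

/-- OVSMD at level `ρ` with iteration limit `T` (iterations `t = 0, …, T`, so `T + 1` of them). -/
def ovsmd (ρ : ℝ) (T : ℕ) (ξ : ℕ → ∀ i, Ξ i) : ℝ × (Fin d → ℝ) :=
  (S.uhat ρ ξ T, S.xbar ρ ξ T)

/-- `Ω(δ) = max {√(12 ln(24/δ)), (4/3) ln(24/δ)}`. -/
def bigOmega (δ : ℝ) : ℝ :=
  max (√(12 * Real.log (24 / δ))) (4 / 3 * Real.log (24 / δ))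

/-- The real number `T(δ, ε)`. -/
def limitReal (δ ε : ℝ) : ℝ :=
  max 6 ((16 * (S.Q * bigOmega δ + 10 * S.M * bigOmega δ + 4.5 * S.M) / ε *
    Real.log (8 * (S.Q * bigOmega δ + 10 * S.M * bigOmega δ + 4.5 * S.M) / ε)) ^ 2 - 2)

/-- The iteration limit `T(δ, ε)`, rounded up. -/
def limit (δ ε : ℝ) : ℕ := ⌈S.limitReal δ ε⌉₊

/-! Estimation of an upper bound on `H(r⁰)`; row `h` of the samples `ξ` drives call `h`. -/

/-- Tolerance `α⁽ʰ⁾ = ᾱ / 2ʰ` of call `h`. -/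
def estTol (abar : ℝ) (h : ℕ) : ℝ := abar / 2 ^ h

/-- Iteration limit of call `h`, with probability `δ⁽ʰ⁾ = δ / 2ʰ⁺¹`. -/
def estLimit (abar δ : ℝ) (h : ℕ) : ℕ := S.limit (δ / 2 ^ (h + 1)) (estTol abar h)

/-- The value `û_*⁽ʰ⁾` returned by call `h`. -/
def estValue (r0 abar δ : ℝ) (ξ : ℕ → ℕ → ∀ i, Ξ i) (h : ℕ) : ℝ :=
  (S.ovsmd r0 (S.estLimit abar δ h) (ξ h)).1

/-- The stopping test after call `h`. -/
def estTest (r0 abar δ θ : ℝ) (ξ : ℕ → ℕ → ∀ i, Ξ i) (h : ℕ) : Prop :=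
  S.estValue r0 abar δ ξ h + estTol abar h < 0 ∧
    (S.estValue r0 abar δ ξ h - estTol abar h) / (S.estValue r0 abar δ ξ h + estTol abar h) ≤ θ

/-- The value `Ū = û_*⁽ʰ⁾ + α⁽ʰ⁾` returned when the procedure stops after call `h`. -/
def estOutput (r0 abar δ : ℝ) (ξ : ℕ → ℕ → ∀ i, Ξ i) (h : ℕ) : ℝ :=
  S.estValue r0 abar δ ξ h + estTol abar h

/-- Gradient iterations spent in the calls `0, …, h`. -/
def estGradIters (abar δ : ℝ) (h : ℕ) : ℕ :=
  ∑ j ∈ Finset.range (h + 1), (S.estLimit abar δ j + 1)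

end SOEC

/-! The level-set method with a general oracle: `𝒜 k ρ ε δ` is the pair that call `k` returns on
the inputs `(ρ, ε, δ)`. -/

/-- The level `r⁽ᵏ⁾`. -/
def level {E : Type*} (𝒜 : ℕ → ℝ → ℝ → ℝ → ℝ × E) (r0 εA δ θ : ℝ) : ℕ → ℝ
  | 0 => r0
  | k + 1 => level 𝒜 r0 εA δ θ k + (𝒜 k (level 𝒜 r0 εA δ θ k) εA (δ / 2 ^ k)).1 / (2 * θ)

/-- The pair `(U(r⁽ᵏ⁾), x⁽ᵏ⁾)` returned by call `k`. -/
def levelCall {E : Type*} (𝒜 : ℕ → ℝ → ℝ → ℝ → ℝ × E) (r0 εA δ θ : ℝ) (k : ℕ) : ℝ × E :=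
  𝒜 k (level 𝒜 r0 εA δ θ k) εA (δ / 2 ^ k)

/-- `k` is the first index at which the test `p` holds: a loop with this test stops after `k`. -/
def StopsAt (p : ℕ → Prop) (k : ℕ) : Prop := p k ∧ ∀ j < k, ¬ p j

/-- The oracle error `ε_𝒜 = -(θ - 1) / (2 θ² (θ + 1)) · Ū ε`. -/
def oracleError (θ U ε : ℝ) : ℝ := -((θ - 1) / (2 * θ ^ 2 * (θ + 1))) * U * ε

/-- The optimality tolerance `ε_opt = -(1 / θ) Ū ε`. -/
def optTol (θ U ε : ℝ) : ℝ := -(1 / θ) * U * ε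

/-- OVSMD with the fixed iteration limit `T` as an oracle; row `k` of the samples drives call
`k`. -/
def SOEC.ovsmdOracle {d m : ℕ} {Ξ : Fin (m + 1) → Type*} [∀ i, MeasurableSpace (Ξ i)]
    (S : SOEC d m Ξ) (T : ℕ) (ξ : ℕ → ℕ → ∀ i, Ξ i) : ℕ → ℝ → ℝ → ℝ → ℝ × (Fin d → ℝ) :=
  fun k ρ _ _ => S.ovsmd ρ T (ξ k)

end SFLS

end

/-! Call a run at level `ρ` accurate with tolerance `ε` when `P ρ x̄ ≤ û + ε` and `û ≤ H ρ + ε`.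
Since `H ρ ≤ P ρ x̄`, the value `û` is then within `ε` of `H ρ`. The proof splits into a
probabilistic claim, that with probability at least `1 - δ` every call that matters is accurate, and
a deterministic one, that accurate calls force all the conclusions.

One call. The regret of mirror descent against `(u, y)` bounds `û` by `P ρ u` plus squared gradients
and the noise at the fixed point `u` (`validation_le`). In the reverse direction the vertex of the
simplex that realizes `P` depends on the noise. A fictitious second mirror descent `aux`, fed with
the noise of the constraint values, bounds it uniformly over the vertices (`P_xbar_le`). Exponential
moments along the adaptive sample path (`measure_sum_adaptive_ge_le`) then give `call_failure_le`.
The limit `T(δ, ε)` makes the error at most `ε / 2` (`callError_le`) and the failure probability at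
most `δ / (8 (T + 2) ^ 7)` (`failure_le`).

All calls. In Phase 1 the failure probabilities form a geometric series. In Phase 2 every call uses
the same `δ`, at a random level and with a random tolerance. The randomness is harmless, because the
samples of call `k` are independent of everything that determines its level
(`measure_indep_mem_le`). The missing union-bound factor is supplied by the power of `T + 2`: the
number of relevant calls is at most `(T + 2) ^ 7` (`levelCount_add_one_le`). That comparison rests
on `r0 - f* ≤ 4 M` (`sub_fstar_le`), a consequence of the light tails being assumed at all levels
with the same constant.

Deterministic part. `H` is 1-Lipschitz and lies between `-(ρ - f*)` and `-β (ρ - f*)` on `[f*, r0]`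
(`neg_le_H`, `H_le_beta`). So Phase 1 stops once its tolerance is small relative to `|H r0|`
(`estimation_stops`). Each level update shrinks `ρ - f*` at least by the factor `1 - β / (3 θ)`
without reaching `f*`, which bounds their number (`level_updates_stop`). `procedure_correct`
combines the two, and the complexity bounds follow by inserting the call counts into the formula for
`T`. -/

namespace SFLS

/-! ### Dual norms on finite-dimensional space. -/

section DualNorm

variable {n : ℕ} (p : Seminorm ℝ (Fin n → ℝ))

lemma Seminorm.continuous_pi : Continuous p := by
  have := (p.convexOn).continuousOn isOpen_univ
  exact continuousOn_univ.1 this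

/-- The constant is the minimum of the continuous function `p` on the compact unit sphere, positive
by definiteness. The sphere is empty only in dimension zero, where any constant works. -/
lemma exists_mul_norm_le (hp : ∀ v, p v = 0 → v = 0) : ∃ c : ℝ, 0 < c ∧ ∀ v, c * ‖v‖ ≤ p v := by
  by_cases hne : (Metric.sphere (0 : Fin n → ℝ) 1).Nonempty
  · obtain ⟨u, hu, hmin⟩ := (isCompact_sphere (0 : Fin n → ℝ) 1).exists_isMinOn hne
      (Seminorm.continuous_pi p).continuousOn
    have hu1 : ‖u‖ = 1 := by simpa using hu
    have hpu : 0 < p u := by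
      rcases (apply_nonneg p u).lt_or_eq with h | h
      · exact h
      · have := hp u h.symm
        rw [this] at hu1; simp at hu1
    refine ⟨p u, hpu, fun v => ?_⟩
    by_cases hv : v = 0
    · simp [hv]
    have hvn : 0 < ‖v‖ := norm_pos_iff.2 hv
    have h1 : p u ≤ p (‖v‖⁻¹ • v) := hmin (by simp [norm_smul, hvn.ne'])
    rw [map_smul_eq_mul, norm_inv, norm_norm] at h1
    calc p u * ‖v‖ ≤ (‖v‖⁻¹ * p v) * ‖v‖ := by gcongr
      _ = p v := by field_simp
  · refine ⟨1, one_pos, fun v => ?_⟩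
    by_cases hv : v = 0
    · simp [hv]
    exact absurd ⟨‖v‖⁻¹ • v, by simp [norm_smul, (norm_pos_iff.2 hv).ne']⟩ hne

variable {p} (hp : ∀ v, p v = 0 → v = 0)
include hp

/-- Definiteness makes the unit ball of `p` bounded. Without it the supremum in `dualNorm` could be
over an unbounded set and take the default value `0`. -/
lemma dualNorm_bddAbove (ζ : Fin n → ℝ) :
    BddAbove ((fun v => ζ ⬝ᵥ v) '' {v | p v ≤ 1}) := by
  obtain ⟨c, hc, h⟩ := exists_mul_norm_le p hp
  refine ⟨(∑ i, |ζ i|) * c⁻¹, ?_⟩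
  rintro _ ⟨v, hv, rfl⟩
  have hv' : ‖v‖ ≤ c⁻¹ := by
    rw [← one_div, le_div_iff₀ hc, mul_comm]
    exact (h v).trans hv
  simp only [dotProduct]
  rw [Finset.sum_mul]
  refine Finset.sum_le_sum fun i _ => ?_
  calc ζ i * v i ≤ |ζ i * v i| := le_abs_self _
    _ = |ζ i| * |v i| := abs_mul _ _
    _ ≤ |ζ i| * c⁻¹ := by
      gcongr
      exact (norm_le_pi_norm v i).trans hv'

lemma dualNorm_nonneg (ζ : Fin n → ℝ) : 0 ≤ dualNorm p ζ :=
  le_csSup (dualNorm_bddAbove hp ζ) ⟨0, by simp, by simp⟩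

lemma dot_le_dualNorm_mul (ζ v : Fin n → ℝ) : ζ ⬝ᵥ v ≤ dualNorm p ζ * p v := by
  by_cases hv : p v = 0
  · simp [hp v hv]
  have hpos : 0 < p v := (apply_nonneg p v).lt_of_ne' hv
  have h : ζ ⬝ᵥ ((p v)⁻¹ • v) ≤ dualNorm p ζ := by
    refine le_csSup (dualNorm_bddAbove hp ζ) ⟨(p v)⁻¹ • v, ?_, rfl⟩
    simp [map_smul_eq_mul, abs_of_pos hpos, hv]
  rw [dotProduct_smul, smul_eq_mul] at h
  calc ζ ⬝ᵥ v = ((p v)⁻¹ * ζ ⬝ᵥ v) * p v := by field_simp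
    _ ≤ _ := by gcongr

omit hp in
lemma dualNorm_le {ζ : Fin n → ℝ} {a : ℝ} (ha : 0 ≤ a) (h : ∀ v, ζ ⬝ᵥ v ≤ a * p v) :
    dualNorm p ζ ≤ a := by
  refine csSup_le ⟨_, 0, by simp, rfl⟩ ?_
  rintro _ ⟨v, hv, rfl⟩
  exact (h v).trans (mul_le_of_le_one_right ha hv)

lemma dualNorm_add_le (ζ η : Fin n → ℝ) : dualNorm p (ζ + η) ≤ dualNorm p ζ + dualNorm p η := by
  refine dualNorm_le (add_nonneg (dualNorm_nonneg hp _) (dualNorm_nonneg hp _)) fun v => ?_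
  rw [add_dotProduct, add_mul]
  exact add_le_add (dot_le_dualNorm_mul hp _ _) (dot_le_dualNorm_mul hp _ _)

lemma dualNorm_smul_le (c : ℝ) (ζ : Fin n → ℝ) : dualNorm p (c • ζ) ≤ |c| * dualNorm p ζ := by
  refine dualNorm_le (mul_nonneg (abs_nonneg _) (dualNorm_nonneg hp _)) fun v => ?_
  have := dot_le_dualNorm_mul hp ζ (c • v)
  rw [dotProduct_smul, map_smul_eq_mul, Real.norm_eq_abs] at this
  rw [smul_dotProduct]
  linarith

lemma dualNorm_neg_le (ζ : Fin n → ℝ) : dualNorm p (-ζ) ≤ dualNorm p ζ := by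
  simpa using dualNorm_smul_le hp (-1) ζ

lemma dualNorm_sub_le (ζ η : Fin n → ℝ) : dualNorm p (ζ - η) ≤ dualNorm p ζ + dualNorm p η := by
  rw [sub_eq_add_neg]
  linarith [dualNorm_add_le hp ζ (-η), dualNorm_neg_le hp η]

lemma continuous_dualNorm : Continuous (dualNorm p) := by
  have hc : ConvexOn ℝ Set.univ (dualNorm p) := by
    refine ⟨convex_univ, fun x _ y _ a b ha hb _ => ?_⟩
    have h1 := dualNorm_add_le hp (a • x) (b • y)
    have h2 := dualNorm_smul_le hp a x
    have h3 := dualNorm_smul_le hp b y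
    rw [abs_of_nonneg ha] at h2
    rw [abs_of_nonneg hb] at h3
    simp only [smul_eq_mul]
    linarith
  exact continuousOn_univ.1 (hc.continuousOn isOpen_univ)

end DualNorm

end SFLS

/-! ### Distance generating functions: Bregman lower bound and diameters. -/

namespace SFLS

namespace DGF

variable {n : ℕ} {D : DGF n} {C : Set (Fin n → ℝ)}

/-- The derivative of `ω` as a continuous linear functional. -/
noncomputable def gradCLM (D : DGF n) (u : Fin n → ℝ) : (Fin n → ℝ) →L[ℝ] ℝ :=
  ∑ i, D.grad u i • (ContinuousLinearMap.proj i : (Fin n → ℝ) →L[ℝ] ℝ)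

@[simp]
lemma gradCLM_apply (u v : Fin n → ℝ) : D.gradCLM u v = D.grad u ⬝ᵥ v := by
  simp [gradCLM, dotProduct]

lemma core_subset : D.core C ⊆ C := fun _ hu => hu.1

/-- Strong convexity along the segment from `u` to `v`, divided by the parameter `b`, bounds the
difference quotient of `ω`. Letting `b` tend to zero turns the quotient into the directional
derivative. -/
lemma IsDGFOn.bregman_lower (h : D.IsDGFOn C) (hC : Convex ℝ C) {u v : Fin n → ℝ}
    (hu : u ∈ D.core C) (hv : v ∈ C) :
    D.α / 2 * D.nrm (u - v) ^ 2 ≤ D.ω v - D.ω u - D.grad u ⬝ᵥ (v - u) := by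
  set N := D.nrm (u - v) ^ 2 with hN
  have hd : HasFDerivWithinAt D.ω (D.gradCLM u) C u := h.hasGrad u hu
  have hline : HasDerivWithinAt (fun b : ℝ => u + b • (v - u)) (v - u) (Set.Icc 0 1) 0 := by
    have h1 : HasDerivAt (fun b : ℝ => u + b • (v - u)) ((1 : ℝ) • (v - u)) 0 :=
      ((hasDerivAt_id (0 : ℝ)).smul_const (v - u)).const_add u
    simpa using h1.hasDerivWithinAt
  have hcomp : HasDerivWithinAt (fun b : ℝ => D.ω (u + b • (v - u))) (D.gradCLM u (v - u))
      (Set.Icc 0 1) 0 := by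
    refine HasFDerivWithinAt.comp_hasDerivWithinAt (t := C) (0 : ℝ) ?_ hline ?_
    · simpa using hd
    · intro b hb
      exact hC.add_smul_sub_mem hu.1 hv hb
  have hlim := hasDerivWithinAt_iff_tendsto_slope.1 hcomp
  have hlim2 : Filter.Tendsto (fun b : ℝ => D.ω v - D.ω u - D.α / 2 * (1 - b) * N)
      (nhdsWithin 0 (Set.Icc 0 1 \ {0})) (nhds (D.ω v - D.ω u - D.α / 2 * (1 - 0) * N)) := by
    have : Continuous fun b : ℝ => D.ω v - D.ω u - D.α / 2 * (1 - b) * N := by fun_prop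
    exact (this.tendsto 0).mono_left nhdsWithin_le_nhds
  have _hne : (nhdsWithin (0 : ℝ) (Set.Icc 0 1 \ {0})).NeBot := by
    have : Set.Icc (0 : ℝ) 1 \ {0} = Set.Ioc 0 1 := by
      simp
    rw [this]
    exact left_nhdsWithin_Ioc_neBot one_pos
  have key := le_of_tendsto_of_tendsto hlim hlim2 ?_
  · simp only [gradCLM_apply] at key
    linarith
  · filter_upwards [self_mem_nhdsWithin] with b hb
    have hb0 : 0 < b := lt_of_le_of_ne hb.1.1 (fun e => hb.2 e.symm)
    have hs := h.strongConvex u hu.1 v hv (1 - b) b (by linarith [hb.1.2]) hb0.le (by ring)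
    have e : (1 - b) • u + b • v = u + b • (v - u) := by
      rw [smul_sub, sub_smul, one_smul]; abel
    rw [e] at hs
    rw [slope_def_field]
    simp only [sub_zero, zero_smul, add_zero]
    rw [div_le_iff₀ hb0]
    linarith [hs]

lemma width_sq (hc : IsCompact C) (h : D.IsDGFOn C) :
    D.width C ^ 2 = sSup (D.ω '' C) - sInf (D.ω '' C) := by
  refine Real.sq_sqrt (sub_nonneg.2 ?_)
  exact Real.sInf_le_sSup _ (hc.bddBelow_image h.continuousOn) (hc.bddAbove_image h.continuousOn)

lemma sub_le_width_sq (hc : IsCompact C) (h : D.IsDGFOn C) {u v : Fin n → ℝ} (hu : u ∈ C)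
    (hv : v ∈ C) : D.ω u - D.ω v ≤ D.width C ^ 2 := by
  rw [width_sq hc h]
  have h1 := le_csSup (hc.bddAbove_image h.continuousOn) ⟨u, hu, rfl⟩
  have h2 := csInf_le (hc.bddBelow_image h.continuousOn) ⟨v, hv, rfl⟩
  linarith

/-- Strong convexity at the midpoint: its defect `α / 8 * ‖u - v‖ ^ 2` is at most the variation of
`ω` on `C`. -/
lemma nrm_sq_le_width_sq (hC : Convex ℝ C) (hc : IsCompact C) (h : D.IsDGFOn C)
    {u v : Fin n → ℝ} (hu : u ∈ C) (hv : v ∈ C) :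
    D.α * D.nrm (u - v) ^ 2 ≤ 8 * D.width C ^ 2 := by
  have hs := h.strongConvex u hu v hv (1/2) (1/2) (by norm_num) (by norm_num) (by norm_num)
  have hm : (1/2 : ℝ) • u + (1/2 : ℝ) • v ∈ C :=
    hC hu hv (by norm_num) (by norm_num) (by norm_num)
  have h1 := sub_le_width_sq hc h hu hm
  have h2 := sub_le_width_sq hc h hv hm
  linarith

/-- This handles the degenerate case in which division by `2 * D.width C ^ 2` yields `0` by
convention: the set is then a single point and the estimates below hold trivially. -/
lemma eq_of_width_eq_zero (hC : Convex ℝ C) (hc : IsCompact C) (h : D.IsDGFOn C)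
    (h0 : D.width C = 0) {u v : Fin n → ℝ} (hu : u ∈ C) (hv : v ∈ C) : u = v := by
  have h1 := nrm_sq_le_width_sq hC hc h hu hv
  rw [h0] at h1
  have h2 : D.nrm (u - v) ^ 2 ≤ 0 := by
    by_contra hlt
    have := mul_pos h.α_pos (not_le.1 hlt)
    linarith
  have h3 : D.nrm (u - v) = 0 := by
    have := le_antisymm h2 (sq_nonneg _)
    exact pow_eq_zero_iff two_ne_zero |>.1 this
  exact sub_eq_zero.1 (h.nrm_definite _ h3)

end DGF

end SFLS

/-! ### Proximal steps and the regret of mirror descent. -/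

namespace SFLS

lemma argminOn_spec {α : Type*} [Nonempty α] {C : Set α} {f : α → ℝ}
    (h : ∃ z, z ∈ C ∧ IsMinOn f C z) : argminOn C f ∈ C ∧ IsMinOn f C (argminOn C f) :=
  Classical.epsilon_spec h

namespace DGF

variable {n : ℕ} {D : DGF n} {C : Set (Fin n → ℝ)}

/-- Minimality says that `-(2 * width ^ 2) • η` is a subgradient of `ω` at `u`. Hence proximal
points land where `grad` really is the gradient. -/
lemma mem_core_of_isMinOn (hC : Convex ℝ C) (hc : IsCompact C) (h : D.IsDGFOn C)
    {η u : Fin n → ℝ} (hu : u ∈ C)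
    (hmin : ∀ v ∈ C, η ⬝ᵥ u + D.ω u / (2 * D.width C ^ 2) ≤
      η ⬝ᵥ v + D.ω v / (2 * D.width C ^ 2)) : u ∈ D.core C := by
  by_cases hw : D.width C = 0
  · refine ⟨hu, 0, fun v hv => ?_⟩
    rw [eq_of_width_eq_zero hC hc h hw hv hu]
    simp
  · have hw2 : 0 < 2 * D.width C ^ 2 := by positivity
    refine ⟨hu, -(2 * D.width C ^ 2) • η, fun v hv => ?_⟩
    have h1 := mul_le_mul_of_nonneg_left (hmin v hv) hw2.le
    rw [mul_add, mul_add, mul_div_cancel₀ _ hw2.ne', mul_div_cancel₀ _ hw2.ne'] at h1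
    rw [smul_dotProduct, dotProduct_sub, smul_eq_mul]
    linarith

lemma optimality_of_isMinOn (hC : Convex ℝ C) (hc : IsCompact C) (h : D.IsDGFOn C)
    {η u : Fin n → ℝ} (hu : u ∈ C)
    (hmin : ∀ v ∈ C, η ⬝ᵥ u + D.ω u / (2 * D.width C ^ 2) ≤
      η ⬝ᵥ v + D.ω v / (2 * D.width C ^ 2)) {v : Fin n → ℝ} (hv : v ∈ C) :
    0 ≤ η ⬝ᵥ (v - u) + D.grad u ⬝ᵥ (v - u) / (2 * D.width C ^ 2) := by
  have hcore := mem_core_of_isMinOn hC hc h hu hmin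
  set L : (Fin n → ℝ) →L[ℝ] ℝ :=
    ∑ i, η i • (ContinuousLinearMap.proj i : (Fin n → ℝ) →L[ℝ] ℝ) with hL
  have hLa : ∀ w, L w = η ⬝ᵥ w := fun w => by simp [hL, dotProduct]
  have hd : HasFDerivWithinAt D.ω (D.gradCLM u) C u := h.hasGrad u hcore
  have hd2 : HasFDerivWithinAt (fun w => L w + (2 * D.width C ^ 2)⁻¹ * D.ω w)
      (L + (2 * D.width C ^ 2)⁻¹ • D.gradCLM u) C u :=
    L.hasFDerivAt.hasFDerivWithinAt.add (hd.const_mul _)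
  have hm : IsMinOn (fun w => L w + (2 * D.width C ^ 2)⁻¹ * D.ω w) C u := by
    intro w hw
    have := hmin w hw
    simp only [Set.mem_ofPred_eq, hLa]
    rw [div_eq_inv_mul, div_eq_inv_mul] at this
    exact this
  have key := IsLocalMinOn.hasFDerivWithinAt_nonneg hm.localize hd2
    (sub_mem_posTangentConeAt_of_segment_subset (hC.segment_subset hu hv))
  simp only [add_apply, smul_apply, hLa,
    gradCLM_apply, smul_eq_mul] at key
  rw [div_eq_inv_mul]
  exact key

/-- Young's inequality between the dual norm of `ζ` and `‖u - v‖`, whose square is dominated by the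
Bregman divergence. The difference of the two sides is the explicit square in the proof. -/
lemma young_bregman (hC : Convex ℝ C) (hc : IsCompact C) (h : D.IsDGFOn C)
    (ζ : Fin n → ℝ) {u v : Fin n → ℝ} (hu : u ∈ D.core C) (hv : v ∈ C) :
    ζ ⬝ᵥ (u - v) - (D.ω v - D.ω u - D.grad u ⬝ᵥ (v - u)) / (2 * D.width C ^ 2) ≤
      2 * D.width C ^ 2 / D.α * dualNorm D.nrm ζ ^ 2 / 2 := by
  have hα := h.α_pos
  by_cases hw : D.width C = 0
  · rw [eq_of_width_eq_zero hC hc h hw hv hu.1, hw]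
    simp
  · have hw2 : 0 < D.width C ^ 2 := by positivity
    have h1 := dot_le_dualNorm_mul h.nrm_definite ζ (u - v)
    have h2 := h.bregman_lower hC hu hv
    set t := dualNorm D.nrm ζ
    set s := D.nrm (u - v)
    set W := D.width C ^ 2
    have h3 : D.α / 2 * s ^ 2 / (2 * W) ≤
        (D.ω v - D.ω u - D.grad u ⬝ᵥ (v - u)) / (2 * W) := by gcongr
    have h4 : t * s - D.α / 2 * s ^ 2 / (2 * W) ≤ 2 * W / D.α * t ^ 2 / 2 := by
      have : 2 * W / D.α * t ^ 2 / 2 - (t * s - D.α / 2 * s ^ 2 / (2 * W)) =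
          (2 * W * t - D.α * s) ^ 2 / (4 * W * D.α) := by
        field_simp
        ring
      have h5 : 0 ≤ (2 * W * t - D.α * s) ^ 2 / (4 * W * D.α) := by positivity
      linarith
    linarith

end DGF

namespace SOEC

variable {d m : ℕ} {Ξ : Fin (m + 1) → Type*} [∀ i, MeasurableSpace (Ξ i)] {S : SOEC d m Ξ}

lemma isCompact_Y : IsCompact S.Y := isCompact_stdSimplex ℝ (Fin (m + 1))

lemma convex_Y : Convex ℝ S.Y := convex_stdSimplex ℝ _

lemma single_mem_Y (i : Fin (m + 1)) : Pi.single i 1 ∈ S.Y := single_mem_stdSimplex ℝ i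

/-- Geometric part of the standing assumptions. -/
structure Geometric (S : SOEC d m Ξ) : Prop where
  X_nonempty : S.X.Nonempty
  X_compact : IsCompact S.X
  X_convex : Convex ℝ S.X
  dx_dgf : S.dx.IsDGFOn S.X
  dy_dgf : S.dy.IsDGFOn S.Y

lemma Standing.geometric {r0 : ℝ} (h : S.Standing r0) : S.Geometric :=
  ⟨h.X_nonempty, h.X_compact, h.X_convex, h.dx_dgf, h.dy_dgf⟩

/-- The product of the sets on which the two distance generating functions are differentiable. -/
def coreZ (S : SOEC d m Ξ) : Set ((Fin d → ℝ) × (Fin (m + 1) → ℝ)) :=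
  S.dx.core S.X ×ˢ S.dy.core S.Y

lemma coreZ_subset : S.coreZ ⊆ S.Z := Set.prod_mono DGF.core_subset DGF.core_subset

/-- Minimizer over `𝒵` of `ω_z` plus a linear function. -/
noncomputable def linMin (S : SOEC d m Ξ) (η : (Fin d → ℝ) × (Fin (m + 1) → ℝ)) :
    (Fin d → ℝ) × (Fin (m + 1) → ℝ) :=
  argminOn S.Z fun z => η.1 ⬝ᵥ z.1 + η.2 ⬝ᵥ z.2 + S.omegaZ z

/-- The linear term of the proximal problem. -/
noncomputable def proxArg (S : SOEC d m Ξ) (z ζ : (Fin d → ℝ) × (Fin (m + 1) → ℝ)) :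
    (Fin d → ℝ) × (Fin (m + 1) → ℝ) :=
  (ζ.1 - (2 * S.Dx ^ 2)⁻¹ • S.dx.grad z.1, ζ.2 - (2 * S.Dy ^ 2)⁻¹ • S.dy.grad z.2)

/-- The two objectives differ by a constant, so they have the same minimizers and `argminOn` chooses
the same one. Continuity of the prox-mapping reduces to continuity of `linMin` in one linear
parameter. -/
lemma prox_eq_linMin (z ζ : (Fin d → ℝ) × (Fin (m + 1) → ℝ)) :
    S.prox z ζ = S.linMin (S.proxArg z ζ) := by
  unfold prox linMin argminOn
  congr 1
  ext u
  have key : ∃ c : ℝ, ∀ w, ζ.1 ⬝ᵥ (w.1 - z.1) + ζ.2 ⬝ᵥ (w.2 - z.2) + S.V z w =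
      (S.proxArg z ζ).1 ⬝ᵥ w.1 + (S.proxArg z ζ).2 ⬝ᵥ w.2 + S.omegaZ w + c := by
    refine ⟨-(ζ.1 ⬝ᵥ z.1) - ζ.2 ⬝ᵥ z.2 - S.omegaZ z + S.dx.grad z.1 ⬝ᵥ z.1 / (2 * S.Dx ^ 2)
      + S.dy.grad z.2 ⬝ᵥ z.2 / (2 * S.Dy ^ 2), fun w => ?_⟩
    simp only [proxArg, V, sub_dotProduct, dotProduct_sub, smul_dotProduct, smul_eq_mul]
    ring
  obtain ⟨c, hc⟩ := key
  simp only [isMinOn_iff, hc, add_le_add_iff_right]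

lemma Geometric.isCompact_Z (h : S.Geometric) : IsCompact S.Z := h.X_compact.prod isCompact_Y

lemma Geometric.Z_nonempty (h : S.Geometric) : S.Z.Nonempty :=
  h.X_nonempty.prod ⟨_, single_mem_Y 0⟩

lemma Geometric.continuousOn_omegaZ (h : S.Geometric) : ContinuousOn S.omegaZ S.Z := by
  have h1 : ContinuousOn (fun z : (Fin d → ℝ) × (Fin (m + 1) → ℝ) => S.dx.ω z.1) S.Z :=
    h.dx_dgf.continuousOn.comp continuousOn_fst fun z hz => hz.1
  have h2 : ContinuousOn (fun z : (Fin d → ℝ) × (Fin (m + 1) → ℝ) => S.dy.ω z.2) S.Z :=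
    h.dy_dgf.continuousOn.comp continuousOn_snd fun z hz => hz.2
  exact (h1.div_const _).add (h2.div_const _)

lemma Geometric.linMin_spec (h : S.Geometric) (η : (Fin d → ℝ) × (Fin (m + 1) → ℝ)) :
    S.linMin η ∈ S.Z ∧ ∀ z ∈ S.Z, η.1 ⬝ᵥ (S.linMin η).1 + η.2 ⬝ᵥ (S.linMin η).2 +
      S.omegaZ (S.linMin η) ≤ η.1 ⬝ᵥ z.1 + η.2 ⬝ᵥ z.2 + S.omegaZ z := by
  have hcont : ContinuousOn
      (fun z : (Fin d → ℝ) × (Fin (m + 1) → ℝ) => η.1 ⬝ᵥ z.1 + η.2 ⬝ᵥ z.2 + S.omegaZ z) S.Z := by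
    refine ContinuousOn.add (Continuous.continuousOn ?_) h.continuousOn_omegaZ
    simp only [dotProduct]
    fun_prop
  obtain ⟨z, hz, hm⟩ := h.isCompact_Z.exists_isMinOn h.Z_nonempty hcont
  exact argminOn_spec ⟨z, hz, hm⟩

lemma linMin_zero : S.linMin 0 = argminOn S.Z S.omegaZ := by
  simp [linMin]

section Blocks

variable (h : S.Geometric) (η : (Fin d → ℝ) × (Fin (m + 1) → ℝ))
  {z : (Fin d → ℝ) × (Fin (m + 1) → ℝ)} (hz : z ∈ S.Z)
  (hmin : ∀ u ∈ S.Z, η.1 ⬝ᵥ z.1 + η.2 ⬝ᵥ z.2 + S.omegaZ z ≤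
    η.1 ⬝ᵥ u.1 + η.2 ⬝ᵥ u.2 + S.omegaZ u)
include hz hmin

lemma block_fst_min {v : Fin d → ℝ} (hv : v ∈ S.X) :
    η.1 ⬝ᵥ z.1 + S.dx.ω z.1 / (2 * S.dx.width S.X ^ 2) ≤
      η.1 ⬝ᵥ v + S.dx.ω v / (2 * S.dx.width S.X ^ 2) := by
  have := hmin (v, z.2) ⟨hv, hz.2⟩
  simp only [omegaZ, Dx] at this
  linarith

lemma block_snd_min {v : Fin (m + 1) → ℝ} (hv : v ∈ S.Y) :
    η.2 ⬝ᵥ z.2 + S.dy.ω z.2 / (2 * S.dy.width S.Y ^ 2) ≤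
      η.2 ⬝ᵥ v + S.dy.ω v / (2 * S.dy.width S.Y ^ 2) := by
  have := hmin (z.1, v) ⟨hz.1, hv⟩
  simp only [omegaZ, Dy] at this
  linarith

include h

lemma mem_coreZ_of_min : z ∈ S.coreZ :=
  ⟨DGF.mem_core_of_isMinOn h.X_convex h.X_compact h.dx_dgf hz.1
      fun _ hv => block_fst_min η hz hmin hv,
    DGF.mem_core_of_isMinOn convex_Y isCompact_Y h.dy_dgf hz.2
      fun _ hv => block_snd_min η hz hmin hv⟩

lemma optimality_of_min {u : (Fin d → ℝ) × (Fin (m + 1) → ℝ)} (hu : u ∈ S.Z) :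
    0 ≤ η.1 ⬝ᵥ (u.1 - z.1) + η.2 ⬝ᵥ (u.2 - z.2) +
      (S.dx.grad z.1 ⬝ᵥ (u.1 - z.1) / (2 * S.Dx ^ 2) +
        S.dy.grad z.2 ⬝ᵥ (u.2 - z.2) / (2 * S.Dy ^ 2)) := by
  have h1 := DGF.optimality_of_isMinOn h.X_convex h.X_compact h.dx_dgf hz.1
      (fun _ hv => block_fst_min η hz hmin hv) hu.1
  have h2 := DGF.optimality_of_isMinOn convex_Y isCompact_Y h.dy_dgf hz.2
      (fun _ hv => block_snd_min η hz hmin hv) hu.2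
  simp only [Dx, Dy]
  linarith

/-- Minimizers of `ω_z` plus a linear function are unique. -/
lemma eq_of_min {u : (Fin d → ℝ) × (Fin (m + 1) → ℝ)} (hu : u ∈ S.Z)
    (hle : η.1 ⬝ᵥ u.1 + η.2 ⬝ᵥ u.2 + S.omegaZ u ≤ η.1 ⬝ᵥ z.1 + η.2 ⬝ᵥ z.2 + S.omegaZ z) :
    u = z := by
  have hc := mem_coreZ_of_min h η hz hmin
  have ho := optimality_of_min h η hz hmin hu
  have b1 := h.dx_dgf.bregman_lower h.X_convex hc.1 hu.1
  have b2 := h.dy_dgf.bregman_lower convex_Y hc.2 hu.2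
  have hαx := h.dx_dgf.α_pos
  have hαy := h.dy_dgf.α_pos
  have c1 : S.dx.α / 2 * S.dx.nrm (z.1 - u.1) ^ 2 / (2 * S.Dx ^ 2) ≤
      (S.dx.ω u.1 - S.dx.ω z.1 - S.dx.grad z.1 ⬝ᵥ (u.1 - z.1)) / (2 * S.Dx ^ 2) := by gcongr
  have c2 : S.dy.α / 2 * S.dy.nrm (z.2 - u.2) ^ 2 / (2 * S.Dy ^ 2) ≤
      (S.dy.ω u.2 - S.dy.ω z.2 - S.dy.grad z.2 ⬝ᵥ (u.2 - z.2)) / (2 * S.Dy ^ 2) := by gcongr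
  have p1 : 0 ≤ S.dx.α / 2 * S.dx.nrm (z.1 - u.1) ^ 2 / (2 * S.Dx ^ 2) := by positivity
  have p2 : 0 ≤ S.dy.α / 2 * S.dy.nrm (z.2 - u.2) ^ 2 / (2 * S.Dy ^ 2) := by positivity
  -- Minimality of `z`, in its first-order form, and the assumption that `u` does no worse leave no
  -- room for a positive Bregman divergence from `z` to `u`.
  have hsum : S.dx.α / 2 * S.dx.nrm (z.1 - u.1) ^ 2 / (2 * S.Dx ^ 2) +
      S.dy.α / 2 * S.dy.nrm (z.2 - u.2) ^ 2 / (2 * S.Dy ^ 2) ≤ 0 := by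
    simp only [omegaZ] at hle
    simp only [dotProduct_sub] at ho c1 c2
    rw [sub_div, sub_div] at c1 c2
    linarith
  have e1 : S.dx.α / 2 * S.dx.nrm (z.1 - u.1) ^ 2 / (2 * S.Dx ^ 2) = 0 := by linarith
  have e2 : S.dy.α / 2 * S.dy.nrm (z.2 - u.2) ^ 2 / (2 * S.Dy ^ 2) = 0 := by linarith
  refine Prod.ext ?_ ?_
  · by_cases hw : S.dx.width S.X = 0
    · exact DGF.eq_of_width_eq_zero h.X_convex h.X_compact h.dx_dgf hw hu.1 hz.1
    · have hne : S.Dx ≠ 0 := hw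
      have : S.dx.nrm (z.1 - u.1) = 0 := by simpa [hne, hαx.ne'] using e1
      exact (sub_eq_zero.1 (h.dx_dgf.nrm_definite _ this)).symm
  · by_cases hw : S.dy.width S.Y = 0
    · exact DGF.eq_of_width_eq_zero convex_Y isCompact_Y h.dy_dgf hw hu.2 hz.2
    · have hne : S.Dy ≠ 0 := hw
      have : S.dy.nrm (z.2 - u.2) = 0 := by simpa [hne, hαy.ne'] using e2
      exact (sub_eq_zero.1 (h.dy_dgf.nrm_definite _ this)).symm

end Blocks

lemma Geometric.linMin_mem_coreZ (h : S.Geometric) (η : (Fin d → ℝ) × (Fin (m + 1) → ℝ)) :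
    S.linMin η ∈ S.coreZ :=
  mem_coreZ_of_min h η (h.linMin_spec η).1 (h.linMin_spec η).2

lemma Geometric.prox_mem_coreZ (h : S.Geometric) (z ζ : (Fin d → ℝ) × (Fin (m + 1) → ℝ)) :
    S.prox z ζ ∈ S.coreZ := by
  rw [prox_eq_linMin]
  exact h.linMin_mem_coreZ _

lemma Geometric.start_mem_coreZ (h : S.Geometric) : argminOn S.Z S.omegaZ ∈ S.coreZ := by
  rw [← linMin_zero]
  exact h.linMin_mem_coreZ _

/-- The squared dual norm matching `ω_z`. -/
noncomputable def dualSq (S : SOEC d m Ξ) (ζ : (Fin d → ℝ) × (Fin (m + 1) → ℝ)) : ℝ :=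
  2 * S.Dx ^ 2 / S.dx.α * dualNorm S.dx.nrm ζ.1 ^ 2 +
    2 * S.Dy ^ 2 / S.dy.α * dualNorm S.dy.nrm ζ.2 ^ 2

/-- The three-point inequality. The optimality condition at the new point `w` handles `ζ` against `w
- u`; the remaining `ζ` against `z - w` is absorbed by `V z w` through `young_bregman`. -/
lemma Geometric.prox_step (h : S.Geometric) {z u : (Fin d → ℝ) × (Fin (m + 1) → ℝ)}
    (ζ : (Fin d → ℝ) × (Fin (m + 1) → ℝ)) (hz : z ∈ S.coreZ) (hu : u ∈ S.Z) :
    ζ.1 ⬝ᵥ (z.1 - u.1) + ζ.2 ⬝ᵥ (z.2 - u.2) ≤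
      S.V z u - S.V (S.prox z ζ) u + S.dualSq ζ / 2 := by
  have hs := h.linMin_spec (S.proxArg z ζ)
  have hcore := h.prox_mem_coreZ z ζ
  have ho := optimality_of_min h (S.proxArg z ζ) hs.1 hs.2 hu
  rw [← prox_eq_linMin] at ho
  set w := S.prox z ζ
  have y1 := DGF.young_bregman h.X_convex h.X_compact h.dx_dgf ζ.1 hz.1 (coreZ_subset hcore).1
  have y2 := DGF.young_bregman convex_Y isCompact_Y h.dy_dgf ζ.2 hz.2 (coreZ_subset hcore).2
  simp only [proxArg, sub_dotProduct, dotProduct_sub, smul_dotProduct, smul_eq_mul] at ho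
  simp only [dotProduct_sub] at y1 y2
  simp only [V, omegaZ, dualSq, dotProduct_sub, Dx, Dy] at *
  ring_nf at *
  linarith

lemma Geometric.V_nonneg (h : S.Geometric) {z u : (Fin d → ℝ) × (Fin (m + 1) → ℝ)}
    (hz : z ∈ S.coreZ) (hu : u ∈ S.Z) : 0 ≤ S.V z u := by
  have b1 := h.dx_dgf.bregman_lower h.X_convex hz.1 hu.1
  have b2 := h.dy_dgf.bregman_lower convex_Y hz.2 hu.2
  have hαx := h.dx_dgf.α_pos
  have hαy := h.dy_dgf.α_pos
  have c1 : 0 ≤ (S.dx.ω u.1 - S.dx.ω z.1 - S.dx.grad z.1 ⬝ᵥ (u.1 - z.1)) / (2 * S.Dx ^ 2) :=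
    div_nonneg (le_trans (by positivity) b1) (by positivity)
  have c2 : 0 ≤ (S.dy.ω u.2 - S.dy.ω z.2 - S.dy.grad z.2 ⬝ᵥ (u.2 - z.2)) / (2 * S.Dy ^ 2) :=
    div_nonneg (le_trans (by positivity) b2) (by positivity)
  simp only [V, omegaZ]
  ring_nf at *
  linarith

/-- At a minimizer of `ω_z` the linear term of `V` only helps, and the normalization of `ω_z` makes
each block vary by at most `1 / 2`. -/
lemma Geometric.V_start_le (h : S.Geometric) {u : (Fin d → ℝ) × (Fin (m + 1) → ℝ)}
    (hu : u ∈ S.Z) : S.V (argminOn S.Z S.omegaZ) u ≤ 1 := by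
  have hs := h.linMin_spec 0
  have ho := optimality_of_min h 0 hs.1 hs.2 hu
  rw [linMin_zero] at ho hs
  set z := argminOn S.Z S.omegaZ
  have d1 := DGF.sub_le_width_sq h.X_compact h.dx_dgf hu.1 hs.1.1
  have d2 := DGF.sub_le_width_sq isCompact_Y h.dy_dgf hu.2 hs.1.2
  have e1 : (S.dx.ω u.1 - S.dx.ω z.1) / (2 * S.Dx ^ 2) ≤ 1 / 2 := by
    refine div_le_of_le_mul₀ (by positivity) (by norm_num) ?_
    simp only [Dx]; linarith
  have e2 : (S.dy.ω u.2 - S.dy.ω z.2) / (2 * S.Dy ^ 2) ≤ 1 / 2 := by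
    refine div_le_of_le_mul₀ (by positivity) (by norm_num) ?_
    simp only [Dy]; linarith
  simp only [Prod.fst_zero, Prod.snd_zero, zero_dotProduct] at ho
  simp only [V, omegaZ]
  rw [sub_div] at e1 e2
  linarith

/-- Regret of mirror descent along an arbitrary sequence of directions. -/
lemma Geometric.regret (h : S.Geometric) (z ζ : ℕ → (Fin d → ℝ) × (Fin (m + 1) → ℝ))
    (h0 : z 0 = argminOn S.Z S.omegaZ) (hstep : ∀ t, z (t + 1) = S.prox (z t) (ζ t))
    {u : (Fin d → ℝ) × (Fin (m + 1) → ℝ)} (hu : u ∈ S.Z) (n : ℕ) :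
    ∑ t ∈ Finset.range n, ((ζ t).1 ⬝ᵥ ((z t).1 - u.1) + (ζ t).2 ⬝ᵥ ((z t).2 - u.2)) ≤
      1 + (∑ t ∈ Finset.range n, S.dualSq (ζ t)) / 2 := by
  have hcore : ∀ t, z t ∈ S.coreZ := by
    intro t
    cases t with
    | zero => rw [h0]; exact h.start_mem_coreZ
    | succ t => rw [hstep]; exact h.prox_mem_coreZ _ _
  have key : ∑ t ∈ Finset.range n, ((ζ t).1 ⬝ᵥ ((z t).1 - u.1) + (ζ t).2 ⬝ᵥ ((z t).2 - u.2)) ≤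
      S.V (z 0) u - S.V (z n) u + (∑ t ∈ Finset.range n, S.dualSq (ζ t)) / 2 := by
    induction n with
    | zero => simp
    | succ n ih =>
      rw [Finset.sum_range_succ, Finset.sum_range_succ]
      have := h.prox_step (ζ n) (hcore n) hu
      rw [← hstep] at this
      linarith
  have h1 := h.V_nonneg (hcore n) hu
  have h2 := h.V_start_le hu
  rw [h0] at key
  linarith

end SOEC

end SFLS

/-! ### Continuity of the prox-mapping and measurability of the iterates. -/

namespace SFLS

namespace SOEC

variable {d m : ℕ} {Ξ : Fin (m + 1) → Type*} [∀ i, MeasurableSpace (Ξ i)] {S : SOEC d m Ξ}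

/-- On a compact set it suffices that every cluster point of `linMin η'` as `η'` tends to `η` is the
unique minimizer for `η`; minimality passes to the limit. This makes the chosen minimizers
measurable in the data. -/
lemma Geometric.continuous_linMin (h : S.Geometric) : Continuous S.linMin := by
  rw [continuous_iff_continuousAt]
  intro η
  refine h.isCompact_Z.tendsto_nhds_of_unique_mapClusterPt
    (Filter.Eventually.of_forall fun η' => (h.linMin_spec η').1) fun z hz hcl => ?_
  obtain ⟨U, hU, hlim⟩ := mapClusterPt_iff_ultrafilter.1 hcl
  refine eq_of_min h η (h.linMin_spec η).1 (h.linMin_spec η).2 hz ?_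
  have hη : Filter.Tendsto (fun η' : (Fin d → ℝ) × (Fin (m + 1) → ℝ) => η') U (nhds η) := hU
  have hω : Filter.Tendsto (fun η' => S.omegaZ (S.linMin η')) U (nhds (S.omegaZ z)) := by
    have h1 := (h.continuousOn_omegaZ z hz).tendsto
    refine h1.comp (tendsto_nhdsWithin_iff.2 ⟨hlim, ?_⟩)
    exact Filter.Eventually.of_forall fun η' => (h.linMin_spec η').1
  have hdot : ∀ {n : ℕ} (a b : (Fin d → ℝ) × (Fin (m + 1) → ℝ) → (Fin n → ℝ)) (a' b' : Fin n → ℝ),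
      Filter.Tendsto a U (nhds a') → Filter.Tendsto b U (nhds b') →
      Filter.Tendsto (fun e => a e ⬝ᵥ b e) U (nhds (a' ⬝ᵥ b')) := by
    intro n a b a' b' ha hb
    simp only [dotProduct]
    exact tendsto_finsetSum _ fun i _ =>
      ((tendsto_pi_nhds.1 ha) i).mul ((tendsto_pi_nhds.1 hb) i)
  have h1 := (continuous_fst.tendsto _).comp hη
  have h2 := (continuous_snd.tendsto _).comp hη
  have l1 := (continuous_fst.tendsto _).comp hlim
  have l2 := (continuous_snd.tendsto _).comp hlim
  exact le_of_tendsto_of_tendsto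
    (((hdot _ _ _ _ h1 l1).add (hdot _ _ _ _ h2 l2)).add hω)
    (((hdot _ _ _ _ h1 tendsto_const_nhds).add (hdot _ _ _ _ h2 tendsto_const_nhds)).add
      tendsto_const_nhds)
    (Filter.Eventually.of_forall fun η' => (h.linMin_spec η').2 _ (h.linMin_spec η).1)

section Measurability

variable {Ω : Type*} {mΩ : MeasurableSpace Ω}

lemma measurable_of_continuousOn {E F : Type*} [TopologicalSpace E] [MeasurableSpace E]
    [BorelSpace E] [TopologicalSpace F] [MeasurableSpace F] [BorelSpace F] {g : E → F}
    {C : Set E} (hg : ContinuousOn g C) {u : Ω → E} (hu : Measurable u) (hmem : ∀ w, u w ∈ C) :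
    Measurable fun w => g (u w) :=
  (continuousOn_iff_continuous_domRestrict.1 hg).measurable.comp
    (hu.subtype_mk (h := hmem))

lemma measurable_smul_pi {n : ℕ} (c : ℝ) {g : Ω → Fin n → ℝ} (hg : Measurable g) :
    Measurable fun w => c • g w :=
  hg.const_smul c

lemma Geometric.measurable_prox (h : S.Geometric)
    {z ζ : Ω → (Fin d → ℝ) × (Fin (m + 1) → ℝ)} (hz : Measurable z)
    (hmem : ∀ w, z w ∈ S.coreZ) (hζ : Measurable ζ) :
    Measurable fun w => S.prox (z w) (ζ w) := by
  simp only [prox_eq_linMin]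
  refine h.continuous_linMin.measurable.comp ?_
  have g1 : Measurable fun w => S.dx.grad (z w).1 :=
    measurable_of_continuousOn h.dx_dgf.grad_continuousOn hz.fst fun w => (hmem w).1
  have g2 : Measurable fun w => S.dy.grad (z w).2 :=
    measurable_of_continuousOn h.dy_dgf.grad_continuousOn hz.snd fun w => (hmem w).2
  exact (hζ.fst.sub (measurable_smul_pi _ g1)).prodMk (hζ.snd.sub (measurable_smul_pi _ g2))

variable {r0 : ℝ} (hS : S.Standing r0)
include hS

/-- `F i` is a Carathéodory function, continuous in `x` and measurable in the sample, hence jointly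
measurable on `S.X × Ξ i`. -/
lemma Standing.measurable_F (i : Fin (m + 1)) {x : Ω → Fin d → ℝ} {ξ : Ω → ∀ i, Ξ i}
    (hx : Measurable x) (hmem : ∀ w, x w ∈ S.X) (hξ : Measurable ξ) :
    Measurable fun w => S.F i (x w) (ξ w i) := by
  have h1 : Measurable (Function.uncurry fun (x : S.X) (ω : Ξ i) => S.F i x ω) :=
    measurable_uncurry_of_continuous_of_measurable
      (fun ω => continuousOn_iff_continuous_domRestrict.1 (hS.F_continuousOn i ω))
      (fun x => hS.F_measurable i x x.2)
  exact h1.comp ((hx.subtype_mk (h := hmem)).prodMk ((measurable_pi_apply i).comp hξ))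

lemma Standing.measurable_F' (i : Fin (m + 1)) {x : Ω → Fin d → ℝ} {ξ : Ω → ∀ i, Ξ i}
    (hx : Measurable x) (hmem : ∀ w, x w ∈ S.X) (hξ : Measurable ξ) :
    Measurable fun w => S.F' i (x w) (ξ w i) :=
  (hS.F'_measurable i).comp
    ((hx.subtype_mk (h := hmem)).prodMk ((measurable_pi_apply i).comp hξ))

lemma Standing.measurable_f (i : Fin (m + 1)) {x : Ω → Fin d → ℝ}
    (hx : Measurable x) (hmem : ∀ w, x w ∈ S.X) : Measurable fun w => S.f i (x w) := by
  have := hS.law_prob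
  have h1 : Measurable fun q : Ω × (∀ i, Ξ i) => S.F i (x q.1) (q.2 i) :=
    hS.measurable_F i (hx.comp measurable_fst) (fun q => hmem q.1) measurable_snd
  exact (h1.stronglyMeasurable.integral_prod_right' (ν := S.law)).measurable

omit hS in
lemma measurable_rhs {ρ : Ω → ℝ} (hρ : Measurable ρ) (i : Fin (m + 1)) :
    Measurable fun w => S.rhs (ρ w) i := by
  refine Fin.cases ?_ (fun j => ?_) i
  · simpa [rhs] using hρ
  · simp [rhs]

lemma Standing.measurable_Gx {x : Ω → Fin d → ℝ} {y : Ω → Fin (m + 1) → ℝ} {ξ : Ω → ∀ i, Ξ i}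
    (hx : Measurable x) (hmem : ∀ w, x w ∈ S.X) (hy : Measurable y) (hξ : Measurable ξ) :
    Measurable fun w => S.Gx (x w) (y w) (ξ w) := by
  unfold Gx
  refine Finset.measurable_fun_sum _ fun i _ => ?_
  exact ((measurable_pi_apply i).comp hy).smul (hS.measurable_F' i hx hmem hξ)

lemma Standing.measurable_Gy {ρ : Ω → ℝ} {x : Ω → Fin d → ℝ} {ξ : Ω → ∀ i, Ξ i}
    (hρ : Measurable ρ) (hx : Measurable x) (hmem : ∀ w, x w ∈ S.X) (hξ : Measurable ξ) :
    Measurable fun w => S.Gy (ρ w) (x w) (ξ w) := by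
  refine measurable_pi_lambda _ fun i => ?_
  exact (hS.measurable_F i hx hmem hξ).sub (measurable_rhs hρ i)

lemma Standing.measurable_Phi {ρ : Ω → ℝ} {x : Ω → Fin d → ℝ} {y : Ω → Fin (m + 1) → ℝ}
    {ξ : Ω → ∀ i, Ξ i} (hρ : Measurable ρ) (hx : Measurable x) (hmem : ∀ w, x w ∈ S.X)
    (hy : Measurable y) (hξ : Measurable ξ) :
    Measurable fun w => S.Phi (ρ w) (x w) (y w) (ξ w) := by
  unfold Phi
  refine Finset.measurable_fun_sum _ fun i _ => ?_
  exact ((measurable_pi_apply i).comp hy).mul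
    ((hS.measurable_F i hx hmem hξ).sub (measurable_rhs hρ i))

omit hS in
lemma Geometric.iter_mem_coreZ (h : S.Geometric) (ρ : ℝ) (η : ℕ → ∀ i, Ξ i) (t : ℕ) :
    S.iter ρ η t ∈ S.coreZ := by
  cases t with
  | zero => exact h.start_mem_coreZ
  | succ t => exact h.prox_mem_coreZ _ _

/-- Only samples with index below `t` are required to be measurable and the σ-algebra is arbitrary,
so the lemma applies to the σ-algebra generated by the past. -/
lemma Standing.measurable_iter {ρ : Ω → ℝ} (hρ : Measurable ρ) {η : Ω → ℕ → ∀ i, Ξ i} (t : ℕ)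
    (hη : ∀ s < t, Measurable fun w => η w s) :
    Measurable fun w => S.iter (ρ w) (η w) t := by
  have h := hS.geometric
  induction t with
  | zero => exact measurable_const
  | succ t ih =>
    have ih' := ih fun s hs => hη s (hs.trans (Nat.lt_succ_self t))
    have hmem : ∀ w, S.iter (ρ w) (η w) t ∈ S.coreZ := fun w => h.iter_mem_coreZ _ _ _
    have hx : ∀ w, (S.iter (ρ w) (η w) t).1 ∈ S.X := fun w => (coreZ_subset (hmem w)).1
    have hηt := hη t (Nat.lt_succ_self t)
    refine h.measurable_prox ih' hmem (Measurable.prodMk ?_ ?_)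
    · exact measurable_smul_pi _ (hS.measurable_Gx ih'.fst hx ih'.snd hηt)
    · exact measurable_neg.comp (measurable_smul_pi _ (hS.measurable_Gy hρ ih'.fst hx hηt))

/-- The auxiliary mirror descent sequence driven by the noise of the constraint values. -/
noncomputable def aux (S : SOEC d m Ξ) (ρ : ℝ) (η : ℕ → ∀ i, Ξ i) :
    ℕ → (Fin d → ℝ) × (Fin (m + 1) → ℝ)
  | 0 => argminOn S.Z S.omegaZ
  | t + 1 => S.prox (aux S ρ η t)
      (0, S.γ t • fun i => S.F i (S.iter ρ η t).1 (η t i) - S.f i (S.iter ρ η t).1)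

omit hS in
lemma Geometric.aux_mem_coreZ (h : S.Geometric) (ρ : ℝ) (η : ℕ → ∀ i, Ξ i) (t : ℕ) :
    S.aux ρ η t ∈ S.coreZ := by
  cases t with
  | zero => exact h.start_mem_coreZ
  | succ t => exact h.prox_mem_coreZ _ _

lemma Standing.measurable_aux {ρ : Ω → ℝ} (hρ : Measurable ρ) {η : Ω → ℕ → ∀ i, Ξ i} (t : ℕ)
    (hη : ∀ s < t, Measurable fun w => η w s) :
    Measurable fun w => S.aux (ρ w) (η w) t := by
  have h := hS.geometric
  induction t with
  | zero => exact measurable_const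
  | succ t ih =>
    have ih' := ih fun s hs => hη s (hs.trans (Nat.lt_succ_self t))
    have hit := hS.measurable_iter hρ t fun s hs => hη s (hs.trans (Nat.lt_succ_self t))
    have hmem : ∀ w, S.aux (ρ w) (η w) t ∈ S.coreZ := fun w => h.aux_mem_coreZ _ _ _
    have hx : ∀ w, (S.iter (ρ w) (η w) t).1 ∈ S.X :=
      fun w => (coreZ_subset (h.iter_mem_coreZ _ _ _)).1
    have hηt := hη t (Nat.lt_succ_self t)
    refine h.measurable_prox ih' hmem (measurable_const.prodMk ?_)
    refine measurable_smul_pi _ (measurable_pi_lambda _ fun i => ?_)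
    exact (hS.measurable_F i hit.fst hx hηt).sub (hS.measurable_f i hit.fst hx)

end Measurability

end SOEC

end SFLS

/-! ### Expected values, subgradients, and the mean of the constraint gradient. -/

namespace SFLS

lemma integrable_of_lintegral_exp_le {Ω : Type*} [MeasurableSpace Ω] {ν : Measure Ω} {g : Ω → ℝ}
    {a : ℝ} (hg : Measurable g) (h : ∫⁻ ω, ENNReal.ofReal (Real.exp (g ω)) ∂ν ≤ ENNReal.ofReal a)
    (ha : 0 ≤ a) :
    Integrable (fun ω => Real.exp (g ω)) ν ∧ ∫ ω, Real.exp (g ω) ∂ν ≤ a := by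
  have hm : Measurable fun ω => Real.exp (g ω) := Real.measurable_exp.comp hg
  have hi : Integrable (fun ω => Real.exp (g ω)) ν := by
    refine ⟨hm.aestronglyMeasurable, ?_⟩
    rw [hasFiniteIntegral_iff_ofReal (Filter.Eventually.of_forall fun ω => (Real.exp_pos _).le)]
    exact h.trans_lt ENNReal.ofReal_lt_top
  refine ⟨hi, ?_⟩
  rw [← ofReal_integral_eq_lintegral_ofReal hi
    (Filter.Eventually.of_forall fun ω => (Real.exp_pos _).le)] at h
  exact (ENNReal.ofReal_le_ofReal_iff ha).1 h

/-- `∑_{s < n} 1 / √(s + 1)` -/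
noncomputable def rootSum (n : ℕ) : ℝ := ∑ s ∈ Finset.range n, 1 / √((s : ℝ) + 1)

/-- `∑_{s < n} 1 / (s + 1)` -/
noncomputable def harmSum (n : ℕ) : ℝ := ∑ s ∈ Finset.range n, 1 / ((s : ℝ) + 1)

lemma rootSum_pos {n : ℕ} (hn : 0 < n) : 0 < rootSum n :=
  Finset.sum_pos (fun s _ => by positivity) (by simpa using hn.ne')

namespace SOEC

variable {d m : ℕ} {Ξ : Fin (m + 1) → Type*} [∀ i, MeasurableSpace (Ξ i)] {S : SOEC d m Ξ}

lemma Phi_eq_dot (ρ : ℝ) (x : Fin d → ℝ) (y : Fin (m + 1) → ℝ) (ξ : ∀ i, Ξ i) :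
    S.Phi ρ x y ξ = S.Gy ρ x ξ ⬝ᵥ y := by
  simp [Phi, Gy, dotProduct, mul_comm]

lemma P_le_iff {ρ : ℝ} {x : Fin d → ℝ} {a : ℝ} :
    S.P ρ x ≤ a ↔ ∀ i, S.f i x - S.rhs ρ i ≤ a := by
  simp [P, Finset.sup'_le_iff]

lemma le_P (ρ : ℝ) (x : Fin d → ℝ) (i : Fin (m + 1)) : S.f i x - S.rhs ρ i ≤ S.P ρ x :=
  Finset.le_sup' (fun i => S.f i x - S.rhs ρ i) (Finset.mem_univ i)

variable {r0 : ℝ} (hS : S.Standing r0)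
include hS

lemma Standing.phi_eq (ρ : ℝ) {x : Fin d → ℝ} (hx : x ∈ S.X) (y : Fin (m + 1) → ℝ) :
    S.phi ρ x y = ∑ i, y i * (S.f i x - S.rhs ρ i) := by
  have := hS.law_prob
  unfold phi Phi
  have hi : ∀ i, Integrable (fun ξ : ∀ i, Ξ i => y i * (S.F i x (ξ i) - S.rhs ρ i)) S.law :=
    fun i => ((hS.F_integrable i x hx).sub (integrable_const _)).const_mul _
  rw [integral_finsetSum _ fun i _ => hi i]
  refine Finset.sum_congr rfl fun i _ => ?_
  rw [integral_const_mul, integral_sub (hS.F_integrable i x hx) (integrable_const _)]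
  simp [f]

lemma Standing.integrable_Phi (ρ : ℝ) {x : Fin d → ℝ} (hx : x ∈ S.X) (y : Fin (m + 1) → ℝ) :
    Integrable (S.Phi ρ x y) S.law := by
  have := hS.law_prob
  exact integrable_finsetSum _ fun i _ =>
    ((hS.F_integrable i x hx).sub (integrable_const _)).const_mul _

lemma Standing.f_convexOn (i : Fin (m + 1)) : ConvexOn ℝ S.X (S.f i) := by
  refine ⟨hS.X_convex, fun x hx y hy a b ha hb hab => ?_⟩
  have hxy := hS.X_convex hx hy ha hb hab
  simp only [f, smul_eq_mul]
  rw [← integral_const_mul, ← integral_const_mul,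
    ← integral_add ((hS.F_integrable i x hx).const_mul _) ((hS.F_integrable i y hy).const_mul _)]
  refine integral_mono (hS.F_integrable i _ hxy)
    (((hS.F_integrable i x hx).const_mul _).add ((hS.F_integrable i y hy).const_mul _)) fun ξ => ?_
  exact (hS.F_convexOn i (ξ i)).2 hx hy ha hb hab

lemma Standing.phi_le_P (ρ : ℝ) {x : Fin d → ℝ} (hx : x ∈ S.X) {y : Fin (m + 1) → ℝ}
    (hy : y ∈ S.Y) : S.phi ρ x y ≤ S.P ρ x := by
  rw [hS.phi_eq ρ hx]
  calc ∑ i, y i * (S.f i x - S.rhs ρ i) ≤ ∑ i, y i * S.P ρ x :=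
        Finset.sum_le_sum fun i _ => mul_le_mul_of_nonneg_left (S.le_P ρ x i) (hy.1 i)
    _ = S.P ρ x := by rw [← Finset.sum_mul, hy.2, one_mul]

lemma Standing.Phi_subgradient (ρ : ℝ) {x u : Fin d → ℝ} (hx : x ∈ S.X) (hu : u ∈ S.X)
    {y : Fin (m + 1) → ℝ} (hy : y ∈ S.Y) (ξ : ∀ i, Ξ i) :
    S.Phi ρ x y ξ + S.Gx x y ξ ⬝ᵥ (u - x) ≤ S.Phi ρ u y ξ := by
  simp only [Phi, Gx]
  rw [sum_dotProduct, ← Finset.sum_add_distrib]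
  refine Finset.sum_le_sum fun i _ => ?_
  rw [smul_dotProduct, smul_eq_mul, ← mul_add]
  refine mul_le_mul_of_nonneg_left ?_ (hy.1 i)
  linarith [hS.F'_subgradient i (ξ i) x hx u hu]

/-- As `m ≥ 1`, the simplex has two distinct vertices. This is what makes `S.M` positive and the
step lengths meaningful. -/
lemma Standing.Dy_pos : 0 < S.Dy := by
  refine lt_of_le_of_ne (Real.sqrt_nonneg _) fun h0 => ?_
  have hm := hS.m_pos
  obtain ⟨k, rfl⟩ : ∃ k, m = k + 1 := ⟨m - 1, by omega⟩
  have := DGF.eq_of_width_eq_zero convex_Y isCompact_Y hS.dy_dgf h0.symm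
    (single_mem_Y (S := S) 0) (single_mem_Y (S := S) 1)
  have h2 := congrFun this 0
  simp at h2

lemma Standing.M_sq : S.M ^ 2 =
    2 * S.Dx ^ 2 / S.dx.α * S.Mx ^ 2 + 2 * S.Dy ^ 2 / S.dy.α * S.My ^ 2 := by
  have h1 := hS.dx_dgf.α_pos
  have h2 := hS.dy_dgf.α_pos
  exact Real.sq_sqrt (by positivity)

lemma Standing.M_pos : 0 < S.M := by
  have h1 := hS.dx_dgf.α_pos
  have h2 := hS.dy_dgf.α_pos
  have h3 := hS.Dy_pos
  have h4 := hS.My_pos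
  exact Real.sqrt_pos.2 (by positivity)

lemma Standing.measurable_dualNorm_Gy (ρ : ℝ) {x : Fin d → ℝ} (hx : x ∈ S.X) :
    Measurable fun ξ => dualNorm S.dy.nrm (S.Gy ρ x ξ) :=
  (continuous_dualNorm hS.dy_dgf.nrm_definite).measurable.comp
    (hS.measurable_Gy measurable_const measurable_const (fun _ => hx) measurable_id)

/-- The mean of `Gy` paired with `v` is the integral of `Phi` at `v`, for any vector `v`. Bounding
the integrand pointwise by an affine function of the light-tail exponential lets the moment
assumption be integrated directly. -/
lemma Standing.dot_mean_Gy_le {ρ : ℝ} (h1 : S.fstar < ρ) (h2 : ρ ≤ r0) {x : Fin d → ℝ}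
    (hx : x ∈ S.X) (v : Fin (m + 1) → ℝ) :
    (fun i => S.f i x - S.rhs ρ i) ⬝ᵥ v ≤ S.My * S.dy.nrm v := by
  have := hS.law_prob
  have hMy := hS.My_pos
  have hm := hS.measurable_dualNorm_Gy ρ hx
  obtain ⟨hi, hle⟩ := integrable_of_lintegral_exp_le ((hm.pow_const 2).div_const (S.My ^ 2))
    (hS.light_y ρ h1 h2 x hx) (Real.exp_pos 1).le
  have e1 : (fun i => S.f i x - S.rhs ρ i) ⬝ᵥ v = ∫ ξ, S.Phi ρ x v ξ ∂S.law := by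
    have := hS.phi_eq ρ hx v
    rw [phi] at this
    rw [this]
    simp [dotProduct, mul_comm]
  rw [e1]
  have hbound : ∀ ξ, S.Phi ρ x v ξ ≤ S.My * S.dy.nrm v / 2 *
      (1 + Real.exp (dualNorm S.dy.nrm (S.Gy ρ x ξ) ^ 2 / S.My ^ 2) * (Real.exp 1)⁻¹) := by
    intro ξ
    rw [Phi_eq_dot]
    refine (dot_le_dualNorm_mul hS.dy_dgf.nrm_definite _ _).trans ?_
    set t := dualNorm S.dy.nrm (S.Gy ρ x ξ)
    -- With `a = t / S.My`, this combines `a ≤ (1 + a ^ 2) / 2` and `a ^ 2 ≤ exp (a ^ 2 - 1)`. The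
    -- mean of the right side is at most `1`.
    have ht : t / S.My ≤ (1 + Real.exp (t ^ 2 / S.My ^ 2) * (Real.exp 1)⁻¹) / 2 := by
      rw [← Real.exp_neg, ← Real.exp_add, ← div_pow]
      have := Real.add_one_le_exp ((t / S.My) ^ 2 + -1)
      nlinarith [sq_nonneg (t / S.My - 1)]
    calc t * S.dy.nrm v = (t / S.My) * (S.My * S.dy.nrm v) := by field_simp
      _ ≤ ((1 + Real.exp (t ^ 2 / S.My ^ 2) * (Real.exp 1)⁻¹) / 2) * (S.My * S.dy.nrm v) := by
        have : 0 ≤ S.dy.nrm v := apply_nonneg _ _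
        gcongr
      _ = _ := by ring
  calc ∫ ξ, S.Phi ρ x v ξ ∂S.law ≤ ∫ ξ, S.My * S.dy.nrm v / 2 *
      (1 + Real.exp (dualNorm S.dy.nrm (S.Gy ρ x ξ) ^ 2 / S.My ^ 2) * (Real.exp 1)⁻¹) ∂S.law :=
        integral_mono (hS.integrable_Phi ρ hx v)
          (((integrable_const _).add (hi.mul_const _)).const_mul _) hbound
    _ = S.My * S.dy.nrm v / 2 * (1 + (∫ ξ, Real.exp (dualNorm S.dy.nrm (S.Gy ρ x ξ) ^ 2 /
          S.My ^ 2) ∂S.law) * (Real.exp 1)⁻¹) := by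
        rw [integral_const_mul, integral_add (integrable_const _) (hi.mul_const _),
          integral_mul_const]
        simp
    _ ≤ S.My * S.dy.nrm v / 2 * (1 + Real.exp 1 * (Real.exp 1)⁻¹) := by
        have : 0 ≤ S.dy.nrm v := apply_nonneg _ _
        gcongr
    _ = S.My * S.dy.nrm v := by
        rw [mul_inv_cancel₀ (Real.exp_pos 1).ne']; ring

lemma Standing.dualNorm_mean_Gy_le {ρ : ℝ} (h1 : S.fstar < ρ) (h2 : ρ ≤ r0) {x : Fin d → ℝ}
    (hx : x ∈ S.X) : dualNorm S.dy.nrm (fun i => S.f i x - S.rhs ρ i) ≤ S.My :=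
  dualNorm_le hS.My_pos.le fun v => hS.dot_mean_Gy_le h1 h2 hx v

end SOEC

end SFLS

/-! ### Pathwise error bounds for one call. -/

namespace SFLS

namespace SOEC

variable {d m : ℕ} {Ξ : Fin (m + 1) → Type*} [∀ i, MeasurableSpace (Ξ i)] {S : SOEC d m Ξ}

/-- `y ↦ ∑_s γ_s Φ(x_s, y, ξ_s) / ∑_s γ_s`, whose maximum over `𝒴` is the validation bound. -/
noncomputable def validation (S : SOEC d m Ξ) (ρ : ℝ) (η : ℕ → ∀ i, Ξ i) (T : ℕ)
    (y : Fin (m + 1) → ℝ) : ℝ :=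
  (∑ s ∈ Finset.range (T + 1), S.γ s)⁻¹ *
    ∑ s ∈ Finset.range (T + 1), S.γ s * (S.Gy ρ (S.iter ρ η s).1 (η s) ⬝ᵥ y)

lemma uhat_eq (ρ : ℝ) (η : ℕ → ∀ i, Ξ i) (T : ℕ) :
    S.uhat ρ η T = sSup (S.validation ρ η T '' S.Y) := by
  unfold uhat validation
  simp only [Phi_eq_dot, dotProduct_sub, add_sub_cancel]

lemma continuous_validation (ρ : ℝ) (η : ℕ → ∀ i, Ξ i) (T : ℕ) :
    Continuous (S.validation ρ η T) := by
  unfold validation dotProduct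
  fun_prop

lemma validation_le_uhat (ρ : ℝ) (η : ℕ → ∀ i, Ξ i) (T : ℕ) {y : Fin (m + 1) → ℝ}
    (hy : y ∈ S.Y) : S.validation ρ η T y ≤ S.uhat ρ η T := by
  rw [uhat_eq]
  exact le_csSup (isCompact_Y.bddAbove_image (continuous_validation ρ η T).continuousOn)
    ⟨y, hy, rfl⟩

lemma uhat_le {ρ : ℝ} {η : ℕ → ∀ i, Ξ i} {T : ℕ} {a : ℝ}
    (h : ∀ y ∈ S.Y, S.validation ρ η T y ≤ a) : S.uhat ρ η T ≤ a := by
  rw [uhat_eq]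
  refine csSup_le ⟨_, _, single_mem_Y 0, rfl⟩ ?_
  rintro _ ⟨y, hy, rfl⟩
  exact h y hy

lemma γ_eq (s : ℕ) : S.γ s = S.M⁻¹ * (1 / √((s : ℝ) + 1)) := by
  rw [γ, one_div, mul_inv, one_div]

lemma sum_γ (n : ℕ) : ∑ s ∈ Finset.range n, S.γ s = S.M⁻¹ * rootSum n := by
  simp only [γ_eq, rootSum, Finset.mul_sum]

variable {r0 : ℝ} (hS : S.Standing r0)
include hS

lemma Standing.γ_sq (s : ℕ) : S.γ s ^ 2 * S.M ^ 2 = 1 / ((s : ℝ) + 1) := by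
  have hM := hS.M_pos
  rw [γ, div_pow, mul_pow, Real.sq_sqrt (by positivity)]
  field_simp

lemma Standing.γ_pos (s : ℕ) : 0 < S.γ s := by
  have hM := hS.M_pos
  rw [γ]; positivity

lemma Standing.dualSq_smul_le (c : ℝ) (ζ : (Fin d → ℝ) × (Fin (m + 1) → ℝ)) :
    S.dualSq (c • ζ) ≤ c ^ 2 * S.dualSq ζ := by
  have h1 := hS.dx_dgf.α_pos
  have h2 := hS.dy_dgf.α_pos
  have a1 := dualNorm_smul_le hS.dx_dgf.nrm_definite c ζ.1
  have a2 := dualNorm_smul_le hS.dy_dgf.nrm_definite c ζ.2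
  have n1 := dualNorm_nonneg hS.dx_dgf.nrm_definite (c • ζ.1)
  have n2 := dualNorm_nonneg hS.dy_dgf.nrm_definite (c • ζ.2)
  have b1 : dualNorm S.dx.nrm (c • ζ.1) ^ 2 ≤ c ^ 2 * dualNorm S.dx.nrm ζ.1 ^ 2 := by
    rw [← sq_abs c, ← mul_pow]; gcongr
  have b2 : dualNorm S.dy.nrm (c • ζ.2) ^ 2 ≤ c ^ 2 * dualNorm S.dy.nrm ζ.2 ^ 2 := by
    rw [← sq_abs c, ← mul_pow]; gcongr
  simp only [dualSq, Prod.smul_fst, Prod.smul_snd]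
  calc _ ≤ 2 * S.Dx ^ 2 / S.dx.α * (c ^ 2 * dualNorm S.dx.nrm ζ.1 ^ 2) +
      2 * S.Dy ^ 2 / S.dy.α * (c ^ 2 * dualNorm S.dy.nrm ζ.2 ^ 2) := by gcongr
    _ = _ := by ring

omit hS in
/-- The normalized squared dual norm of the stochastic gradient at iteration `s`. -/
noncomputable def gradSq (S : SOEC d m Ξ) (ρ : ℝ) (η : ℕ → ∀ i, Ξ i) (s : ℕ) : ℝ :=
  S.dualSq (S.Gx (S.iter ρ η s).1 (S.iter ρ η s).2 (η s), S.Gy ρ (S.iter ρ η s).1 (η s)) / S.M ^ 2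

lemma Standing.iter_fst_mem (ρ : ℝ) (η : ℕ → ∀ i, Ξ i) (t : ℕ) : (S.iter ρ η t).1 ∈ S.X :=
  (coreZ_subset (hS.geometric.iter_mem_coreZ ρ η t)).1

lemma Standing.iter_snd_mem (ρ : ℝ) (η : ℕ → ∀ i, Ξ i) (t : ℕ) : (S.iter ρ η t).2 ∈ S.Y :=
  (coreZ_subset (hS.geometric.iter_mem_coreZ ρ η t)).2

lemma Standing.aux_snd_mem (ρ : ℝ) (η : ℕ → ∀ i, Ξ i) (t : ℕ) : (S.aux ρ η t).2 ∈ S.Y :=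
  (coreZ_subset (hS.geometric.aux_mem_coreZ ρ η t)).2

lemma Standing.dualSq_step_le (ρ : ℝ) (η : ℕ → ∀ i, Ξ i) (s : ℕ) :
    S.dualSq (S.γ s • S.Gx (S.iter ρ η s).1 (S.iter ρ η s).2 (η s),
      -(S.γ s • S.Gy ρ (S.iter ρ η s).1 (η s))) ≤ S.gradSq ρ η s / ((s : ℝ) + 1) := by
  have hM := hS.M_pos
  have hα := hS.dy_dgf.α_pos
  set gx := S.Gx (S.iter ρ η s).1 (S.iter ρ η s).2 (η s) with hgx
  set gy := S.Gy ρ (S.iter ρ η s).1 (η s) with hgy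
  have h1 := hS.dualSq_smul_le (S.γ s) (gx, -gy)
  have h2 : S.dualSq (gx, -gy) ≤ S.dualSq (gx, gy) := by
    have a := dualNorm_neg_le hS.dy_dgf.nrm_definite gy
    have b := dualNorm_nonneg hS.dy_dgf.nrm_definite (-gy)
    simp only [dualSq]
    gcongr
  have e : S.γ s • (gx, -gy) = (S.γ s • gx, -(S.γ s • gy)) := by
    ext <;> simp
  rw [e] at h1
  refine h1.trans ?_
  calc S.γ s ^ 2 * S.dualSq (gx, -gy) ≤ S.γ s ^ 2 * S.dualSq (gx, gy) := by gcongr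
    _ = (S.γ s ^ 2 * S.M ^ 2) * (S.dualSq (gx, gy) / S.M ^ 2) := by field_simp
    _ = _ := by rw [hS.γ_sq]; simp only [gradSq, ← hgx, ← hgy]; ring

/-- Convexity replaces the current point by `u` in `Phi`, whose mean there is at most `P ρ u`; the
linear terms are the regret against `(u, y)`. The remaining noise sits at the deterministic point
`u` and does not involve `y`, so the bound survives the maximum over `y`. -/
lemma Standing.validation_le (ρ : ℝ) (η : ℕ → ∀ i, Ξ i) (T : ℕ) {u : Fin d → ℝ} (hu : u ∈ S.X)
    {y : Fin (m + 1) → ℝ} (hy : y ∈ S.Y) :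
    S.validation ρ η T y ≤ S.P ρ u + (S.M *
      (1 + (∑ s ∈ Finset.range (T + 1), S.gradSq ρ η s / ((s : ℝ) + 1)) / 2) +
      ∑ s ∈ Finset.range (T + 1), 1 / √((s : ℝ) + 1) *
        (S.Phi ρ u (S.iter ρ η s).2 (η s) - S.phi ρ u (S.iter ρ η s).2)) / rootSum (T + 1) := by
  have hM := hS.M_pos
  have hA := rootSum_pos (Nat.succ_pos T)
  have hreg := hS.geometric.regret (S.iter ρ η)
    (fun t => (S.γ t • S.Gx (S.iter ρ η t).1 (S.iter ρ η t).2 (η t),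
      -(S.γ t • S.Gy ρ (S.iter ρ η t).1 (η t)))) rfl (fun t => rfl) (u := (u, y)) ⟨hu, hy⟩ (T + 1)
  have hdual := Finset.sum_le_sum fun s (_ : s ∈ Finset.range (T + 1)) =>
    hS.dualSq_step_le ρ η s
  have hsum : ∑ s ∈ Finset.range (T + 1), S.γ s * (S.Gy ρ (S.iter ρ η s).1 (η s) ⬝ᵥ y) ≤
      ∑ s ∈ Finset.range (T + 1), (S.γ s * S.P ρ u + S.γ s *
        (S.Phi ρ u (S.iter ρ η s).2 (η s) - S.phi ρ u (S.iter ρ η s).2) +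
        ((S.γ s • S.Gx (S.iter ρ η s).1 (S.iter ρ η s).2 (η s)) ⬝ᵥ ((S.iter ρ η s).1 - u) +
        (-(S.γ s • S.Gy ρ (S.iter ρ η s).1 (η s))) ⬝ᵥ ((S.iter ρ η s).2 - y))) := by
    refine Finset.sum_le_sum fun s _ => ?_
    have h1 := hS.Phi_subgradient ρ (hS.iter_fst_mem ρ η s) hu (hS.iter_snd_mem ρ η s) (η s)
    have h2 := hS.phi_le_P ρ hu (hS.iter_snd_mem ρ η s)
    rw [Phi_eq_dot ρ (S.iter ρ η s).1] at h1
    have h3 := mul_le_mul_of_nonneg_left (add_le_add h1 h2) (hS.γ_pos s).le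
    rw [neg_dotProduct, smul_dotProduct, smul_dotProduct, smul_eq_mul, smul_eq_mul]
    simp only [dotProduct_sub] at h3 ⊢
    linarith
  rw [Finset.sum_add_distrib, Finset.sum_add_distrib, ← Finset.sum_mul, sum_γ] at hsum
  have hnoise : ∑ s ∈ Finset.range (T + 1), S.γ s *
        (S.Phi ρ u (S.iter ρ η s).2 (η s) - S.phi ρ u (S.iter ρ η s).2) =
      S.M⁻¹ * ∑ s ∈ Finset.range (T + 1), 1 / √((s : ℝ) + 1) *
        (S.Phi ρ u (S.iter ρ η s).2 (η s) - S.phi ρ u (S.iter ρ η s).2) := by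
    rw [Finset.mul_sum]
    exact Finset.sum_congr rfl fun s _ => by rw [γ_eq]; ring
  rw [hnoise] at hsum
  unfold validation
  rw [sum_γ, ← div_eq_inv_mul, div_le_iff₀ (by positivity)]
  refine hsum.trans ?_
  have e : ∀ a b c : ℝ, (a + (S.M * b + c) / rootSum (T + 1)) * (S.M⁻¹ * rootSum (T + 1)) =
      S.M⁻¹ * rootSum (T + 1) * a + S.M⁻¹ * c + b := by
    intro a b c
    field_simp
    ring
  rw [e]
  linarith

/-- The noise is `Gy` minus its mean, and the mean has dual norm at most `S.My`. Squaring the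
triangle inequality costs the factor `2`. -/
lemma Standing.dualSq_aux_le {ρ : ℝ} (hρ1 : S.fstar < ρ) (hρ2 : ρ ≤ r0) (η : ℕ → ∀ i, Ξ i)
    (s : ℕ) :
    S.dualSq (0, S.γ s • fun i => S.F i (S.iter ρ η s).1 (η s i) - S.f i (S.iter ρ η s).1) ≤
      2 * (S.gradSq ρ η s / ((s : ℝ) + 1)) + 2 * (1 / ((s : ℝ) + 1)) := by
  have hM := hS.M_pos
  have hα := hS.dy_dgf.α_pos
  have hαx := hS.dx_dgf.α_pos
  have hx := hS.iter_fst_mem ρ η s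
  set x := (S.iter ρ η s).1
  have e0 : (fun i => S.F i x (η s i) - S.f i x) =
      S.Gy ρ x (η s) - fun i => S.f i x - S.rhs ρ i := by
    ext i; simp [Gy]
  have h1 := hS.dualSq_smul_le (S.γ s) (0, fun i => S.F i x (η s i) - S.f i x)
  have e : S.γ s • ((0 : Fin d → ℝ), fun i => S.F i x (η s i) - S.f i x) =
      (0, S.γ s • fun i => S.F i x (η s i) - S.f i x) := by
    ext <;> simp
  rw [e] at h1
  have h2 := dualNorm_sub_le hS.dy_dgf.nrm_definite (S.Gy ρ x (η s))
    (fun i => S.f i x - S.rhs ρ i)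
  have h3 := hS.dualNorm_mean_Gy_le hρ1 hρ2 hx
  have n0 := dualNorm_nonneg hS.dy_dgf.nrm_definite (fun i => S.F i x (η s i) - S.f i x)
  rw [← e0] at h2
  set N := dualNorm S.dy.nrm (fun i => S.F i x (η s i) - S.f i x)
  set G := dualNorm S.dy.nrm (S.Gy ρ x (η s))
  have h4 : N ^ 2 ≤ 2 * G ^ 2 + 2 * S.My ^ 2 := by
    have : N ≤ G + S.My := by linarith
    nlinarith [sq_nonneg (G - S.My)]
  have h0 : dualNorm S.dx.nrm (0 : Fin d → ℝ) = 0 :=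
    le_antisymm (dualNorm_le le_rfl fun v => by simp)
      (dualNorm_nonneg hS.dx_dgf.nrm_definite _)
  have h5 : S.dualSq (0, fun i => S.F i x (η s i) - S.f i x) ≤
      2 * S.dualSq (S.Gx x (S.iter ρ η s).2 (η s), S.Gy ρ x (η s)) + 2 * S.M ^ 2 := by
    rw [hS.M_sq]
    simp only [dualSq, h0]
    have a1 : 2 * S.Dy ^ 2 / S.dy.α * N ^ 2 ≤
        2 * S.Dy ^ 2 / S.dy.α * (2 * G ^ 2 + 2 * S.My ^ 2) := by gcongr
    have a2 : 0 ≤ 2 * S.Dx ^ 2 / S.dx.α *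
      dualNorm S.dx.nrm (S.Gx x (S.iter ρ η s).2 (η s)) ^ 2 := by positivity
    have a3 : 0 ≤ 2 * S.Dx ^ 2 / S.dx.α * S.Mx ^ 2 := by positivity
    linarith
  refine h1.trans ?_
  calc _ ≤ S.γ s ^ 2 *
      (2 * S.dualSq (S.Gx x (S.iter ρ η s).2 (η s), S.Gy ρ x (η s)) + 2 * S.M ^ 2) := by gcongr
    _ = 2 * ((S.γ s ^ 2 * S.M ^ 2) *
          (S.dualSq (S.Gx x (S.iter ρ η s).2 (η s), S.Gy ρ x (η s)) / S.M ^ 2))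
        + 2 * (S.γ s ^ 2 * S.M ^ 2) := by field_simp
    _ = _ := by rw [hS.γ_sq]; simp only [gradSq]; ring

/-- For each constraint, Jensen passes from `xbar` to the iterates and the noise is tested against a
vertex. The regret of `aux` replaces that vertex by `aux ρ η s`, which depends only on earlier
samples, so one centered sum serves all vertices at once. -/
lemma Standing.P_xbar_le {ρ : ℝ} (hρ1 : S.fstar < ρ) (hρ2 : ρ ≤ r0) (η : ℕ → ∀ i, Ξ i) (T : ℕ) :
    S.P ρ (S.xbar ρ η T) ≤ S.uhat ρ η T + (S.M *
      (1 + (∑ s ∈ Finset.range (T + 1), S.gradSq ρ η s / ((s : ℝ) + 1)) + harmSum (T + 1)) +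
      ∑ s ∈ Finset.range (T + 1), 1 / √((s : ℝ) + 1) *
        (S.phi ρ (S.iter ρ η s).1 (S.aux ρ η s).2 -
          S.Phi ρ (S.iter ρ η s).1 (S.aux ρ η s).2 (η s))) / rootSum (T + 1) := by
  have hM := hS.M_pos
  have hA := rootSum_pos (Nat.succ_pos T)
  rw [P_le_iff]
  intro i
  have hv := S.validation_le_uhat ρ η T (single_mem_Y (S := S) i)
  -- The `X`-component of the comparator is irrelevant, since the direction has zero `X`-part; any
  -- point of `S.X` would do.
  have hreg := hS.geometric.regret (S.aux ρ η)
    (fun t => (0, S.γ t • fun i => S.F i (S.iter ρ η t).1 (η t i) - S.f i (S.iter ρ η t).1))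
    rfl (fun t => rfl) (u := ((S.iter ρ η 0).1, Pi.single i 1))
    ⟨hS.iter_fst_mem ρ η 0, single_mem_Y i⟩ (T + 1)
  have hdual := Finset.sum_le_sum fun s (_ : s ∈ Finset.range (T + 1)) =>
    hS.dualSq_aux_le hρ1 hρ2 η s
  rw [Finset.sum_add_distrib, ← Finset.mul_sum, ← Finset.mul_sum] at hdual
  change _ ≤ _ + 2 * harmSum (T + 1) at hdual
  have hΓ : 0 < ∑ s ∈ Finset.range (T + 1), S.γ s := by rw [sum_γ]; positivity
  have hjensen : S.f i (S.xbar ρ η T) ≤ (∑ s ∈ Finset.range (T + 1), S.γ s)⁻¹ *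
      ∑ s ∈ Finset.range (T + 1), S.γ s * S.f i (S.iter ρ η s).1 := by
    have := (hS.f_convexOn i).map_centerMass_le (t := Finset.range (T + 1)) (w := S.γ)
      (p := fun s => (S.iter ρ η s).1) (fun s _ => (hS.γ_pos s).le) hΓ
      (fun s _ => hS.iter_fst_mem ρ η s)
    simpa [Finset.centerMass, xbar] using this
  have hsum : ∑ s ∈ Finset.range (T + 1), S.γ s * S.f i (S.iter ρ η s).1 ≤
      ∑ s ∈ Finset.range (T + 1), (S.γ s * S.rhs ρ i +
        S.γ s * (S.Gy ρ (S.iter ρ η s).1 (η s) ⬝ᵥ Pi.single i 1) + S.γ s *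
        (S.phi ρ (S.iter ρ η s).1 (S.aux ρ η s).2 -
          S.Phi ρ (S.iter ρ η s).1 (S.aux ρ η s).2 (η s)) +
        ((0 : Fin d → ℝ) ⬝ᵥ ((S.aux ρ η s).1 - (S.iter ρ η 0).1) +
        (S.γ s • fun i => S.F i (S.iter ρ η s).1 (η s i) - S.f i (S.iter ρ η s).1) ⬝ᵥ
          ((S.aux ρ η s).2 - Pi.single i 1))) := by
    refine Finset.sum_le_sum fun s _ => le_of_eq ?_
    rw [hS.phi_eq ρ (hS.iter_fst_mem ρ η s)]
    have e1 : ∑ j, (S.aux ρ η s).2 j * (S.f j (S.iter ρ η s).1 - S.rhs ρ j) -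
        S.Phi ρ (S.iter ρ η s).1 (S.aux ρ η s).2 (η s) =
        -((fun i => S.F i (S.iter ρ η s).1 (η s i) - S.f i (S.iter ρ η s).1) ⬝ᵥ
          (S.aux ρ η s).2) := by
      rw [Phi, ← Finset.sum_sub_distrib, dotProduct, ← Finset.sum_neg_distrib]
      exact Finset.sum_congr rfl fun j _ => by ring
    rw [e1, dotProduct_single, zero_dotProduct, smul_dotProduct, smul_eq_mul, dotProduct_sub,
      dotProduct_single]
    simp only [Gy]
    ring
  rw [Finset.sum_add_distrib, Finset.sum_add_distrib, Finset.sum_add_distrib,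
    ← Finset.sum_mul, sum_γ] at hsum
  have hnoise : ∑ s ∈ Finset.range (T + 1), S.γ s *
        (S.phi ρ (S.iter ρ η s).1 (S.aux ρ η s).2 -
          S.Phi ρ (S.iter ρ η s).1 (S.aux ρ η s).2 (η s)) =
      S.M⁻¹ * ∑ s ∈ Finset.range (T + 1), 1 / √((s : ℝ) + 1) *
        (S.phi ρ (S.iter ρ η s).1 (S.aux ρ η s).2 -
          S.Phi ρ (S.iter ρ η s).1 (S.aux ρ η s).2 (η s)) := by
    rw [Finset.mul_sum]
    exact Finset.sum_congr rfl fun s _ => by rw [γ_eq]; ring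
  rw [hnoise] at hsum
  unfold validation at hv
  rw [sum_γ] at hv hjensen
  have e : ∀ a b c : ℝ, (a + (S.M * b + c) / rootSum (T + 1)) * (S.M⁻¹ * rootSum (T + 1)) =
      S.M⁻¹ * rootSum (T + 1) * a + S.M⁻¹ * c + b := by
    intro a b c
    field_simp
    ring
  have hG : 0 < S.M⁻¹ * rootSum (T + 1) := by positivity
  rw [← div_eq_inv_mul, div_le_iff₀ hG] at hv
  rw [← div_eq_inv_mul, le_div_iff₀ hG] at hjensen
  rw [← mul_le_mul_iff_of_pos_right hG, e]
  rw [sub_mul]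
  linarith

end SOEC

end SFLS

/-! ### Exponential moments of light-tailed variables. -/

namespace SFLS

section Exponential

lemma exp_le_add_exp_sq (x : ℝ) : Real.exp x ≤ x + Real.exp (x ^ 2) := by
  have h2 := Real.add_one_le_exp (x ^ 2)
  rcases le_or_gt |x| 1 with h | h
  · have := (abs_le.1 (Real.abs_exp_sub_one_sub_id_le h)).2
    linarith
  · rcases lt_abs.1 h with h1 | h1
    · have : Real.exp x ≤ Real.exp (x ^ 2) := Real.exp_le_exp.2 (by nlinarith)
      linarith
    · have : Real.exp x ≤ 1 := Real.exp_le_one_iff.2 (by linarith)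
      nlinarith

/-- Convexity of `exp` between `0` and `g - 1`. The right side is affine in `exp g`, so integrating
it replaces Jensen's inequality for the power `p`. -/
lemma exp_mul_le_of_mem_Icc {p : ℝ} (h0 : 0 ≤ p) (h1 : p ≤ 1) (g : ℝ) :
    Real.exp (p * g) ≤ Real.exp p * ((1 - p) + p * (Real.exp g * (Real.exp 1)⁻¹)) := by
  have h := convexOn_exp.2 (Set.mem_univ (0 : ℝ)) (Set.mem_univ (g - 1)) (sub_nonneg.2 h1) h0
    (by ring)
  simp only [smul_eq_mul, mul_zero, zero_add, Real.exp_zero, mul_one] at h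
  have e1 : p * g = p + p * (g - 1) := by ring
  rw [e1, Real.exp_add, ← Real.exp_neg, ← Real.exp_add g, ← sub_eq_add_neg g 1]
  gcongr

variable {Ω : Type*} [MeasurableSpace Ω] {ν : Measure Ω} [IsProbabilityMeasure ν]

lemma integral_exp_mul_le {g : Ω → ℝ} (hg : Measurable g)
    (h : ∫⁻ ω, ENNReal.ofReal (Real.exp (g ω)) ∂ν ≤ ENNReal.ofReal (Real.exp 1))
    {p : ℝ} (h0 : 0 ≤ p) (h1 : p ≤ 1) :
    Integrable (fun ω => Real.exp (p * g ω)) ν ∧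
      ∫ ω, Real.exp (p * g ω) ∂ν ≤ Real.exp p := by
  obtain ⟨hi, hle⟩ := integrable_of_lintegral_exp_le hg h (Real.exp_pos 1).le
  have hdom : Integrable
      (fun ω => Real.exp p * ((1 - p) + p * (Real.exp (g ω) * (Real.exp 1)⁻¹))) ν :=
    ((integrable_const _).add ((hi.mul_const _).const_mul _)).const_mul _
  have hint : Integrable (fun ω => Real.exp (p * g ω)) ν := by
    refine hdom.mono' (Real.measurable_exp.comp (hg.const_mul p)).aestronglyMeasurable
      (Filter.Eventually.of_forall fun ω => ?_)
    rw [Real.norm_eq_abs, abs_of_pos (Real.exp_pos _)]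
    exact exp_mul_le_of_mem_Icc h0 h1 _
  refine ⟨hint, ?_⟩
  calc ∫ ω, Real.exp (p * g ω) ∂ν
      ≤ ∫ ω, Real.exp p * ((1 - p) + p * (Real.exp (g ω) * (Real.exp 1)⁻¹)) ∂ν :=
        integral_mono hint hdom fun ω => exp_mul_le_of_mem_Icc h0 h1 _
    _ = Real.exp p * ((1 - p) + p * ((∫ ω, Real.exp (g ω) ∂ν) * (Real.exp 1)⁻¹)) := by
        rw [integral_const_mul, integral_add (integrable_const _) ((hi.mul_const _).const_mul _),
          integral_const_mul, integral_mul_const]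
        simp
    _ ≤ Real.exp p * ((1 - p) + p * (Real.exp 1 * (Real.exp 1)⁻¹)) := by gcongr
    _ = Real.exp p := by rw [mul_inv_cancel₀ (Real.exp_pos 1).ne']; ring

lemma lintegral_exp_mul_le {g : Ω → ℝ} (hg : Measurable g)
    (h : ∫⁻ ω, ENNReal.ofReal (Real.exp (g ω)) ∂ν ≤ ENNReal.ofReal (Real.exp 1))
    {p : ℝ} (h0 : 0 ≤ p) (h1 : p ≤ 1) :
    ∫⁻ ω, ENNReal.ofReal (Real.exp (p * g ω)) ∂ν ≤ ENNReal.ofReal (Real.exp p) := by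
  obtain ⟨hi, hle⟩ := integral_exp_mul_le hg h h0 h1
  rw [← ofReal_integral_eq_lintegral_ofReal hi
    (Filter.Eventually.of_forall fun ω => (Real.exp_pos _).le)]
  exact ENNReal.ofReal_le_ofReal hle

/-- A centered variable with a Gaussian tail of parameter `Q` is sub-Gaussian. -/
lemma lintegral_exp_le_of_light_tail {ζ : Ω → ℝ} (hζ : Measurable ζ) (hi : Integrable ζ ν)
    (h0 : ∫ ω, ζ ω ∂ν = 0) {Q : ℝ} (hQ : 0 < Q)
    (h : ∫⁻ ω, ENNReal.ofReal (Real.exp (|ζ ω| ^ 2 / Q ^ 2)) ∂ν ≤ ENNReal.ofReal (Real.exp 1))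
    (t : ℝ) :
    ∫⁻ ω, ENNReal.ofReal (Real.exp (t * ζ ω)) ∂ν ≤ ENNReal.ofReal (Real.exp (t ^ 2 * Q ^ 2)) := by
  simp only [sq_abs] at h
  have hg : Measurable fun ω => ζ ω ^ 2 / Q ^ 2 := (hζ.pow_const 2).div_const _
  -- For small `t` the linear term of `exp x ≤ x + exp (x ^ 2)` integrates to zero and the power
  -- bound applies with `p = t ^ 2 * Q ^ 2`. For large `t`, Young's inequality splits the exponent,
  -- and the leftover `exp (1 / 2)` is at most `exp (t ^ 2 * Q ^ 2 / 2)`.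
  rcases le_or_gt (t ^ 2 * Q ^ 2) 1 with ht | ht
  · obtain ⟨hi2, hle⟩ := integral_exp_mul_le hg h (by positivity : 0 ≤ t ^ 2 * Q ^ 2) ht
    have hpt : ∀ ω, Real.exp (t * ζ ω) ≤
        t * ζ ω + Real.exp (t ^ 2 * Q ^ 2 * (ζ ω ^ 2 / Q ^ 2)) := by
      intro ω
      have e : t ^ 2 * Q ^ 2 * (ζ ω ^ 2 / Q ^ 2) = (t * ζ ω) ^ 2 := by field_simp
      rw [e]
      exact exp_le_add_exp_sq _
    calc ∫⁻ ω, ENNReal.ofReal (Real.exp (t * ζ ω)) ∂ν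
        ≤ ∫⁻ ω, ENNReal.ofReal (t * ζ ω + Real.exp (t ^ 2 * Q ^ 2 * (ζ ω ^ 2 / Q ^ 2))) ∂ν :=
          lintegral_mono fun ω => ENNReal.ofReal_le_ofReal (hpt ω)
      _ = ENNReal.ofReal (∫ ω, (t * ζ ω + Real.exp (t ^ 2 * Q ^ 2 * (ζ ω ^ 2 / Q ^ 2))) ∂ν) := by
          have hi3 : Integrable (fun ω => t * ζ ω + Real.exp (t ^ 2 * Q ^ 2 * (ζ ω ^ 2 / Q ^ 2))) ν :=
            (hi.const_mul t).add hi2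
          rw [ofReal_integral_eq_lintegral_ofReal hi3]
          exact Filter.Eventually.of_forall fun ω => (Real.exp_pos _).le.trans (hpt ω)
      _ ≤ _ := by
          refine ENNReal.ofReal_le_ofReal ?_
          rw [integral_add (hi.const_mul t) hi2, integral_const_mul, h0]
          linarith
  · have hhalf := lintegral_exp_mul_le hg h (by norm_num : (0 : ℝ) ≤ 1 / 2) (by norm_num)
    have hpt : ∀ ω, Real.exp (t * ζ ω) ≤
        Real.exp (t ^ 2 * Q ^ 2 / 2) * Real.exp (1 / 2 * (ζ ω ^ 2 / Q ^ 2)) := by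
      intro ω
      rw [← Real.exp_add]
      refine Real.exp_le_exp.2 ?_
      have e : t * ζ ω = (t * Q) * (ζ ω / Q) := by field_simp
      rw [e, ← div_pow]
      nlinarith [sq_nonneg (t * Q - ζ ω / Q)]
    calc ∫⁻ ω, ENNReal.ofReal (Real.exp (t * ζ ω)) ∂ν
        ≤ ∫⁻ ω, ENNReal.ofReal (Real.exp (t ^ 2 * Q ^ 2 / 2)) *
            ENNReal.ofReal (Real.exp (1 / 2 * (ζ ω ^ 2 / Q ^ 2))) ∂ν := by
          refine lintegral_mono fun ω => ?_
          rw [← ENNReal.ofReal_mul (Real.exp_pos _).le]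
          exact ENNReal.ofReal_le_ofReal (hpt ω)
      _ ≤ ENNReal.ofReal (Real.exp (t ^ 2 * Q ^ 2 / 2)) * ENNReal.ofReal (Real.exp (1 / 2)) := by
          have hm : Measurable fun ω => ENNReal.ofReal (Real.exp (1 / 2 * (ζ ω ^ 2 / Q ^ 2))) :=
            (Real.measurable_exp.comp (hg.const_mul _)).ennreal_ofReal
          rw [lintegral_const_mul _ hm]
          gcongr
      _ ≤ _ := by
          rw [← ENNReal.ofReal_mul (Real.exp_pos _).le, ← Real.exp_add]
          exact ENNReal.ofReal_le_ofReal (Real.exp_le_exp.2 (by linarith))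

end Exponential

/-! ### Deviation bounds along adaptively generated states. -/

section Adaptive

variable {ι Prb : Type*} {Ω' : Type*} [mΩ' : MeasurableSpace Ω']

/-- The σ-algebra generated by the samples with index in `J`. -/
abbrev sigmaOn (ξ : ι → Prb → Ω') (J : Set ι) : MeasurableSpace Prb :=
  ⨆ j ∈ J, mΩ'.comap (ξ j)

lemma measurable_sigmaOn {ξ : ι → Prb → Ω'} {J : Set ι} {j : ι} (hj : j ∈ J) :
    Measurable[sigmaOn ξ J] (ξ j) :=
  (comap_measurable (ξ j)).mono (le_iSup₂_of_le j hj le_rfl) le_rfl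

lemma sigmaOn_mono {ξ : ι → Prb → Ω'} {J K : Set ι} (h : J ⊆ K) : sigmaOn ξ J ≤ sigmaOn ξ K :=
  iSup₂_le fun j hj => le_iSup₂_of_le (f := fun j _ => mΩ'.comap (ξ j)) j (h hj) le_rfl

variable [mP : MeasurableSpace Prb] {μ : Measure Prb}

lemma sigmaOn_le {ξ : ι → Prb → Ω'} (hξ : ∀ j, Measurable (ξ j)) (J : Set ι) :
    sigmaOn ξ J ≤ mP :=
  iSup₂_le fun j _ => (hξ j).comap_le

lemma indepFun_of_sigmaOn {ξ : ι → Prb → Ω'} (hξ : ∀ j, Measurable (ξ j)) (hind : iIndepFun ξ μ)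
    {J K : Set ι} (hJK : Disjoint J K) {E F : Type*} [mE : MeasurableSpace E]
    [mF : MeasurableSpace F] {f : Prb → E} {g : Prb → F} (hf : Measurable[sigmaOn ξ J] f)
    (hg : Measurable[sigmaOn ξ K] g) : IndepFun f g μ := by
  rw [IndepFun_iff_Indep]
  have h := indep_iSup_of_disjoint (m := fun j => mΩ'.comap (ξ j)) (fun j => (hξ j).comap_le)
    hind.iIndep hJK
  exact indep_of_indep_of_le_left (indep_of_indep_of_le_right h hg.comap_le) hf.comap_le

variable [IsProbabilityMeasure μ] {ξ : ℕ → Prb → Ω'} {ν : Measure Ω'}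

/-- The partial product and the state `z n` depend only on samples before `n`, hence are independent
of `ξ n`. Fubini integrates out the newest sample with the state frozen, which takes the place of
conditional expectations. -/
lemma lintegral_prod_adaptive_le (hξ : ∀ s, Measurable (ξ s)) (hlaw : ∀ s, μ.map (ξ s) = ν)
    (hind : iIndepFun ξ μ) {E : Type*} [MeasurableSpace E] {z : ℕ → Prb → E}
    (hz : ∀ s, Measurable[sigmaOn ξ {j | j < s}] (z s)) {f : ℕ → E × Ω' → ENNReal}
    (hf : ∀ s, Measurable (f s)) {c : ℕ → ENNReal} (hc : ∀ s e, ∫⁻ ω, f s (e, ω) ∂ν ≤ c s)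
    (n : ℕ) :
    ∫⁻ w, ∏ s ∈ Finset.range n, f s (z s w, ξ s w) ∂μ ≤ ∏ s ∈ Finset.range n, c s := by
  have hν : IsProbabilityMeasure ν := hlaw 0 ▸ Measure.isProbabilityMeasure_map (hξ 0).aemeasurable
  induction n with
  | zero => simp
  | succ n ih =>
    simp only [Finset.prod_range_succ]
    set p : Prb → ENNReal := fun w => ∏ s ∈ Finset.range n, f s (z s w, ξ s w) with hp
    have hpm : Measurable[sigmaOn ξ {j | j < n}] p := by
      refine Finset.measurable_fun_prod _ fun s hs => ?_
      have hs' : s < n := Finset.mem_range.1 hs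
      refine (hf s).comp (Measurable.prodMk ?_ (measurable_sigmaOn hs'))
      exact (hz s).mono (sigmaOn_mono fun j hj => lt_trans hj hs') le_rfl
    have hpair : Measurable[sigmaOn ξ {j | j < n}] fun w => (p w, z n w) := hpm.prodMk (hz n)
    have hpm' := hpm.mono (sigmaOn_le hξ _) le_rfl
    have hpair' := hpair.mono (sigmaOn_le hξ _) le_rfl
    have hi : IndepFun (fun w => (p w, z n w)) (ξ n) μ :=
      indepFun_of_sigmaOn hξ hind (J := {j | j < n}) (K := {n})
        (by simp) hpair (measurable_sigmaOn rfl)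
    have hmap := (indepFun_iff_map_prod_eq_prod_map_map hpair'.aemeasurable
      (hξ n).aemeasurable).1 hi
    have hgm : Measurable fun q : (ENNReal × E) × Ω' => q.1.1 * f n (q.1.2, q.2) :=
      (measurable_fst.comp measurable_fst).mul
        ((hf n).comp ((measurable_snd.comp measurable_fst).prodMk measurable_snd))
    calc ∫⁻ w, p w * f n (z n w, ξ n w) ∂μ
        = ∫⁻ q, q.1.1 * f n (q.1.2, q.2) ∂(μ.map fun w => ((p w, z n w), ξ n w)) :=
          (lintegral_map hgm (hpair'.prodMk (hξ n))).symm
      _ = ∫⁻ a, ∫⁻ ω, a.1 * f n (a.2, ω) ∂ν ∂(μ.map fun w => (p w, z n w)) := by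
          rw [hmap, hlaw, lintegral_prod _ hgm.aemeasurable]
      _ ≤ ∫⁻ a, a.1 * c n ∂(μ.map fun w => (p w, z n w)) := by
          refine lintegral_mono fun a => ?_
          have hm : Measurable fun ω => f n (a.2, ω) :=
            (hf n).comp (measurable_const.prodMk measurable_id)
          rw [lintegral_const_mul _ hm]
          gcongr
          exact hc n a.2
      _ = (∫⁻ w, p w ∂μ) * c n := by
          rw [lintegral_mul_const _ measurable_fst, lintegral_map measurable_fst hpair']
      _ ≤ _ := by gcongr

lemma measure_sum_adaptive_ge_le (hξ : ∀ s, Measurable (ξ s)) (hlaw : ∀ s, μ.map (ξ s) = ν)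
    (hind : iIndepFun ξ μ) {E : Type*} [MeasurableSpace E] {z : ℕ → Prb → E}
    (hz : ∀ s, Measurable[sigmaOn ξ {j | j < s}] (z s)) {g : ℕ → E × Ω' → ℝ}
    (hg : ∀ s, Measurable (g s)) {c : ℕ → ℝ}
    (hc : ∀ s e, ∫⁻ ω, ENNReal.ofReal (Real.exp (g s (e, ω))) ∂ν ≤ ENNReal.ofReal (Real.exp (c s)))
    (n : ℕ) (a : ℝ) :
    μ {w | a ≤ ∑ s ∈ Finset.range n, g s (z s w, ξ s w)} ≤
      ENNReal.ofReal (Real.exp (∑ s ∈ Finset.range n, c s - a)) := by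
  have h := lintegral_prod_adaptive_le hξ hlaw hind hz
    (fun s => (Real.measurable_exp.comp (hg s)).ennreal_ofReal) hc n
  have e1 : ∀ w, ∏ s ∈ Finset.range n, ENNReal.ofReal ((Real.exp ∘ g s) (z s w, ξ s w)) =
      ENNReal.ofReal (Real.exp (∑ s ∈ Finset.range n, g s (z s w, ξ s w))) := by
    intro w
    rw [Real.exp_sum, ENNReal.ofReal_prod_of_nonneg fun s _ => (Real.exp_pos _).le]
    rfl
  simp only [e1] at h
  rw [← ENNReal.ofReal_prod_of_nonneg fun s _ => (Real.exp_pos _).le, ← Real.exp_sum] at h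
  have hzm : ∀ s, Measurable (z s) := fun s => (hz s).mono (sigmaOn_le hξ _) le_rfl
  have hm : Measurable fun w => ENNReal.ofReal
      (Real.exp (∑ s ∈ Finset.range n, g s (z s w, ξ s w))) := by
    refine (Real.measurable_exp.comp (Finset.measurable_fun_sum _ fun s _ => ?_)).ennreal_ofReal
    exact (hg s).comp ((hzm s).prodMk (hξ s))
  have hmarkov := mul_meas_ge_le_lintegral (μ := μ) hm (ENNReal.ofReal (Real.exp a))
  have hset : {w | ENNReal.ofReal (Real.exp a) ≤ ENNReal.ofReal
      (Real.exp (∑ s ∈ Finset.range n, g s (z s w, ξ s w)))} =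
      {w | a ≤ ∑ s ∈ Finset.range n, g s (z s w, ξ s w)} := by
    ext w
    simp only [Set.mem_ofPred_eq]
    rw [ENNReal.ofReal_le_ofReal_iff (Real.exp_pos _).le, Real.exp_le_exp]
  rw [hset] at hmarkov
  rw [sub_eq_add_neg, Real.exp_add, ENNReal.ofReal_mul (Real.exp_pos _).le, Real.exp_neg,
    ENNReal.ofReal_inv_of_pos (Real.exp_pos _), ← div_eq_mul_inv,
    ENNReal.le_div_iff_mul_le (Or.inl (by simp [Real.exp_pos])) (Or.inl ENNReal.ofReal_ne_top),
    mul_comm]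
  exact hmarkov.trans h

end Adaptive

end SFLS

/-! ### Failure probability of one call. -/

namespace SFLS

lemma rootSum_sq_sum (n : ℕ) :
    ∑ s ∈ Finset.range n, (1 / √((s : ℝ) + 1)) ^ 2 = harmSum n := by
  unfold harmSum
  refine Finset.sum_congr rfl fun s _ => ?_
  rw [div_pow, Real.sq_sqrt (by positivity), one_pow]

namespace SOEC

variable {d m : ℕ} {Ξ : Fin (m + 1) → Type*} [∀ i, MeasurableSpace (Ξ i)] {S : SOEC d m Ξ}
  {r0 : ℝ} (hS : S.Standing r0)
include hS

/-- By the definition of `S.M`, the normalized squared norm is a convex combination of the two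
normalized blocks; convexity of `exp` transfers their light tails. -/
lemma Standing.lintegral_gradSq_le {ρ : ℝ} (h1 : S.fstar < ρ) (h2 : ρ ≤ r0) {x : Fin d → ℝ}
    (hx : x ∈ S.X) {y : Fin (m + 1) → ℝ} (hy : y ∈ S.Y) :
    ∫⁻ ξ, ENNReal.ofReal (Real.exp (S.dualSq (S.Gx x y ξ, S.Gy ρ x ξ) / S.M ^ 2)) ∂S.law ≤
      ENNReal.ofReal (Real.exp 1) := by
  have hM := hS.M_pos
  have hαx := hS.dx_dgf.α_pos
  have hαy := hS.dy_dgf.α_pos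
  have hMx := hS.Mx_pos
  have hMy := hS.My_pos
  set a := 2 * S.Dx ^ 2 / S.dx.α * S.Mx ^ 2 / S.M ^ 2 with ha
  set b := 2 * S.Dy ^ 2 / S.dy.α * S.My ^ 2 / S.M ^ 2 with hb
  have ha0 : 0 ≤ a := by positivity
  have hb0 : 0 ≤ b := by positivity
  have hab : a + b = 1 := by
    rw [ha, hb, ← add_div, ← hS.M_sq, div_self (by positivity)]
  have hmx : Measurable fun ξ => ENNReal.ofReal
      (Real.exp (dualNorm S.dx.nrm (S.Gx x y ξ) ^ 2 / S.Mx ^ 2)) :=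
    (Real.measurable_exp.comp ((((continuous_dualNorm hS.dx_dgf.nrm_definite).measurable.comp
      (hS.measurable_Gx measurable_const (fun _ => hx) measurable_const
        measurable_id)).pow_const 2).div_const _)).ennreal_ofReal
  have hmy : Measurable fun ξ => ENNReal.ofReal
      (Real.exp (dualNorm S.dy.nrm (S.Gy ρ x ξ) ^ 2 / S.My ^ 2)) :=
    (Real.measurable_exp.comp
      (((hS.measurable_dualNorm_Gy ρ hx).pow_const 2).div_const _)).ennreal_ofReal
  calc ∫⁻ ξ, ENNReal.ofReal (Real.exp (S.dualSq (S.Gx x y ξ, S.Gy ρ x ξ) / S.M ^ 2)) ∂S.law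
      ≤ ∫⁻ ξ, (ENNReal.ofReal a * ENNReal.ofReal
            (Real.exp (dualNorm S.dx.nrm (S.Gx x y ξ) ^ 2 / S.Mx ^ 2)) +
          ENNReal.ofReal b * ENNReal.ofReal
            (Real.exp (dualNorm S.dy.nrm (S.Gy ρ x ξ) ^ 2 / S.My ^ 2))) ∂S.law := by
        refine lintegral_mono fun ξ => ?_
        rw [← ENNReal.ofReal_mul ha0, ← ENNReal.ofReal_mul hb0,
          ← ENNReal.ofReal_add (by positivity) (by positivity)]
        refine ENNReal.ofReal_le_ofReal ?_
        have := convexOn_exp.2 (Set.mem_univ (dualNorm S.dx.nrm (S.Gx x y ξ) ^ 2 / S.Mx ^ 2))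
          (Set.mem_univ (dualNorm S.dy.nrm (S.Gy ρ x ξ) ^ 2 / S.My ^ 2)) ha0 hb0 hab
        simp only [smul_eq_mul] at this
        refine le_trans (le_of_eq ?_) this
        congr 1
        simp only [dualSq, ha, hb]
        field_simp
    _ ≤ ENNReal.ofReal a * ENNReal.ofReal (Real.exp 1) +
          ENNReal.ofReal b * ENNReal.ofReal (Real.exp 1) := by
        rw [lintegral_add_left (hmx.const_mul _), lintegral_const_mul _ hmx,
          lintegral_const_mul _ hmy]
        gcongr
        · exact hS.light_x x hx y hy
        · exact hS.light_y ρ h1 h2 x hx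
    _ = ENNReal.ofReal (Real.exp 1) := by
        rw [← add_mul, ← ENNReal.ofReal_add ha0 hb0, hab]
        simp

lemma Standing.lintegral_noise_le {ρ : ℝ} (h1 : S.fstar < ρ) (h2 : ρ ≤ r0) {x : Fin d → ℝ}
    (hx : x ∈ S.X) {y : Fin (m + 1) → ℝ} (hy : y ∈ S.Y) (t : ℝ) :
    ∫⁻ ξ, ENNReal.ofReal (Real.exp (t * (S.Phi ρ x y ξ - S.phi ρ x y))) ∂S.law ≤
      ENNReal.ofReal (Real.exp (t ^ 2 * S.Q ^ 2)) := by
  have := hS.law_prob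
  have hm : Measurable (S.Phi ρ x y) :=
    hS.measurable_Phi measurable_const measurable_const (fun _ => hx) measurable_const
      measurable_id
  refine lintegral_exp_le_of_light_tail (hm.sub_const _)
    ((hS.integrable_Phi ρ hx y).sub (integrable_const _)) ?_ hS.Q_pos
    (hS.light_obj ρ h1 h2 x hx y hy) t
  rw [integral_sub (hS.integrable_Phi ρ hx y) (integrable_const _)]
  simp [phi]

omit hS in
/-- The error bound of a call with `n` iterations and deviation parameter `Om`. -/
noncomputable def callError (S : SOEC d m Ξ) (n : ℕ) (Om : ℝ) : ℝ :=
  (S.M * (1 + harmSum n * (2 + 10 * Om)) + S.Q * Om * harmSum n) / rootSum n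

omit hS in
/-- The states of the iterates and of the auxiliary sequence. -/
abbrev State (S : SOEC d m Ξ) : Type :=
  {q : ((Fin d → ℝ) × (Fin (m + 1) → ℝ)) × (Fin (m + 1) → ℝ) //
    (q.1.1 ∈ S.X ∧ q.1.2 ∈ S.Y) ∧ q.2 ∈ S.Y}

omit hS in
lemma harmSum_pos {n : ℕ} (hn : 0 < n) : 0 < harmSum n :=
  Finset.sum_pos (fun s _ => by positivity) (by simpa using hn.ne')

variable {Prb : Type*} [mP : MeasurableSpace Prb] {μ : Measure Prb} [IsProbabilityMeasure μ]
  {ξ : ℕ → Prb → ∀ i, Ξ i} (hξ : ∀ s, Measurable (ξ s)) (hlaw : ∀ s, μ.map (ξ s) = S.law)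
  (hind : iIndepFun ξ μ)

/-- The joint state process along a sample path. -/
noncomputable def Standing.state (hS : S.Standing r0) (ρ : ℝ) (ξ : ℕ → Prb → ∀ i, Ξ i) (s : ℕ)
    (w : Prb) : S.State :=
  ⟨(S.iter ρ (fun t => ξ t w) s, (S.aux ρ (fun t => ξ t w) s).2),
    ⟨hS.iter_fst_mem _ _ _, hS.iter_snd_mem _ _ _⟩, hS.aux_snd_mem _ _ _⟩

omit mP in
lemma Standing.measurable_state (ρ : ℝ) (s : ℕ) :
    Measurable[sigmaOn ξ {j | j < s}] (hS.state ρ ξ s) := by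
  refine Measurable.subtype_mk (Measurable.prodMk ?_ ?_)
  · exact hS.measurable_iter (mΩ := sigmaOn ξ {j | j < s}) measurable_const s
      fun t ht => measurable_sigmaOn ht
  · exact (hS.measurable_aux (mΩ := sigmaOn ξ {j | j < s}) measurable_const s
      fun t ht => measurable_sigmaOn ht).snd

include hξ hlaw hind

lemma Standing.measure_state_sum_ge_le (ρ : ℝ) {G : S.State × (∀ i, Ξ i) → ℝ} (hG : Measurable G)
    (b c : ℕ → ℝ) (hc : ∀ s e, ∫⁻ ω, ENNReal.ofReal (Real.exp (b s * G (e, ω))) ∂S.law ≤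
      ENNReal.ofReal (Real.exp (c s))) (n : ℕ) (a : ℝ) :
    μ {w | a ≤ ∑ s ∈ Finset.range n, b s * G (hS.state ρ ξ s w, ξ s w)} ≤
      ENNReal.ofReal (Real.exp (∑ s ∈ Finset.range n, c s - a)) :=
  measure_sum_adaptive_ge_le hξ hlaw hind (hS.measurable_state (ξ := ξ) ρ)
    (g := fun s q => b s * G q) (c := c) (fun s => hG.const_mul (b s)) hc n a

lemma Standing.measure_gradSq_ge_le {ρ : ℝ} (h1 : S.fstar < ρ) (h2 : ρ ≤ r0) (n : ℕ) (a : ℝ) :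
    μ {w | a ≤ ∑ s ∈ Finset.range n, S.gradSq ρ (fun t => ξ t w) s / ((s : ℝ) + 1)} ≤
      ENNReal.ofReal (Real.exp (harmSum n - a)) := by
  have := hS.law_prob
  have mfst : Measurable fun q : S.State × (∀ i, Ξ i) => q.1.1.1.1 := by fun_prop
  have msnd : Measurable fun q : S.State × (∀ i, Ξ i) => q.1.1.1.2 := by fun_prop
  set G : S.State × (∀ i, Ξ i) → ℝ := fun q =>
    S.dualSq (S.Gx q.1.1.1.1 q.1.1.1.2 q.2, S.Gy ρ q.1.1.1.1 q.2) / S.M ^ 2 with hGdef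
  have hG : Measurable G := by
    have a1 := (continuous_dualNorm hS.dx_dgf.nrm_definite).measurable.comp
      (hS.measurable_Gx mfst (fun q => q.1.2.1.1) msnd measurable_snd)
    have a2 := (continuous_dualNorm hS.dy_dgf.nrm_definite).measurable.comp
      (hS.measurable_Gy (ρ := fun _ => ρ) measurable_const mfst (fun q => q.1.2.1.1) measurable_snd)
    exact (((a1.pow_const 2).const_mul _).add ((a2.pow_const 2).const_mul _)).div_const _
  have hc : ∀ (s : ℕ) (e : S.State), ∫⁻ ω, ENNReal.ofReal
      (Real.exp (1 / ((s : ℝ) + 1) * G (e, ω))) ∂S.law ≤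
        ENNReal.ofReal (Real.exp (1 / ((s : ℝ) + 1))) := by
    intro s e
    have hme : Measurable fun ω => G (e, ω) := hG.comp (measurable_const.prodMk measurable_id)
    have hle := hS.lintegral_gradSq_le h1 h2 e.2.1.1 e.2.1.2
    exact lintegral_exp_mul_le hme hle (by positivity)
      (div_le_one_of_le₀ (by linarith [(Nat.cast_nonneg s : (0 : ℝ) ≤ s)]) (by positivity))
  have key := hS.measure_state_sum_ge_le hξ hlaw hind ρ hG (fun s => 1 / ((s : ℝ) + 1))
    (fun s => 1 / ((s : ℝ) + 1)) hc n a
  refine le_trans (measure_mono fun w hw => ?_) key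
  rw [Set.mem_ofPred_eq] at hw ⊢
  refine le_trans hw (le_of_eq (Finset.sum_congr rfl fun s _ => ?_))
  simp only [gradSq, state, hGdef]
  ring

/-- Stated for arbitrary functions `x`, `y` of the state and either sign of `t`, so that it covers
the noise at the fixed `u` and, with the opposite sign, the noise along the auxiliary sequence. -/
lemma Standing.measure_noise_ge_le {ρ : ℝ} (h1 : S.fstar < ρ) (h2 : ρ ≤ r0)
    {x : S.State → Fin d → ℝ} {y : S.State → Fin (m + 1) → ℝ} (hx : Measurable x)
    (hy : Measurable y) (hxX : ∀ e, x e ∈ S.X) (hyY : ∀ e, y e ∈ S.Y) (t : ℝ) (n : ℕ) (a : ℝ) :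
    μ {w | a ≤ ∑ s ∈ Finset.range n, t * (1 / √((s : ℝ) + 1)) *
      (S.Phi ρ (x (hS.state ρ ξ s w)) (y (hS.state ρ ξ s w)) (ξ s w) -
        S.phi ρ (x (hS.state ρ ξ s w)) (y (hS.state ρ ξ s w)))} ≤
      ENNReal.ofReal (Real.exp (t ^ 2 * S.Q ^ 2 * harmSum n - a)) := by
  set G : S.State × (∀ i, Ξ i) → ℝ := fun q =>
    S.Phi ρ (x q.1) (y q.1) q.2 - S.phi ρ (x q.1) (y q.1) with hGdef
  have hG : Measurable G := by
    refine (hS.measurable_Phi measurable_const (hx.comp measurable_fst) (fun q => hxX q.1)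
      (hy.comp measurable_fst) measurable_snd).sub ?_
    have e : (fun q : S.State × (∀ i, Ξ i) => S.phi ρ (x q.1) (y q.1)) =
        fun q => ∑ i, y q.1 i * (S.f i (x q.1) - S.rhs ρ i) :=
      funext fun q => hS.phi_eq ρ (hxX q.1) _
    rw [e]
    refine Finset.measurable_fun_sum _ fun i _ => ?_
    exact ((measurable_pi_apply i).comp (hy.comp measurable_fst)).mul
      ((hS.measurable_f i (hx.comp measurable_fst) fun q => hxX q.1).sub_const _)
  have hc : ∀ (s : ℕ) (e : S.State), ∫⁻ ω, ENNReal.ofReal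
      (Real.exp (t * (1 / √((s : ℝ) + 1)) * G (e, ω))) ∂S.law ≤
        ENNReal.ofReal (Real.exp ((t * (1 / √((s : ℝ) + 1))) ^ 2 * S.Q ^ 2)) :=
    fun s e => hS.lintegral_noise_le h1 h2 (hxX e) (hyY e) _
  have key := hS.measure_state_sum_ge_le hξ hlaw hind ρ hG
    (fun s => t * (1 / √((s : ℝ) + 1))) (fun s => (t * (1 / √((s : ℝ) + 1))) ^ 2 * S.Q ^ 2) hc n a
  have e : ∑ s ∈ Finset.range n, (t * (1 / √((s : ℝ) + 1))) ^ 2 * S.Q ^ 2 =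
      t ^ 2 * S.Q ^ 2 * harmSum n := by
    rw [← rootSum_sq_sum, Finset.mul_sum]
    exact Finset.sum_congr rfl fun s _ => by ring
  rw [e] at key
  exact key

/-- Failure probability of one call at a fixed level. -/
lemma Standing.call_failure_le {ρ : ℝ} (h1 : S.fstar < ρ) (h2 : ρ ≤ r0) (T : ℕ) {Om : ℝ}
    (hOm : 0 < Om) {u : Fin d → ℝ} (hu : u ∈ S.X) :
    μ {w | ¬ (S.uhat ρ (fun t => ξ t w) T ≤ S.P ρ u + S.callError (T + 1) Om ∧
      S.P ρ (S.xbar ρ (fun t => ξ t w) T) ≤ S.uhat ρ (fun t => ξ t w) T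
        + S.callError (T + 1) Om)} ≤
      ENNReal.ofReal (Real.exp (-(10 * Om * harmSum (T + 1))) +
        2 * Real.exp (-(Om ^ 2 / 4 * harmSum (T + 1)))) := by
  set n := T + 1 with hn
  have hB := harmSum_pos (Nat.succ_pos T)
  have hA := rootSum_pos (Nat.succ_pos T)
  rw [← Nat.add_one, ← hn] at hB hA
  have hM := hS.M_pos
  have hQ := hS.Q_pos
  -- This value minimizes the Chernoff exponent `t ^ 2 * Q ^ 2 - t * Q * Om`, with minimum `-Om ^ 2
  -- / 4`.
  set t : ℝ := Om / (2 * S.Q) with ht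
  have hE1 := hS.measure_gradSq_ge_le hξ hlaw hind h1 h2 n (harmSum n * (1 + 10 * Om))
  have hE2 := hS.measure_noise_ge_le hξ hlaw hind h1 h2 (x := fun _ => u) (y := fun e => e.1.1.2)
    measurable_const (by fun_prop) (fun _ => hu) (fun e => e.2.1.2) t n
    (t * (S.Q * Om * harmSum n))
  have hE3 := hS.measure_noise_ge_le hξ hlaw hind h1 h2 (x := fun e => e.1.1.1)
    (y := fun e => e.1.2) (by fun_prop) (by fun_prop) (fun e => e.2.1.1) (fun e => e.2.2) (-t) n
    (t * (S.Q * Om * harmSum n))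
  have c1 : harmSum n - harmSum n * (1 + 10 * Om) = -(10 * Om * harmSum n) := by ring
  have c2 : t ^ 2 * S.Q ^ 2 * harmSum n - t * (S.Q * Om * harmSum n) =
      -(Om ^ 2 / 4 * harmSum n) := by
    rw [ht]
    field_simp
    ring
  rw [neg_sq] at hE3
  rw [c1] at hE1
  rw [c2] at hE2 hE3
  have hcover : {w | ¬ (S.uhat ρ (fun t => ξ t w) T ≤ S.P ρ u + S.callError n Om ∧
      S.P ρ (S.xbar ρ (fun t => ξ t w) T) ≤ S.uhat ρ (fun t => ξ t w) T
        + S.callError n Om)} ⊆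
      {w | harmSum n * (1 + 10 * Om) ≤ 
        ∑ s ∈ Finset.range n, S.gradSq ρ (fun t => ξ t w) s / ((s : ℝ) + 1)} ∪
      ({w | t * (S.Q * Om * harmSum n) ≤ ∑ s ∈ Finset.range n, t * (1 / √((s : ℝ) + 1)) *
        (S.Phi ρ u (hS.state ρ ξ s w).1.1.2 (ξ s w) - S.phi ρ u (hS.state ρ ξ s w).1.1.2)} ∪
      {w | t * (S.Q * Om * harmSum n) ≤ ∑ s ∈ Finset.range n, -t * (1 / √((s : ℝ) + 1)) *
        (S.Phi ρ (hS.state ρ ξ s w).1.1.1 (hS.state ρ ξ s w).1.2 (ξ s w) -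
          S.phi ρ (hS.state ρ ξ s w).1.1.1 (hS.state ρ ξ s w).1.2)}) := by
    intro w hw
    by_contra hcon
    simp only [Set.mem_union, not_or, Set.mem_ofPred_eq, not_le] at hcon
    obtain ⟨g1, g2, g3⟩ := hcon
    apply hw
    set η : ℕ → ∀ i, Ξ i := fun t => ξ t w with hη
    have htpos : 0 < t := by positivity
    have g1' := g1.le
    have g2' : ∑ s ∈ Finset.range n, 1 / √((s : ℝ) + 1) *
        (S.Phi ρ u (S.iter ρ η s).2 (η s) - S.phi ρ u (S.iter ρ η s).2) ≤
        S.Q * Om * harmSum n := by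
      refine le_of_mul_le_mul_left (le_trans (le_of_eq ?_) g2.le) htpos
      rw [Finset.mul_sum]
      refine Finset.sum_congr rfl fun s _ => ?_
      simp only [state, hη]
      ring
    have g3' : ∑ s ∈ Finset.range n, 1 / √((s : ℝ) + 1) *
        (S.phi ρ (S.iter ρ η s).1 (S.aux ρ η s).2 -
          S.Phi ρ (S.iter ρ η s).1 (S.aux ρ η s).2 (η s)) ≤ S.Q * Om * harmSum n := by
      refine le_of_mul_le_mul_left (le_trans (le_of_eq ?_) g3.le) htpos
      rw [Finset.mul_sum]
      refine Finset.sum_congr rfl fun s _ => ?_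
      simp only [state, hη]
      ring
    refine ⟨uhat_le fun y hy => (hS.validation_le ρ η T hu hy).trans ?_,
      (hS.P_xbar_le h1 h2 η T).trans ?_⟩
    · rw [← hn]
      refine add_le_add le_rfl (div_le_div_of_nonneg_right (add_le_add
        (mul_le_mul_of_nonneg_left ?_ hM.le) g2') hA.le)
      nlinarith [mul_pos hB hOm]
    · rw [← hn]
      refine add_le_add le_rfl (div_le_div_of_nonneg_right (add_le_add
        (mul_le_mul_of_nonneg_left ?_ hM.le) g3') hA.le)
      linarith
  refine (measure_mono hcover).trans ((measure_union_le _ _).trans ?_)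
  refine (add_le_add hE1 ((measure_union_le _ _).trans (add_le_add hE2 hE3))).trans ?_
  rw [← ENNReal.ofReal_add (by positivity) (by positivity),
    ← ENNReal.ofReal_add (by positivity) (by positivity)]
  exact ENNReal.ofReal_le_ofReal (le_of_eq (by ring))

end SOEC

end SFLS

/-! ### What the iteration limit guarantees. -/

namespace SFLS

lemma harmSum_eq_harmonic (n : ℕ) : harmSum n = (harmonic n : ℝ) := by
  simp [harmSum, harmonic]

lemma log_add_one_le_harmSum (n : ℕ) : Real.log ((n : ℝ) + 1) ≤ harmSum n := by
  rw [harmSum_eq_harmonic]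
  exact_mod_cast log_add_one_le_harmonic n

lemma harmSum_le (n : ℕ) (hn : 0 < n) : harmSum n ≤ 1 + Real.log ((n : ℝ) + 1) := by
  rw [harmSum_eq_harmonic]
  refine (harmonic_le_one_add_log n).trans ?_
  have : (0 : ℝ) < n := by exact_mod_cast hn
  gcongr
  linarith

lemma le_rootSum (n : ℕ) : 2 * (√((n : ℝ) + 1) - 1) ≤ rootSum n := by
  induction n with
  | zero => simp [rootSum]
  | succ n ih =>
    have hstep : rootSum (n + 1) = rootSum n + 1 / √((n : ℝ) + 1) := by
      simp [rootSum, Finset.sum_range_succ]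
    rw [hstep]
    push_cast
    set a := √((n : ℝ) + 1) with ha
    set b := √((n : ℝ) + 1 + 1) with hb
    have ha0 : 0 < a := Real.sqrt_pos.2 (by positivity)
    have ha2 : a ^ 2 = (n : ℝ) + 1 := Real.sq_sqrt (by positivity)
    have hb2 : b ^ 2 = (n : ℝ) + 1 + 1 := Real.sq_sqrt (by positivity)
    have : 2 * (b - a) ≤ 1 / a := by
      rw [le_div_iff₀ ha0]
      nlinarith [sq_nonneg (b - a)]
    linarith

/-- Used with `N = √(T + 2)`, where `1 + 2 * log N` bounds `harmSum` and `2 * (N - 1)` bounds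
`rootSum` from below: a limit of order `x * log x` beats the logarithm in the error. For `x ≤ 2` the
bound `log N ≤ N - 1` suffices; otherwise `log` is bounded by its tangent at `2 * x * log x`. -/
lemma mul_one_add_log_le {x N : ℝ} (hN : 14 / 5 ≤ N) (hx : 0 < x)
    (h : 2 * x * Real.log x ≤ N) : x * (1 + 2 * Real.log N) ≤ 8 * (N - 1) := by
  have hN0 : 0 < N := by linarith
  have hlN : Real.log N ≤ N - 1 := Real.log_le_sub_one_of_pos hN0
  have hlN0 : 0 ≤ Real.log N := Real.log_nonneg (by linarith)
  rcases le_or_gt x 2 with h2 | h2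
  · calc x * (1 + 2 * Real.log N) ≤ 2 * (1 + 2 * Real.log N) := by gcongr
      _ ≤ 8 * (N - 1) := by linarith
  · set u := Real.log x with hu
    have hl2 := Real.log_two_gt_d9
    have hl2' := Real.log_two_lt_d9
    have hu2 : 0.69 ≤ u := by
      have : Real.log 2 ≤ u := Real.log_le_log (by norm_num) h2.le
      linarith
    have hu0 : 0 < u := by linarith
    have ha : 0 < 2 * x * u := by positivity
    have h1 : Real.log N ≤ Real.log (2 * x * u) + N / (2 * x * u) - 1 := by
      have h3 := Real.log_le_sub_one_of_pos (div_pos hN0 ha)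
      rw [Real.log_div hN0.ne' ha.ne'] at h3
      linarith
    have h3 : Real.log (2 * x * u) ≤ 0.7 + u + (u - 1) := by
      rw [Real.log_mul (by positivity) hu0.ne', Real.log_mul (by norm_num) hx.ne']
      have := Real.log_le_sub_one_of_pos hu0
      linarith
    have h4 : x * (N / (2 * x * u)) = N / (2 * u) := by field_simp
    have h5 : N / (2 * u) ≤ N * 0.73 := by
      rw [div_le_iff₀ (by positivity)]
      nlinarith
    have h6 : x * Real.log N ≤ x * (2 * u - 1.3) + N / (2 * u) := by
      rw [← h4, ← mul_add]
      gcongr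
      linarith
    nlinarith

namespace SOEC

variable {d m : ℕ} {Ξ : Fin (m + 1) → Type*} [∀ i, MeasurableSpace (Ξ i)] {S : SOEC d m Ξ}

lemma le_bigOmega {δ : ℝ} : 4 / 3 * Real.log (24 / δ) ≤ bigOmega δ := le_max_right _ _

lemma three_le_log {δ : ℝ} (h0 : 0 < δ) (h1 : δ < 1) : 3 ≤ Real.log (24 / δ) := by
  rw [Real.le_log_iff_exp_le (by positivity)]
  have h2 : Real.exp 3 ≤ 24 := by
    have := Real.exp_one_lt_d9
    have e : Real.exp 3 = Real.exp 1 ^ 3 := by rw [← Real.exp_nat_mul]; norm_num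
    rw [e]
    calc Real.exp 1 ^ 3 ≤ 2.7182818286 ^ 3 := by gcongr
      _ ≤ 24 := by norm_num
  refine h2.trans ?_
  rw [le_div_iff₀ h0]
  linarith

lemma bigOmega_pos {δ : ℝ} (h0 : 0 < δ) (h1 : δ < 1) : 4 ≤ bigOmega δ := by
  have := three_le_log h0 h1
  linarith [le_bigOmega (δ := δ)]

lemma le_bigOmega_sq {δ : ℝ} (h0 : 0 < δ) (h1 : δ < 1) :
    12 * Real.log (24 / δ) ≤ bigOmega δ ^ 2 := by
  have := three_le_log h0 h1
  have h2 : √(12 * Real.log (24 / δ)) ≤ bigOmega δ := le_max_left _ _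
  calc 12 * Real.log (24 / δ) = √(12 * Real.log (24 / δ)) ^ 2 :=
        (Real.sq_sqrt (by linarith)).symm
    _ ≤ _ := by gcongr

/-- The quantity `X_δ`. -/
noncomputable def bigX (S : SOEC d m Ξ) (δ : ℝ) : ℝ :=
  S.Q * bigOmega δ + 10 * S.M * bigOmega δ + 4.5 * S.M

lemma limitReal_eq (δ ε : ℝ) : S.limitReal δ ε =
    max 6 ((2 * (8 * S.bigX δ / ε) * Real.log (8 * S.bigX δ / ε)) ^ 2 - 2) := by
  unfold limitReal bigX
  congr 3
  ring

lemma six_le_of_limit {δ ε : ℝ} {T : ℕ} (hT : S.limitReal δ ε ≤ T) : (6 : ℝ) ≤ T :=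
  (le_max_left _ _).trans hT

lemma sq_le_of_limit {δ ε : ℝ} {T : ℕ} (hT : S.limitReal δ ε ≤ T) :
    (2 * (8 * S.bigX δ / ε) * Real.log (8 * S.bigX δ / ε)) ^ 2 ≤ (T : ℝ) + 2 := by
  rw [limitReal_eq] at hT
  linarith [(le_max_right _ _).trans hT]

/-- Since `harmSum ≥ 1`, the numerator of `callError` is at most `bigX δ * harmSum`, and the limit
makes `harmSum / rootSum` at most `4 / x` with `x = 8 * bigX δ / ε`. The other half of `ε` is kept
for a near-minimizer of `P`. -/
lemma callError_le (hM : 0 < S.M) (hQ : 0 < S.Q) {δ ε : ℝ} (h0 : 0 < δ) (h1 : δ < 1) (hε : 0 < ε)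
    {T : ℕ} (hT : S.limitReal δ ε ≤ T) : S.callError (T + 1) (bigOmega δ) ≤ ε / 2 := by
  have hOm := bigOmega_pos h0 h1
  have hX : 0 < S.bigX δ := by unfold bigX; positivity
  have hT6 := six_le_of_limit hT
  set x := 8 * S.bigX δ / ε with hx
  have hx0 : 0 < x := by positivity
  have hsq := sq_le_of_limit hT
  rw [← hx] at hsq
  set N := √((T : ℝ) + 2) with hNdef
  have hN2 : N ^ 2 = (T : ℝ) + 2 := Real.sq_sqrt (by positivity)
  -- The floor `6` in the limit gives `T + 2 ≥ 8`, while `(14 / 5) ^ 2 = 7.84`.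
  have hN : 14 / 5 ≤ N := by
    refine Real.le_sqrt_of_sq_le ?_
    linarith
  have hxN : 2 * x * Real.log x ≤ N := by
    refine Real.le_sqrt_of_sq_le hsq
  have key := mul_one_add_log_le hN hx0 hxN
  have hA : 2 * (N - 1) ≤ rootSum (T + 1) := by
    have := le_rootSum (T + 1)
    push_cast at this
    rwa [add_assoc, one_add_one_eq_two, ← hNdef] at this
  have hB : harmSum (T + 1) ≤ 1 + 2 * Real.log N := by
    have := harmSum_le (T + 1) (Nat.succ_pos T)
    push_cast at this
    rw [add_assoc, one_add_one_eq_two, ← hN2, Real.log_pow] at this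
    exact_mod_cast this
  have hB1 : 1 ≤ harmSum (T + 1) := by
    have h2 : (1 : ℝ) / (((0 : ℕ) : ℝ) + 1) ≤ harmSum (T + 1) :=
      Finset.single_le_sum (f := fun s : ℕ => 1 / ((s : ℝ) + 1)) (fun s _ => by positivity)
        (Finset.mem_range.2 (Nat.succ_pos T))
    simpa using h2
  have hA0 := rootSum_pos (Nat.succ_pos T)
  have hxB : x * harmSum (T + 1) ≤ 4 * rootSum (T + 1) := by
    calc x * harmSum (T + 1) ≤ x * (1 + 2 * Real.log N) := by gcongr
      _ ≤ 8 * (N - 1) := key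
      _ ≤ _ := by linarith
  unfold callError
  rw [div_le_iff₀ hA0]
  have e : S.bigX δ * harmSum (T + 1) ≤ ε / 2 * rootSum (T + 1) := by
    have : S.bigX δ = ε / 8 * x := by rw [hx]; field_simp
    rw [this]
    nlinarith
  refine le_trans ?_ e
  unfold bigX
  have hMB := mul_le_mul_of_nonneg_left hB1 hM.le
  nlinarith

/-- Both exponents are at least `3 * harmSum * log (24 / δ)`, and `harmSum ≥ log (T + 2)`. So
besides `δ` a power of `T + 2` is gained, which later pays for the union over the Phase 2 calls that
share `δ`. -/
lemma failure_le {δ : ℝ} (h0 : 0 < δ) (h1 : δ < 1) {T : ℕ} (hT : (6 : ℝ) ≤ T) :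
    Real.exp (-(10 * bigOmega δ * harmSum (T + 1))) +
        2 * Real.exp (-(bigOmega δ ^ 2 / 4 * harmSum (T + 1))) ≤
      δ / 8 / ((T : ℝ) + 2) ^ 7 := by
  set L := Real.log (24 / δ) with hL
  have hL3 : 3 ≤ L := three_le_log h0 h1
  have hO1 : 4 / 3 * L ≤ bigOmega δ := le_bigOmega
  have hO2 : 12 * L ≤ bigOmega δ ^ 2 := le_bigOmega_sq h0 h1
  set B := harmSum (T + 1)
  have hlog : Real.log ((T : ℝ) + 2) ≤ B := by
    have := log_add_one_le_harmSum (T + 1)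
    push_cast at this
    rwa [add_assoc, one_add_one_eq_two] at this
  have hB2 : 2 ≤ B := by
    have h8 : Real.log 8 ≤ Real.log ((T : ℝ) + 2) := Real.log_le_log (by norm_num) (by linarith)
    have e8 : Real.log 8 = 3 * Real.log 2 := by
      rw [show (8 : ℝ) = 2 ^ 3 by norm_num, Real.log_pow]; norm_num
    linarith [Real.log_two_gt_d9]
  have b1 : 3 * (B * L) ≤ 10 * bigOmega δ * B := by nlinarith
  have b2 : 3 * (B * L) ≤ bigOmega δ ^ 2 / 4 * B := by nlinarith
  have b3 : L + 7 * Real.log ((T : ℝ) + 2) ≤ 3 * (B * L) := by nlinarith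
  have c1 : Real.exp (-(10 * bigOmega δ * B)) ≤ Real.exp (-(3 * (B * L))) :=
    Real.exp_le_exp.2 (by linarith)
  have c2 : Real.exp (-(bigOmega δ ^ 2 / 4 * B)) ≤ Real.exp (-(3 * (B * L))) :=
    Real.exp_le_exp.2 (by linarith)
  have c3 : Real.exp (-(3 * (B * L))) ≤ δ / 24 / ((T : ℝ) + 2) ^ 7 := by
    calc Real.exp (-(3 * (B * L))) ≤ Real.exp (-(L + 7 * Real.log ((T : ℝ) + 2))) :=
          Real.exp_le_exp.2 (by linarith)
      _ = δ / 24 / ((T : ℝ) + 2) ^ 7 := by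
          have hT2 : (0 : ℝ) < (T : ℝ) + 2 := by linarith
          have e7 : (7 : ℝ) * Real.log ((T : ℝ) + 2) = Real.log (((T : ℝ) + 2) ^ 7) := by
            rw [Real.log_pow]; norm_num
          rw [Real.exp_neg, Real.exp_add, e7, Real.exp_log (by positivity),
            Real.exp_log (by positivity)]
          field_simp
  calc _ ≤ 3 * (δ / 24 / ((T : ℝ) + 2) ^ 7) := by linarith
    _ = _ := by ring

end SOEC

end SFLS

/-! ### The level-set function and the condition measure. -/

namespace SFLS

namespace SOEC

variable {d m : ℕ} {Ξ : Fin (m + 1) → Type*} [∀ i, MeasurableSpace (Ξ i)] {S : SOEC d m Ξ}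

@[simp] lemma rhs_zero (ρ : ℝ) : S.rhs ρ 0 = ρ := by simp [rhs]

@[simp] lemma rhs_succ (ρ : ℝ) (i : Fin m) : S.rhs ρ i.succ = S.r i := by simp [rhs]

lemma P_le_add (ρ ρ' : ℝ) (x : Fin d → ℝ) : S.P ρ' x ≤ S.P ρ x + |ρ - ρ'| := by
  rw [P_le_iff]
  intro i
  have h1 := S.le_P ρ x i
  refine Fin.cases (fun h1 => ?_) (fun j h1 => ?_) i h1
  · simp only [rhs_zero] at *
    linarith [le_abs_self (ρ - ρ')]
  · simp only [rhs_succ] at *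
    linarith [abs_nonneg (ρ - ρ')]

lemma mem_feasible_of_P_nonpos {ρ : ℝ} {x : Fin d → ℝ} (hx : x ∈ S.X) (h : S.P ρ x ≤ 0) :
    x ∈ S.feasible := by
  refine ⟨hx, fun i => ?_⟩
  have := (S.le_P ρ x i.succ).trans h
  rw [rhs_succ] at this
  linarith

lemma f_zero_le (ρ : ℝ) (x : Fin d → ℝ) : S.f 0 x ≤ ρ + S.P ρ x := by
  have := S.le_P ρ x 0
  rw [rhs_zero] at this
  linarith

variable {r0 : ℝ} (hS : S.Standing r0)
include hS

/-- The expected subgradient at one point gives an affine minorant, bounded below on the compact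
`S.X`. The infima defining `fstar` and `H` are thus genuine; they are only ever approached by
near-minimizers, never assumed attained. -/
lemma Standing.bddBelow_f (i : Fin (m + 1)) : BddBelow (S.f i '' S.X) := by
  have := hS.law_prob
  obtain ⟨x, hx⟩ := hS.X_nonempty
  have hF' : ∀ j, Integrable (fun ξ : ∀ i, Ξ i => S.F' i x (ξ i) j) S.law :=
    fun j => (hS.F'_integrable i x hx).eval j
  set v : Fin d → ℝ := fun j => ∫ ξ, S.F' i x (ξ i) j ∂S.law with hv
  have hsub : ∀ x' ∈ S.X, S.f i x + v ⬝ᵥ (x' - x) ≤ S.f i x' := by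
    intro x' hx'
    have e : v ⬝ᵥ (x' - x) = ∫ ξ : ∀ i, Ξ i, S.F' i x (ξ i) ⬝ᵥ (x' - x) ∂S.law := by
      simp only [dotProduct, hv]
      rw [integral_finsetSum _ fun j _ => (hF' j).mul_const _]
      exact Finset.sum_congr rfl fun j _ => (integral_mul_const _ _).symm
    have hi : Integrable (fun ξ : ∀ i, Ξ i => S.F' i x (ξ i) ⬝ᵥ (x' - x)) S.law :=
      integrable_finsetSum _ fun j _ => (hF' j).mul_const _
    rw [e]
    simp only [f]
    rw [← integral_add (hS.F_integrable i x hx) hi]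
    exact integral_mono ((hS.F_integrable i x hx).add hi) (hS.F_integrable i x' hx')
      fun ξ => hS.F'_subgradient i (ξ i) x hx x' hx'
  have hc : ContinuousOn (fun x' : Fin d → ℝ => S.f i x + v ⬝ᵥ (x' - x)) S.X := by
    refine Continuous.continuousOn ?_
    simp only [dotProduct]
    fun_prop
  obtain ⟨b, hb⟩ := hS.X_compact.bddBelow_image hc
  refine ⟨b, ?_⟩
  rintro _ ⟨x', hx', rfl⟩
  exact (hb ⟨x', hx', rfl⟩).trans (hsub x' hx')

lemma Standing.fstar_le {x : Fin d → ℝ} (hx : x ∈ S.feasible) : S.fstar ≤ S.f 0 x :=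
  csInf_le ((hS.bddBelow_f 0).mono (Set.image_mono fun _ h => h.1)) ⟨x, hx, rfl⟩

lemma Standing.exists_near_optimal {a : ℝ} (ha : S.fstar < a) :
    ∃ x ∈ S.feasible, S.f 0 x < a := by
  obtain ⟨x, hx, hlt, -⟩ := hS.strictly_feasible
  have hf : x ∈ S.feasible := ⟨hx, fun i => (hlt i).le⟩
  obtain ⟨_, ⟨y, hy, rfl⟩, hya⟩ := exists_lt_of_csInf_lt (Set.Nonempty.image (S.f 0) ⟨x, hf⟩) ha
  exact ⟨y, hy, hya⟩

lemma Standing.H_le (ρ : ℝ) {x : Fin d → ℝ} (hx : x ∈ S.X) : S.H ρ ≤ S.P ρ x := by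
  refine csInf_le ?_ ⟨x, hx, rfl⟩
  obtain ⟨b, hb⟩ := hS.bddBelow_f 0
  refine ⟨b - ρ, ?_⟩
  rintro _ ⟨y, hy, rfl⟩
  have h1 := hb ⟨y, hy, rfl⟩
  have h2 := S.f_zero_le ρ y
  linarith

lemma Standing.le_H {ρ a : ℝ} (h : ∀ x ∈ S.X, a ≤ S.P ρ x) : a ≤ S.H ρ := by
  refine le_csInf (hS.X_nonempty.image _) ?_
  rintro _ ⟨x, hx, rfl⟩
  exact h x hx

lemma Standing.exists_near_H {ρ a : ℝ} (ha : S.H ρ < a) : ∃ x ∈ S.X, S.P ρ x < a := by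
  obtain ⟨_, ⟨y, hy, rfl⟩, hya⟩ := exists_lt_of_csInf_lt (hS.X_nonempty.image _) ha
  exact ⟨y, hy, hya⟩

lemma Standing.H_le_add (ρ ρ' : ℝ) : S.H ρ' ≤ S.H ρ + |ρ - ρ'| := by
  have := hS.le_H (ρ := ρ) (a := S.H ρ' - |ρ - ρ'|) fun x hx => by
    linarith [hS.H_le ρ' hx, S.P_le_add ρ ρ' x]
  linarith

lemma Standing.continuous_H : Continuous S.H := by
  have : LipschitzWith 1 S.H := LipschitzWith.of_dist_le_mul fun a b => by
    rw [Real.dist_eq, Real.dist_eq, NNReal.coe_one, one_mul, abs_sub_le_iff]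
    have h1 := hS.H_le_add b a
    have h2 := hS.H_le_add a b
    rw [abs_sub_comm] at h1
    constructor <;> linarith
  exact this.continuous

lemma Standing.neg_le_H {ρ : ℝ} (hρ : S.fstar ≤ ρ) : -(ρ - S.fstar) ≤ S.H ρ := by
  refine hS.le_H fun x hx => ?_
  by_cases hf : ∀ i : Fin m, S.f i.succ x ≤ S.r i
  · have h1 := hS.fstar_le ⟨hx, hf⟩
    have h2 := S.f_zero_le ρ x
    linarith
  · push Not at hf
    obtain ⟨i, hi⟩ := hf
    have := S.le_P ρ x i.succ
    rw [rhs_succ] at this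
    linarith

/-- A near-optimal feasible point is mixed with the strictly feasible one. The weight `l` is small
enough to keep the objective below `r0`, while every constraint becomes strict. -/
lemma Standing.H_neg (hr : S.fstar < r0) : S.H r0 < 0 := by
  obtain ⟨x, hx, hlt, -⟩ := hS.strictly_feasible
  obtain ⟨y, hy, hyr⟩ := hS.exists_near_optimal hr
  set g := r0 - S.f 0 y with hg
  have hg0 : 0 < g := by linarith
  set Δ := S.f 0 x - S.f 0 y with hΔ
  set l := g / (g + |Δ| + 1) with hl
  have hden : 0 < g + |Δ| + 1 := by positivity
  have hl0 : 0 < l := by positivity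
  have hl1 : l < 1 := by
    rw [hl, div_lt_one hden]
    linarith [abs_nonneg Δ]
  have hlΔ : l * Δ < g := by
    rw [hl, div_mul_eq_mul_div, div_lt_iff₀ hden]
    nlinarith [le_abs_self Δ]
  have hz : (1 - l) • y + l • x ∈ S.X := hS.X_convex hy.1 hx (by linarith) hl0.le (by ring)
  refine (hS.H_le r0 hz).trans_lt ?_
  unfold P
  rw [Finset.sup'_lt_iff]
  intro i _
  have hconv := (hS.f_convexOn i).2 hy.1 hx (by linarith : 0 ≤ 1 - l) hl0.le (by ring)
  simp only [smul_eq_mul] at hconv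
  refine Fin.cases (fun hconv => ?_) (fun j hconv => ?_) i hconv
  · rw [rhs_zero]
    nlinarith
  · rw [rhs_succ]
    have h1 := mul_le_mul_of_nonneg_left (hy.2 j) (by linarith : 0 ≤ 1 - l)
    have h2 := mul_lt_mul_of_pos_left (hlt j) hl0
    linarith

omit hS in
lemma H_eq_beta (hr : S.fstar < r0) : S.H r0 = -(S.beta r0 * (r0 - S.fstar)) := by
  have : r0 - S.fstar ≠ 0 := by linarith
  unfold beta
  field_simp

lemma Standing.beta_pos (hr : S.fstar < r0) : 0 < S.beta r0 :=
  div_pos (neg_pos.2 (hS.H_neg hr)) (sub_pos.2 hr)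

lemma Standing.beta_le_one (hr : S.fstar < r0) : S.beta r0 ≤ 1 := by
  unfold beta
  rw [div_le_one (sub_pos.2 hr)]
  linarith [hS.neg_le_H hr.le]

/-- Convexity: on `[f*, r0]` the function `H` lies below the chord from `0` at `f*` to `H r0` at
`r0`. The convex combination is formed with an `η`-minimizer of `P r0` and an `η`-optimal feasible
point. -/
lemma Standing.H_le_beta (hr : S.fstar < r0) {ρ : ℝ} (h1 : S.fstar ≤ ρ) (h2 : ρ ≤ r0) :
    S.H ρ ≤ -(S.beta r0 * (ρ - S.fstar)) := by
  have hD : 0 < r0 - S.fstar := sub_pos.2 hr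
  set l := (ρ - S.fstar) / (r0 - S.fstar) with hl
  have hl0 : 0 ≤ l := div_nonneg (by linarith) hD.le
  have hl1 : l ≤ 1 := by rw [hl, div_le_one hD]; linarith
  have hρ : ρ = l * r0 + (1 - l) * S.fstar := by
    rw [hl]; field_simp; ring
  have e : -(S.beta r0 * (ρ - S.fstar)) = l * S.H r0 := by
    rw [H_eq_beta hr, hl]
    field_simp
  rw [e]
  refine le_of_forall_pos_lt_add fun η hη => ?_
  obtain ⟨x, hx, hxP⟩ := hS.exists_near_H (lt_add_of_pos_right (S.H r0) hη)
  obtain ⟨y, hy, hyf⟩ := hS.exists_near_optimal (lt_add_of_pos_right S.fstar hη)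
  have hz : l • x + (1 - l) • y ∈ S.X := hS.X_convex hx hy.1 hl0 (by linarith) (by ring)
  refine (hS.H_le ρ hz).trans_lt ?_
  unfold P
  rw [Finset.sup'_lt_iff]
  intro i _
  have hconv := (hS.f_convexOn i).2 hx hy.1 hl0 (by linarith : 0 ≤ 1 - l) (by ring)
  simp only [smul_eq_mul] at hconv
  have hlt : ∀ a b : ℝ, a < η → b < η → l * a + (1 - l) * b < η := by
    intro a b ha hb
    rcases hl0.eq_or_lt with h | h
    · rw [← h]; linarith
    · have := mul_lt_mul_of_pos_left ha h
      have := mul_le_mul_of_nonneg_left hb.le (by linarith : 0 ≤ 1 - l)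
      linarith
  have hxi := (S.le_P r0 x i).trans_lt hxP
  refine Fin.cases (fun hconv hxi => ?_) (fun j hconv hxi => ?_) i hconv hxi
  · rw [rhs_zero] at hxi ⊢
    have := hlt (S.f 0 x - r0 - S.H r0) (S.f 0 y - S.fstar) (by linarith) (by linarith)
    rw [hρ]
    linarith
  · rw [rhs_succ] at hxi ⊢
    have := hlt (S.f j.succ x - S.r j - S.H r0) (S.f j.succ y - S.r j) (by linarith)
      (by linarith [hy.2 j])
    linarith

/-- Testing the mean of `Gy` against the difference of two vertices bounds `|f 0 x - ρ - (f 1 x - r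
0)|` by `2 * M` at every admissible level. As `ρ` sweeps `(f*, r0]` this quantity moves by `r0 -
f*`. -/
lemma Standing.sub_fstar_le : r0 - S.fstar ≤ 4 * S.M := by
  by_contra hcon
  push Not at hcon
  have hM := hS.M_pos
  have hMy := hS.My_pos
  have hα := hS.dy_dgf.α_pos
  have hαx := hS.dx_dgf.α_pos
  obtain ⟨x, hx⟩ := hS.X_nonempty
  obtain ⟨k, hk⟩ : ∃ k, m = k + 1 := ⟨m - 1, by have := hS.m_pos; omega⟩
  subst hk
  set e0 : Fin (k + 1 + 1) → ℝ := Pi.single 0 1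
  set e1 : Fin (k + 1 + 1) → ℝ := Pi.single 1 1
  have hw := DGF.nrm_sq_le_width_sq convex_Y isCompact_Y hS.dy_dgf
    (single_mem_Y (S := S) 0) (single_mem_Y (S := S) 1)
  have hbound : S.My * S.dy.nrm (e0 - e1) ≤ 2 * S.M := by
    refine abs_le_of_sq_le_sq' ?_ (by positivity) |>.2
    rw [mul_pow, mul_pow, hS.M_sq]
    have h1 : S.dy.nrm (e0 - e1) ^ 2 ≤ 8 * S.Dy ^ 2 / S.dy.α := by
      rw [le_div_iff₀ hα, mul_comm]
      exact hw
    have h2 : 0 ≤ 2 * S.Dx ^ 2 / S.dx.α * S.Mx ^ 2 := by positivity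
    have h3 := mul_le_mul_of_nonneg_left h1 (sq_nonneg S.My)
    have h4 : S.My ^ 2 * (8 * S.Dy ^ 2 / S.dy.α) = 4 * (2 * S.Dy ^ 2 / S.dy.α * S.My ^ 2) := by
      ring
    linarith
  have key : ∀ ρ, S.fstar < ρ → ρ ≤ r0 →
      |S.f 0 x - ρ - (S.f 1 x - S.r 0)| ≤ 2 * S.M := by
    intro ρ h1 h2
    have a1 := hS.dot_mean_Gy_le h1 h2 hx (e0 - e1)
    have a2 := hS.dot_mean_Gy_le h1 h2 hx (e1 - e0)
    have hs : S.dy.nrm (e1 - e0) = S.dy.nrm (e0 - e1) := map_sub_rev _ _ _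
    rw [hs] at a2
    have r1 : S.rhs ρ 1 = S.r 0 := S.rhs_succ ρ 0
    simp only [dotProduct_sub, e0, e1, dotProduct_single, rhs_zero, r1, mul_one] at a1 a2
    simp only [e0, e1] at hbound
    rw [abs_le]
    constructor <;> linarith
  have k1 := (abs_le.1 (key r0 (by linarith) le_rfl)).1
  -- The level `f*` itself is not admissible, so a level strictly above it is taken at distance more
  -- than `4 * M` from `r0`.
  set ρ := r0 - (r0 - S.fstar + 4 * S.M) / 2 with hρ
  have k2 := (abs_le.1 (key ρ (by linarith) (by linarith))).2
  linarith

end SOEC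

/-! ### Deterministic analysis of the level updates. -/

/-- A bound on the number of level updates. -/
noncomputable def levelCount (β θ ε : ℝ) : ℕ :=
  ⌈3 * θ / β * Real.log (2 * θ ^ 2 / (β * ε))⌉₊

/-- The level updates stop at a level close to the optimal value. -/
lemma level_updates_stop {H : ℝ → ℝ} {fs r0 β θ ε eo ea : ℝ} {r u : ℕ → ℝ}
    (hr0 : fs < r0) (hβ : 0 < β) (hβ1 : β ≤ 1) (hθ : 1 < θ) (hε : 0 < ε) (hε1 : ε ≤ 1)
    (hLip : ∀ a b, H b ≤ H a + |a - b|) (hlow : ∀ a, fs ≤ a → -(a - fs) ≤ H a)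
    (hup : ∀ a, fs ≤ a → a ≤ r0 → H a ≤ -(β * (a - fs)))
    (hea : 0 < ea) (heo : 8 * ea ≤ eo) (heo1 : β * (r0 - fs) * ε / θ ^ 2 ≤ eo)
    (heo2 : eo + ea ≤ β * (r0 - fs) * ε)
    (h0 : r 0 = r0) (hstep : ∀ k, r (k + 1) = r k + u k / (2 * θ))
    (hacc : ∀ k ≤ levelCount β θ ε, fs < r k → r k ≤ r0 → H (r k) ≤ u k + ea ∧ u k ≤ H (r k) + ea) :
    ∃ k ≤ levelCount β θ ε, StopsAt (fun j => u j ≥ -eo) k ∧ fs < r k ∧ r k ≤ r0 ∧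
      H (r k) ≤ -(2 * ea) ∧ r k - fs ≤ ε * (r0 - fs) := by
  set K := levelCount β θ ε with hK
  set q := β / (3 * θ) with hq
  have hθ0 : 0 < θ := by linarith
  have hD : 0 < r0 - fs := sub_pos.2 hr0
  have hq0 : 0 < q := by positivity
  have hq1 : q ≤ 1 / 3 := by
    rw [hq, div_le_div_iff₀ (by positivity) (by norm_num)]
    nlinarith
  -- If the test fails, then `8 * ea ≤ eo < -u k`, so the oracle error is below `1 / 8` of `-u k`.
  -- This gives the factors `8 / 7` and `9 / 8`: the step removes at least the fraction `q` of the
  -- gap and at most `4 / 7` of it.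
  have hstepfacts : ∀ k ≤ K, fs < r k → r k ≤ r0 → ¬ u k ≥ -eo →
      fs < r (k + 1) ∧ r (k + 1) ≤ r0 ∧ H (r (k + 1)) ≤ -(2 * ea) ∧
        r (k + 1) - fs ≤ (1 - q) * (r k - fs) ∧ -u k ≤ 8 / 7 * (r k - fs) := by
    intro k hk h1 h2 hns
    obtain ⟨a1, a2⟩ := hacc k hk h1 h2
    have hu : eo < -u k := by
      have := not_le.1 hns
      linarith
    have b1 := hlow (r k) h1.le
    have b2 := hup (r k) h1.le h2
    have c1 : -u k ≤ 8 / 7 * (r k - fs) := by linarith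
    have c2 : β * (r k - fs) ≤ 9 / 8 * -u k := by linarith
    have hrk : 0 < r k - fs := sub_pos.2 h1
    have e : r (k + 1) = r k - -u k / (2 * θ) := by rw [hstep]; ring
    have hu0 : 0 < -u k := by linarith
    have d1 : -u k / (2 * θ) ≤ 4 / 7 * (r k - fs) := by
      rw [div_le_iff₀ (by positivity)]
      nlinarith
    have d2 : q * (r k - fs) ≤ -u k / (2 * θ) := by
      rw [hq, div_mul_eq_mul_div, div_le_div_iff₀ (by positivity) (by positivity)]
      nlinarith
    have d3 : -u k / (2 * θ) ≤ -u k / 2 := by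
      refine div_le_div_of_nonneg_left hu0.le (by norm_num) (by linarith)
    have d4 : 0 ≤ -u k / (2 * θ) := by positivity
    refine ⟨by linarith, by linarith, ?_, by linarith, c1⟩
    -- The step length is at most half of `-u k`, so by the Lipschitz bound `H` stays below `-2 *
    -- ea`, the margin needed for feasibility at the next level.
    have l1 := hLip (r k) (r (k + 1))
    have e2 : r k - r (k + 1) = -u k / (2 * θ) := by rw [e]; ring
    rw [e2, abs_of_nonneg d4] at l1
    linarith
  have hH0 : H r0 ≤ -(2 * ea) := by
    have h1 := hup r0 hr0.le le_rfl
    have h2 : β * (r0 - fs) * ε ≤ β * (r0 - fs) := by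
      have : 0 < β * (r0 - fs) := by positivity
      nlinarith
    linarith
  have inv : ∀ k ≤ K, (∀ j < k, ¬ u j ≥ -eo) →
      fs < r k ∧ r k ≤ r0 ∧ H (r k) ≤ -(2 * ea) ∧ r k - fs ≤ (1 - q) ^ k * (r0 - fs) := by
    intro k
    induction k with
    | zero =>
      intro _ _
      rw [h0]
      exact ⟨hr0, le_rfl, hH0, by simp⟩
    | succ k ih =>
      intro hk hns
      obtain ⟨i1, i2, -, i4⟩ := ih (by omega) fun j hj => hns j (by omega)
      obtain ⟨f1, f2, f3, f4, -⟩ := hstepfacts k (by omega) i1 i2 (hns k (by omega))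
      refine ⟨f1, f2, f3, f4.trans ?_⟩
      rw [pow_succ, mul_comm _ (1 - q), mul_assoc]
      exact mul_le_mul_of_nonneg_left i4 (by linarith)
  -- After `K` contractions the gap is at most half of `β * (r0 - fs) * ε / θ ^ 2`, hence at most
  -- `eo / 2`, whereas a failed test would force `eo < 8 / 7` of the gap.
  have hhalt : ∃ k, k ≤ K ∧ u k ≥ -eo := by
    by_contra hcon
    push Not at hcon
    obtain ⟨i1, i2, -, i4⟩ := inv K le_rfl fun j hj => not_le.2 (hcon j hj.le)
    obtain ⟨-, -, -, -, f5⟩ := hstepfacts K le_rfl i1 i2 (not_le.2 (hcon K le_rfl))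
    have hu := hcon K le_rfl
    have hbe : 0 < β * ε := by positivity
    have hpow : (1 - q) ^ K ≤ β * ε / (2 * θ ^ 2) := by
      have h1 : (1 - q) ^ K ≤ Real.exp (-q) ^ K :=
        pow_le_pow_left₀ (by linarith) (Real.one_sub_le_exp_neg q) K
      rw [← Real.exp_nat_mul] at h1
      refine h1.trans ?_
      have h2 : Real.log (2 * θ ^ 2 / (β * ε)) ≤ K * q := by
        have h3 : 3 * θ / β * Real.log (2 * θ ^ 2 / (β * ε)) ≤ K := Nat.le_ceil _
        calc Real.log (2 * θ ^ 2 / (β * ε)) =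
            (3 * θ / β * Real.log (2 * θ ^ 2 / (β * ε))) * q := by rw [hq]; field_simp
          _ ≤ K * q := by gcongr
      calc Real.exp (K * -q) ≤ Real.exp (-Real.log (2 * θ ^ 2 / (β * ε))) :=
            Real.exp_le_exp.2 (by linarith)
        _ = β * ε / (2 * θ ^ 2) := by
            rw [Real.exp_neg, Real.exp_log (by positivity), inv_div]
    have h6 : r K - fs ≤ β * ε / (2 * θ ^ 2) * (r0 - fs) :=
      i4.trans (mul_le_mul_of_nonneg_right hpow hD.le)
    have h7 : β * ε / (2 * θ ^ 2) * (r0 - fs) = β * (r0 - fs) * ε / θ ^ 2 / 2 := by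
      field_simp
    have h8 : 0 < β * (r0 - fs) * ε / θ ^ 2 := by positivity
    linarith
  classical
  set k := Nat.find hhalt with hk
  obtain ⟨hkK, hku⟩ := Nat.find_spec hhalt
  have hmin : ∀ j < k, ¬ u j ≥ -eo := fun j hj hcon =>
    Nat.find_min hhalt hj ⟨by omega, hcon⟩
  obtain ⟨i1, i2, i3, -⟩ := inv k hkK hmin
  refine ⟨k, hkK, ⟨hku, hmin⟩, i1, i2, i3, ?_⟩
  obtain ⟨a1, a2⟩ := hacc k hkK i1 i2
  have b2 := hup (r k) i1.le i2
  -- the stopping rule controls the level through the slope bound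
  have h9 : β * (r k - fs) ≤ β * (ε * (r0 - fs)) := by
    linarith
  exact le_of_mul_le_mul_left h9 hβ

end SFLS

/-! ### The estimation loop and accurate calls. -/

namespace SFLS

/-- Contrapositively, a tolerance small relative to `-H` makes `v + a` negative, and then the ratio
test is a linear inequality in `v`. -/
lemma lt_of_test_fails {H a v θ : ℝ} (hθ : 1 < θ) (ha : 0 < a) (h2 : v ≤ H + a) (hfail : ¬ (v + a < 0 ∧ (v - a) / (v + a) ≤ θ)) :
    (θ - 1) * -H < 2 * (θ + 1) * a := by
  by_contra hcon
  push Not at hcon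
  apply hfail
  have hlt : v + a < 0 := by nlinarith
  refine ⟨hlt, ?_⟩
  rw [div_le_iff_of_neg hlt]
  nlinarith

/-- The estimation loop stops early, and its output is a relative estimate. -/
lemma estimation_stops {H abar θ : ℝ} {v : ℕ → ℝ} (hH : H < 0) (hθ : 1 < θ) (ha : 0 < abar)
    (hacc : ∀ h, H ≤ v h + abar / 2 ^ h ∧ v h ≤ H + abar / 2 ^ h) :
    ∃ h, StopsAt (fun h => v h + abar / 2 ^ h < 0 ∧
        (v h - abar / 2 ^ h) / (v h + abar / 2 ^ h) ≤ θ) h ∧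
      H ≤ v h + abar / 2 ^ h ∧ v h + abar / 2 ^ h < 0 ∧ -H ≤ θ * -(v h + abar / 2 ^ h) ∧
      (2 : ℝ) ^ h ≤ 1 + 4 * (θ + 1) * abar / ((θ - 1) * -H) := by
  have hden : 0 < (θ - 1) * -H := by
    have : 0 < θ - 1 := by linarith
    have : 0 < -H := by linarith
    positivity
  have hex : ∃ h, v h + abar / 2 ^ h < 0 ∧ (v h - abar / 2 ^ h) / (v h + abar / 2 ^ h) ≤ θ := by
    by_contra hcon
    push Not at hcon
    obtain ⟨h, hh⟩ := pow_unbounded_of_one_lt (2 * (θ + 1) * abar / ((θ - 1) * -H))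
      (one_lt_two : (1 : ℝ) < 2)
    have := lt_of_test_fails hθ (by positivity : 0 < abar / 2 ^ h) (hacc h).2
      fun hc => absurd hc.2 (not_le.2 (hcon h hc.1))
    rw [← mul_div_assoc, lt_div_iff₀ (by positivity)] at this
    rw [div_lt_iff₀ hden] at hh
    linarith
  classical
  have hspec := Nat.find_spec hex
  refine ⟨Nat.find hex, ⟨hspec, fun j hj => Nat.find_min hex hj⟩, (hacc _).1, hspec.1, ?_, ?_⟩
  · have h1 := hspec.2
    rw [div_le_iff_of_neg hspec.1] at h1
    linarith [(hacc (Nat.find hex)).2]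
  -- The failed test just before stopping bounds the previous power of two, and one doubling gives
  -- the claim. The summand `1` covers stopping at once.
  · rcases Nat.eq_zero_or_pos (Nat.find hex) with h0 | h0
    · rw [h0, pow_zero, le_add_iff_nonneg_right]
      exact div_nonneg (by nlinarith) hden.le
    · obtain ⟨j, hj⟩ : ∃ j, Nat.find hex = j + 1 := ⟨Nat.find hex - 1, by omega⟩
      have := lt_of_test_fails hθ (by positivity : 0 < abar / 2 ^ j) (hacc j).2
        (Nat.find_min hex (by omega))
      rw [← mul_div_assoc, lt_div_iff₀ (by positivity)] at this
      rw [hj, pow_succ]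
      have h3 : (2 : ℝ) ^ j * 2 ≤ 4 * (θ + 1) * abar / ((θ - 1) * -H) := by
        rw [le_div_iff₀ hden]
        linarith
      linarith

namespace SOEC

variable {d m : ℕ} {Ξ : Fin (m + 1) → Type*} [∀ i, MeasurableSpace (Ξ i)] {S : SOEC d m Ξ}

lemma validation_eq_sum (ρ : ℝ) (η : ℕ → ∀ i, Ξ i) (T : ℕ) (y : Fin (m + 1) → ℝ) :
    S.validation ρ η T y = ∑ i, y i * S.validation ρ η T (Pi.single i 1) := by
  unfold validation
  simp only [dotProduct_single, mul_one]
  simp only [dotProduct, Finset.mul_sum]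
  rw [Finset.sum_comm]
  exact Finset.sum_congr rfl fun i _ => Finset.sum_congr rfl fun s _ => by ring

/-- A linear function on the simplex is maximal at a vertex. The finite maximum makes `uhat` visibly
measurable. -/
lemma uhat_eq_sup (ρ : ℝ) (η : ℕ → ∀ i, Ξ i) (T : ℕ) :
    S.uhat ρ η T = Finset.univ.sup' Finset.univ_nonempty
      fun i => S.validation ρ η T (Pi.single i 1) := by
  refine le_antisymm (uhat_le fun y hy => ?_) ?_
  · rw [validation_eq_sum]
    set a := Finset.univ.sup' Finset.univ_nonempty fun i => S.validation ρ η T (Pi.single i 1)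
    calc ∑ i, y i * S.validation ρ η T (Pi.single i 1) ≤ ∑ i, y i * a :=
          Finset.sum_le_sum fun i _ => mul_le_mul_of_nonneg_left
            (Finset.le_sup' (fun i => S.validation ρ η T (Pi.single i 1)) (Finset.mem_univ i))
            (hy.1 i)
      _ = a := by rw [← Finset.sum_mul, hy.2, one_mul]
  · rw [Finset.sup'_le_iff]
    exact fun i _ => validation_le_uhat ρ η T (single_mem_Y i)

/-- The returned pair is accurate up to `ε`. -/
def Accurate (S : SOEC d m Ξ) (ρ : ℝ) (T : ℕ) (ε : ℝ) (η : ℕ → ∀ i, Ξ i) : Prop :=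
  S.P ρ (S.xbar ρ η T) ≤ S.uhat ρ η T + ε ∧ S.uhat ρ η T ≤ S.H ρ + ε

lemma measurable_limit (δ : ℝ) : Measurable (S.limit δ) := by
  unfold limit limitReal
  refine Nat.measurable_ceil.comp ?_
  refine measurable_const.max ((Measurable.pow_const (Measurable.mul ?_
    (Real.measurable_log.comp ?_)) 2).sub_const _)
  · exact measurable_const.div measurable_id
  · exact measurable_const.div measurable_id

variable {r0 : ℝ} (hS : S.Standing r0)
include hS

lemma Standing.xbar_mem (ρ : ℝ) (η : ℕ → ∀ i, Ξ i) (T : ℕ) : S.xbar ρ η T ∈ S.X := by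
  have hΓ : 0 < ∑ s ∈ Finset.range (T + 1), S.γ s :=
    Finset.sum_pos (fun s _ => hS.γ_pos s) (by simp)
  exact hS.X_convex.centerMass_mem (t := Finset.range (T + 1)) (w := S.γ)
    (fun s _ => (hS.γ_pos s).le) hΓ fun s _ => hS.iter_fst_mem ρ η s

section Measurability

variable {Ω : Type*} {mΩ : MeasurableSpace Ω} {ρ : Ω → ℝ} (hρ : Measurable ρ)
  {η : Ω → ℕ → ∀ i, Ξ i} (hη : ∀ s, Measurable fun w => η w s) {T : Ω → ℕ} (hT : Measurable T)
include hρ hη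

lemma Standing.measurable_uhat_const (T : ℕ) : Measurable fun w => S.uhat (ρ w) (η w) T := by
  simp only [uhat_eq_sup]
  have hG : ∀ i : Fin (m + 1), Measurable fun w => S.validation (ρ w) (η w) T (Pi.single i 1) := by
    intro i
    unfold validation
    refine (Finset.measurable_fun_sum _ fun s _ => Measurable.const_mul ?_ _).const_mul _
    simp only [dotProduct_single, mul_one]
    exact (measurable_pi_apply i).comp (hS.measurable_Gy hρ
      (hS.measurable_iter hρ s fun t _ => hη t).fst (fun w => hS.iter_fst_mem _ _ _) (hη s))
  have h1 := Finset.measurable_sup' (s := (Finset.univ : Finset (Fin (m + 1))))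
    Finset.univ_nonempty (f := fun i w => S.validation (ρ w) (η w) T (Pi.single i 1))
    fun i _ => hG i
  convert h1 using 1
  ext w
  rw [Finset.sup'_apply]

lemma Standing.measurable_P_xbar_const (T : ℕ) :
    Measurable fun w => S.P (ρ w) (S.xbar (ρ w) (η w) T) := by
  have hx : Measurable fun w => S.xbar (ρ w) (η w) T := by
    unfold xbar
    refine measurable_smul_pi _ (Finset.measurable_fun_sum _ fun s _ => measurable_smul_pi _ ?_)
    exact (hS.measurable_iter hρ s fun t _ => hη t).fst
  have h1 := Finset.measurable_sup' (s := (Finset.univ : Finset (Fin (m + 1))))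
    Finset.univ_nonempty
    (f := fun i w => S.f i (S.xbar (ρ w) (η w) T) - S.rhs (ρ w) i)
    fun i _ => (hS.measurable_f i hx fun w => hS.xbar_mem _ _ _).sub (measurable_rhs hρ i)
  convert h1 using 1
  ext w
  rw [Finset.sup'_apply]
  rfl

omit hS hρ hη in
include hT in
lemma measurable_apply_nat {F : ℕ → Ω → ℝ} (hF : ∀ n, Measurable (F n)) :
    Measurable fun w => F (T w) w :=
  (measurable_from_prod_countable_right (f := fun q : ℕ × Ω => F q.1 q.2) hF).comp
    (hT.prodMk measurable_id)

include hT

lemma Standing.measurable_uhat : Measurable fun w => S.uhat (ρ w) (η w) (T w) :=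
  measurable_apply_nat hT fun n => hS.measurable_uhat_const hρ hη n

lemma Standing.measurable_P_xbar :
    Measurable fun w => S.P (ρ w) (S.xbar (ρ w) (η w) (T w)) :=
  measurable_apply_nat hT fun n => hS.measurable_P_xbar_const hρ hη n

lemma Standing.measurableSet_accurate {e : Ω → ℝ} (he : Measurable e) :
    MeasurableSet {w | S.Accurate (ρ w) (T w) (e w) (η w)} :=
  (measurableSet_le (hS.measurable_P_xbar hρ hη hT)
    ((hS.measurable_uhat hρ hη hT).add he)).inter
  (measurableSet_le (hS.measurable_uhat hρ hη hT)
    ((hS.continuous_H.measurable.comp hρ).add he))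

end Measurability

lemma Standing.measure_not_accurate_le {Prb : Type*} [mP : MeasurableSpace Prb] {μ : Measure Prb}
    [IsProbabilityMeasure μ] {ξ : ℕ → Prb → ∀ i, Ξ i} (hξ : ∀ s, Measurable (ξ s))
    (hlaw : ∀ s, μ.map (ξ s) = S.law) (hind : iIndepFun ξ μ) {ρ : ℝ} (h1 : S.fstar < ρ)
    (h2 : ρ ≤ r0) {δ ε : ℝ} (hδ : 0 < δ) (hδ1 : δ < 1) (hε : 0 < ε) {T : ℕ}
    (hT : S.limitReal δ ε ≤ T) :
    μ {w | ¬ S.Accurate ρ T ε fun t => ξ t w} ≤ ENNReal.ofReal (δ / 8 / ((T : ℝ) + 2) ^ 7) := by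
  obtain ⟨u, hu, huP⟩ := hS.exists_near_H (lt_add_of_pos_right (S.H ρ) (half_pos hε))
  have hOm : 0 < bigOmega δ := lt_of_lt_of_le (by norm_num) (bigOmega_pos hδ hδ1)
  have herr := S.callError_le hS.M_pos hS.Q_pos hδ hδ1 hε hT
  refine le_trans (measure_mono fun w hw => ?_)
    ((hS.call_failure_le hξ hlaw hind h1 h2 T hOm hu).trans
      (ENNReal.ofReal_le_ofReal (failure_le hδ hδ1 (six_le_of_limit hT))))
  rw [Set.mem_ofPred_eq] at hw ⊢
  intro hgood
  exact hw ⟨by linarith [hgood.2], by linarith [hgood.1]⟩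

end SOEC

/-- Fubini for independent variables: a bound valid for each frozen value of `X` holds for the
random one. It transfers the failure bound from deterministic to random levels and tolerances. -/
lemma measure_indep_mem_le {Prb E F : Type*} [MeasurableSpace Prb] {μ : Measure Prb}
    [IsProbabilityMeasure μ] [MeasurableSpace E] [MeasurableSpace F] {X : Prb → E} {R : Prb → F}
    (hX : Measurable X) (hR : Measurable R) (hi : IndepFun X R μ) {B : Set (E × F)}
    (hB : MeasurableSet B) {c : ENNReal} (hc : ∀ e, μ {w | (e, R w) ∈ B} ≤ c) :
    μ {w | (X w, R w) ∈ B} ≤ c := by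
  have hmap := (indepFun_iff_map_prod_eq_prod_map_map hX.aemeasurable hR.aemeasurable).1 hi
  have e1 : μ {w | (X w, R w) ∈ B} = μ.map (fun w => (X w, R w)) B :=
    (Measure.map_apply (hX.prodMk hR) hB).symm
  have hXp : IsProbabilityMeasure (μ.map X) := Measure.isProbabilityMeasure_map hX.aemeasurable
  have hRp : IsProbabilityMeasure (μ.map R) := Measure.isProbabilityMeasure_map hR.aemeasurable
  rw [e1, hmap, Measure.prod_apply hB]
  calc ∫⁻ e, μ.map R (Prod.mk e ⁻¹' B) ∂(μ.map X) ≤ ∫⁻ _, c ∂(μ.map X) := by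
        refine lintegral_mono fun e => ?_
        rw [Measure.map_apply hR (measurable_prodMk_left hB)]
        exact hc e
    _ = c := by simp

end SFLS

/-! ### Probability that every relevant call is accurate. -/

namespace SFLS

open Classical in
/-- The first index at which `p` holds, and `0` if there is none. -/
noncomputable def firstIndex (p : ℕ → Prop) : ℕ :=
  Nat.find (p := fun n => p n ∨ ∀ m, ¬ p m) <| by
    by_cases h : ∃ n, p n
    · exact h.imp fun n hn => Or.inl hn
    · exact ⟨0, Or.inr fun m hm => h ⟨m, hm⟩⟩

lemma StopsAt.firstIndex_eq {p : ℕ → Prop} {h : ℕ} (hs : StopsAt p h) : firstIndex p = h := by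
  classical
  unfold firstIndex
  rw [Nat.find_eq_iff]
  refine ⟨Or.inl hs.1, fun j hj hcon => ?_⟩
  rcases hcon with hc | hc
  · exact hs.2 j hj hc
  · exact hc h hs.1

lemma measurable_firstIndex {Ω : Type*} [MeasurableSpace Ω] {p : Ω → ℕ → Prop}
    (hp : ∀ n, MeasurableSet {w | p w n}) : Measurable fun w => firstIndex (p w) := by
  classical
  refine measurable_find (p := fun w n => p w n ∨ ∀ m, ¬ p w m) _ fun n => ?_
  have : {w | p w n ∨ ∀ m, ¬ p w m} = {w | p w n} ∪ ⋂ m, {w | p w m}ᶜ := by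
    ext w; simp
  rw [this]
  exact (hp n).union (MeasurableSet.iInter fun m => (hp m).compl)

namespace SOEC

variable {d m : ℕ} {Ξ : Fin (m + 1) → Type*} [∀ i, MeasurableSpace (Ξ i)] {S : SOEC d m Ξ}
  {r0 : ℝ} (hS : S.Standing r0)

lemma level_succ_eq (T : ℕ) (η : ℕ → ℕ → ∀ i, Ξ i) (r0 ea δ θ : ℝ) (k : ℕ) :
    level (S.ovsmdOracle T η) r0 ea δ θ (k + 1) = level (S.ovsmdOracle T η) r0 ea δ θ k +
      S.uhat (level (S.ovsmdOracle T η) r0 ea δ θ k) (η k) T / (2 * θ) := rfl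

include hS

lemma Standing.measurable_level {Ω : Type*} {mΩ : MeasurableSpace Ω} {T : Ω → ℕ}
    (hT : Measurable T) {η : Ω → ℕ → ℕ → ∀ i, Ξ i} (ea : Ω → ℝ) (ρ δ θ : ℝ) (k : ℕ)
    (hη : ∀ j < k, ∀ s, Measurable fun w => η w j s) :
    Measurable fun w => level (S.ovsmdOracle (T w) (η w)) ρ (ea w) δ θ k := by
  induction k with
  | zero => exact measurable_const
  | succ k ih =>
    have ih' := ih fun j hj => hη j (hj.trans (Nat.lt_succ_self k))
    simp only [level_succ_eq]
    exact ih'.add ((hS.measurable_uhat ih' (hη k (Nat.lt_succ_self k)) hT).div_const _)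

/-- Both sides are compared with `z = θ ^ 2 / (β * ε)`. The count is at most quadratic in `z`; as
`-U ≤ β * (r0 - f*) ≤ 4 * β * M`, the tolerance is at most `2 * M / z`, so the limit is at least of
order `z ^ 2`. -/
lemma Standing.levelCount_add_one_le (hr : S.fstar < r0) {δ ε θ U : ℝ} (hδ : 0 < δ) (hδ1 : δ < 1)
    (hε : 0 < ε) (hε1 : ε ≤ 1) (hθ : 1 < θ) (hU : S.H r0 ≤ U) (hU0 : U < 0) :
    (levelCount (S.beta r0) θ ε : ℝ) + 1 ≤ ((S.limit δ (oracleError θ U ε) : ℕ) + 2 : ℝ) ^ 7 := by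
  have hβ := hS.beta_pos hr
  have hβ1 := hS.beta_le_one hr
  have hD := hS.sub_fstar_le
  have hHβ := S.H_eq_beta hr
  have hM := hS.M_pos
  have hQ := hS.Q_pos
  have hθ0 : 0 < θ := by linarith
  set β := S.beta r0
  set z := θ ^ 2 / (β * ε) with hz
  have hz0 : 0 < z := by positivity
  have hθz : θ / β ≤ z := by
    rw [hz, div_le_div_iff₀ hβ (by positivity)]
    have h1 : θ * ε ≤ θ ^ 2 := by nlinarith
    calc θ * (β * ε) = β * (θ * ε) := by ring
      _ ≤ β * θ ^ 2 := by gcongr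
      _ = θ ^ 2 * β := by ring
  have hz1 : 1 ≤ z := by
    refine le_trans ?_ hθz
    rw [le_div_iff₀ hβ]; linarith
  -- the tolerance is small
  have hea0 : 0 < oracleError θ U ε := by
    unfold oracleError
    have h1 : 0 < (θ - 1) / (2 * θ ^ 2 * (θ + 1)) := by
      have : 0 < θ - 1 := by linarith
      positivity
    have h2 := mul_pos (mul_pos h1 (neg_pos.2 hU0)) hε
    linarith
  have hea : oracleError θ U ε * z ≤ 2 * S.M := by
    have e : oracleError θ U ε * z = (θ - 1) / (θ + 1) * (-U) / (2 * β) := by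
      unfold oracleError
      rw [hz]
      field_simp
    rw [e, div_le_iff₀ (by positivity)]
    have h1 : (θ - 1) / (θ + 1) ≤ 1 := by
      rw [div_le_one (by linarith)]; linarith
    calc (θ - 1) / (θ + 1) * -U ≤ 1 * -U := by
          gcongr
          linarith
      _ ≤ β * (r0 - S.fstar) := by linarith
      _ ≤ β * (4 * S.M) := by gcongr
      _ = _ := by ring
  have hX : 40 * S.M ≤ S.bigX δ := by
    have hOm := bigOmega_pos hδ hδ1
    unfold bigX
    have h1 : 0 ≤ S.Q * bigOmega δ := by positivity
    nlinarith
  set x := 8 * S.bigX δ / oracleError θ U ε with hx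
  have hxz : 160 * z ≤ x := by
    rw [hx, le_div_iff₀ hea0]
    nlinarith
  have hsq := sq_le_of_limit (Nat.le_ceil (S.limitReal δ (oracleError θ U ε)))
  rw [← hx] at hsq
  change _ ≤ ((S.limit δ (oracleError θ U ε) : ℕ) : ℝ) + 2 at hsq
  set T := S.limit δ (oracleError θ U ε)
  have hx2 : 2 ≤ x := by linarith
  have hlog : 1 / 2 ≤ Real.log x := by
    have := Real.log_le_log (by norm_num) hx2
    linarith [Real.log_two_gt_d9]
  have hxT : x ^ 2 ≤ (T : ℝ) + 2 := by
    refine le_trans ?_ hsq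
    have : x ≤ 2 * x * Real.log x := by nlinarith
    gcongr
  have hT1 : (1 : ℝ) ≤ (T : ℝ) + 2 := by
    have : (0 : ℝ) ≤ T := Nat.cast_nonneg _
    linarith
  have hK : (levelCount β θ ε : ℝ) ≤ 6 * z ^ 2 + 1 := by
    have hlogz : Real.log (2 * θ ^ 2 / (β * ε)) ≤ 2 * z := by
      have : 2 * θ ^ 2 / (β * ε) = 2 * z := by rw [hz]; ring
      rw [this]
      have := Real.log_le_sub_one_of_pos (by positivity : 0 < 2 * z)
      linarith
    have hlogz0 : 0 ≤ Real.log (2 * θ ^ 2 / (β * ε)) := by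
      have : 2 * θ ^ 2 / (β * ε) = 2 * z := by rw [hz]; ring
      rw [this]
      exact Real.log_nonneg (by linarith)
    have h1 : 3 * θ / β * Real.log (2 * θ ^ 2 / (β * ε)) ≤ 6 * z ^ 2 := by
      calc 3 * θ / β * Real.log (2 * θ ^ 2 / (β * ε)) =
          3 * (θ / β) * Real.log (2 * θ ^ 2 / (β * ε)) := by ring
        _ ≤ 3 * z * (2 * z) := by gcongr
        _ = _ := by ring
    have h2 := (Nat.ceil_lt_add_one (by positivity :
      0 ≤ 3 * θ / β * Real.log (2 * θ ^ 2 / (β * ε)))).le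
    unfold levelCount
    linarith
  -- The first power of `T + 2` already suffices; the seventh is only what `failure_le` offers.
  calc (levelCount β θ ε : ℝ) + 1 ≤ (160 * z) ^ 2 := by nlinarith
    _ ≤ x ^ 2 := by gcongr
    _ ≤ (T : ℝ) + 2 := hxT
    _ = ((T : ℝ) + 2) ^ 1 := (pow_one _).symm
    _ ≤ ((T : ℝ) + 2) ^ 7 := pow_le_pow_right₀ hT1 (by norm_num)

variable {Prb : Type*} [mP : MeasurableSpace Prb] {μ : Measure Prb} [IsProbabilityMeasure μ]
  {ξ : Bool × ℕ × ℕ → Prb → ∀ i, Ξ i} (hξ : ∀ j, Measurable (ξ j))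
  (hlaw : ∀ j, μ.map (ξ j) = S.law) (hind : iIndepFun ξ μ)

include hξ hlaw hind

lemma Standing.measure_row_not_accurate_le (b : Bool) (k : ℕ) {ρ : ℝ} (h1 : S.fstar < ρ)
    (h2 : ρ ≤ r0) {δ ε : ℝ} (hδ : 0 < δ) (hδ1 : δ < 1) (hε : 0 < ε) :
    μ {w | ¬ S.Accurate ρ (S.limit δ ε) ε fun t => ξ (b, k, t) w} ≤
      ENNReal.ofReal (δ / 8 / ((S.limit δ ε : ℝ) + 2) ^ 7) := by
  have hinj : Function.Injective fun t : ℕ => ((b, k, t) : Bool × ℕ × ℕ) := by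
    intro s t h
    simpa using h
  exact hS.measure_not_accurate_le (ξ := fun t => ξ (b, k, t)) (fun s => hξ _) (fun s => hlaw _)
    (hind.precomp hinj) h1 h2 hδ hδ1 hε (Nat.le_ceil _)

lemma Standing.measure_estimation_failure_le (hr : S.fstar < r0) {abar δ : ℝ} (ha : 0 < abar)
    (hδ : 0 < δ) (hδ1 : δ < 1) :
    μ (⋃ h, {w | ¬ S.Accurate r0 (S.estLimit abar δ h) (estTol abar h)
      fun t => ξ (false, h, t) w}) ≤ ENNReal.ofReal (δ / 8) := by
  refine (measure_iUnion_le _).trans ?_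
  have hle : ∀ h, μ {w | ¬ S.Accurate r0 (S.estLimit abar δ h) (estTol abar h)
      fun t => ξ (false, h, t) w} ≤ ENNReal.ofReal (δ / 8 / 2 / 2 ^ h) := by
    intro h
    have h2 : (1 : ℝ) ≤ 2 ^ (h + 1) := one_le_pow₀ (by norm_num)
    refine (hS.measure_row_not_accurate_le hξ hlaw hind false h hr le_rfl
      (δ := δ / 2 ^ (h + 1)) (ε := estTol abar h) (by positivity) ?_ ?_).trans ?_
    · exact (div_le_self hδ.le h2).trans_lt hδ1
    · unfold estTol; positivity
    · refine ENNReal.ofReal_le_ofReal ?_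
      refine (div_le_self (by positivity) (one_le_pow₀ ?_)).trans (le_of_eq ?_)
      · have : (0 : ℝ) ≤ (S.limit (δ / 2 ^ (h + 1)) (estTol abar h) : ℝ) := Nat.cast_nonneg _
        linarith
      · rw [pow_succ]; ring
  refine (ENNReal.tsum_le_tsum hle).trans ?_
  rw [← ENNReal.ofReal_tsum_of_nonneg (fun h => by positivity) (summable_geometric_two' _),
    tsum_geometric_two']

/-- With the prescribed probability, every call made by the procedure is accurate. -/
lemma Standing.exists_accurate_event (hr : S.fstar < r0) {abar δ ε θ : ℝ} (ha : 0 < abar)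
    (hδ : 0 < δ) (hδ1 : δ < 1) (hε : 0 < ε) (hε1 : ε ≤ 1) (hθ : 1 < θ) :
    ∃ A : Set Prb, MeasurableSet A ∧ ENNReal.ofReal (1 - δ) ≤ μ A ∧ ∀ w ∈ A,
      (∀ h, S.Accurate r0 (S.estLimit abar δ h) (estTol abar h) fun t => ξ (false, h, t) w) ∧
      ∀ h, StopsAt (S.estTest r0 abar δ θ fun k t => ξ (false, k, t) w) h →
        ∀ U, U = S.estOutput r0 abar δ (fun k t => ξ (false, k, t) w) h →
        S.H r0 ≤ U → U < 0 → ∀ k ≤ levelCount (S.beta r0) θ ε,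
        ∀ ρ, ρ = level (S.ovsmdOracle (S.limit δ (oracleError θ U ε)) fun k t => ξ (true, k, t) w)
          r0 (oracleError θ U ε) δ θ k → S.fstar < ρ → ρ ≤ r0 →
          S.Accurate ρ (S.limit δ (oracleError θ U ε)) (oracleError θ U ε)
            fun t => ξ (true, k, t) w := by
  set K := levelCount (S.beta r0) θ ε with hK
  set E1 : Set Prb := ⋃ h, {w | ¬ S.Accurate r0 (S.estLimit abar δ h) (estTol abar h)
      fun t => ξ (false, h, t) w} with hE1
  -- measurability of the data of the second phase
  set J : ℕ → Set (Bool × ℕ × ℕ) := fun k => {j | j.1 = false ∨ j.2.1 < k} with hJ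
  -- `J k` holds all Phase 1 samples and the Phase 2 rows before `k`. Because `firstIndex` is total,
  -- `U` is defined and measurable everywhere, and it is the true output wherever Phase 1 stops.
  set U : Prb → ℝ := fun w => S.estOutput r0 abar δ (fun k t => ξ (false, k, t) w)
    (firstIndex (S.estTest r0 abar δ θ fun k t => ξ (false, k, t) w)) with hU
  have hval : ∀ k h, Measurable[sigmaOn ξ (J k)]
      fun w => S.estValue r0 abar δ (fun k t => ξ (false, k, t) w) h := fun k h =>
    hS.measurable_uhat_const (mΩ := sigmaOn ξ (J k)) measurable_const
      (fun s => measurable_sigmaOn (Or.inl rfl)) _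
  have hUm : ∀ k, Measurable[sigmaOn ξ (J k)] U := by
    intro k
    let _ : MeasurableSpace Prb := sigmaOn ξ (J k)
    have hidx : Measurable fun w =>
        firstIndex (S.estTest r0 abar δ θ fun k t => ξ (false, k, t) w) := by
      refine measurable_firstIndex fun n => ?_
      exact (measurableSet_lt ((hval k n).add_const _) measurable_const).inter
        (measurableSet_le (((hval k n).sub_const _).div ((hval k n).add_const _))
          measurable_const)
    exact measurable_apply_nat hidx fun n => (hval k n).add_const _
  have hea : Measurable fun u : ℝ => oracleError θ u ε := by
    unfold oracleError; fun_prop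
  set L : ℕ → Prb → ℝ := fun k w =>
    level (S.ovsmdOracle (S.limit δ (oracleError θ (U w) ε)) fun k t => ξ (true, k, t) w)
      r0 (oracleError θ (U w) ε) δ θ k with hL
  have hLm : ∀ k, Measurable[sigmaOn ξ (J k)] (L k) := fun k =>
    hS.measurable_level (mΩ := sigmaOn ξ (J k))
      ((measurable_limit δ).comp (hea.comp (hUm k))) _ r0 δ θ k
      fun j hj s => measurable_sigmaOn (Or.inr hj)
  -- The section of `B` at a fixed pair (estimate, level) is the failure event of a call with
  -- deterministic inputs, and is empty when the pair is inadmissible.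
  set B : Set ((ℝ × ℝ) × (ℕ → ∀ i, Ξ i)) := {q | (S.H r0 ≤ q.1.1 ∧ q.1.1 < 0) ∧
    (S.fstar < q.1.2 ∧ q.1.2 ≤ r0) ∧ ¬ S.Accurate q.1.2 (S.limit δ (oracleError θ q.1.1 ε))
      (oracleError θ q.1.1 ε) q.2} with hB
  have hBm : MeasurableSet B := by
    have m1 : Measurable fun q : (ℝ × ℝ) × (ℕ → ∀ i, Ξ i) => q.1.1 := by fun_prop
    have m2 : Measurable fun q : (ℝ × ℝ) × (ℕ → ∀ i, Ξ i) => q.1.2 := by fun_prop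
    refine ((measurableSet_le measurable_const m1).inter
      (measurableSet_lt m1 measurable_const)).inter
      (((measurableSet_lt measurable_const m2).inter
        (measurableSet_le m2 measurable_const)).inter (MeasurableSet.compl ?_))
    exact hS.measurableSet_accurate m2 (fun s => (measurable_pi_apply s).comp measurable_snd)
      ((measurable_limit δ).comp (hea.comp m1)) (hea.comp m1)
  set R : ℕ → Prb → ℕ → ∀ i, Ξ i := fun k w t => ξ (true, k, t) w with hR
  have hcall : ∀ k, μ {w | ((U w, L k w), R k w) ∈ B} ≤
      ENNReal.ofReal (δ / 8 / (K + 1 : ℝ)) := by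
    intro k
    have hX : Measurable[sigmaOn ξ (J k)] fun w => (U w, L k w) := (hUm k).prodMk (hLm k)
    have hRm : Measurable[sigmaOn ξ {j | j.1 = true ∧ j.2.1 = k}] (R k) := by
      refine @measurable_pi_lambda _ _ _ (sigmaOn ξ {j | j.1 = true ∧ j.2.1 = k}) _ _ fun t => ?_
      exact measurable_sigmaOn ⟨rfl, rfl⟩
    have hdisj : Disjoint (J k) {j : Bool × ℕ × ℕ | j.1 = true ∧ j.2.1 = k} := by
      rw [Set.disjoint_left]
      rintro ⟨b, i, t⟩ h1 ⟨h2, h3⟩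
      rcases h1 with h1 | h1
      · simp only at h1 h2
        rw [h1] at h2
        exact Bool.noConfusion h2
      · simp only at h1 h3
        omega
    refine measure_indep_mem_le (hX.mono (sigmaOn_le hξ _) le_rfl)
      (hRm.mono (sigmaOn_le hξ _) le_rfl) (indepFun_of_sigmaOn hξ hind hdisj hX hRm) hBm
      fun e => ?_
    by_cases hv : (S.H r0 ≤ e.1 ∧ e.1 < 0) ∧ S.fstar < e.2 ∧ e.2 ≤ r0
    · obtain ⟨⟨v1, v2⟩, v3, v4⟩ := hv
      have hcount := hS.levelCount_add_one_le hr hδ hδ1 hε hε1 hθ v1 v2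
      have hea0 : 0 < oracleError θ e.1 ε := by
        unfold oracleError
        have h1 : 0 < (θ - 1) / (2 * θ ^ 2 * (θ + 1)) := by
          have : 0 < θ - 1 := by linarith
          have : 0 < θ := by linarith
          positivity
        have h2 := mul_pos (mul_pos h1 (neg_pos.2 v2)) hε
        linarith
      refine le_trans (measure_mono fun w hw => ?_)
        ((hS.measure_row_not_accurate_le hξ hlaw hind true k v3 v4 hδ hδ1 hea0).trans
          (ENNReal.ofReal_le_ofReal ?_))
      · exact hw.2.2
      · exact div_le_div_of_nonneg_left (by positivity) (by positivity) hcount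
    · have : {w | (e, R k w) ∈ B} = ∅ := by
        ext w
        simp only [Set.mem_empty_iff_false, iff_false]
        exact fun hw => hv ⟨hw.1, hw.2.1⟩
      rw [this]
      simp
  set E2 : Set Prb := ⋃ k ∈ Finset.range (K + 1), {w | ((U w, L k w), R k w) ∈ B} with hE2
  have hm1 : MeasurableSet E1 := by
    refine MeasurableSet.iUnion fun h => MeasurableSet.compl ?_
    exact hS.measurableSet_accurate measurable_const (fun s => hξ _) measurable_const
      measurable_const
  have hm2 : MeasurableSet E2 := by
    refine Finset.measurableSet_biUnion _ fun k _ => ?_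
    refine Measurable.prodMk (Measurable.prodMk ((hUm k).mono (sigmaOn_le hξ _) le_rfl)
      ((hLm k).mono (sigmaOn_le hξ _) le_rfl)) ?_ hBm
    exact measurable_pi_lambda _ fun t => hξ _
  have hp1 : μ E1 ≤ ENNReal.ofReal (δ / 8) :=
    hS.measure_estimation_failure_le hξ hlaw hind hr ha hδ hδ1
  have hp2 : μ E2 ≤ ENNReal.ofReal (δ / 8) := by
    refine (measure_biUnion_finset_le _ _).trans ((Finset.sum_le_sum fun k _ => hcall k).trans ?_)
    rw [Finset.sum_const, Finset.card_range, nsmul_eq_mul, ← ENNReal.ofReal_natCast,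
      ← ENNReal.ofReal_mul (Nat.cast_nonneg _)]
    refine ENNReal.ofReal_le_ofReal (le_of_eq ?_)
    push_cast
    field_simp
  refine ⟨(E1 ∪ E2)ᶜ, (hm1.union hm2).compl, ?_, fun w hw => ?_⟩
  · have hp : μ (E1 ∪ E2) ≤ ENNReal.ofReal δ := by
      refine (measure_union_le _ _).trans ((add_le_add hp1 hp2).trans ?_)
      rw [← ENNReal.ofReal_add (by positivity) (by positivity)]
      exact ENNReal.ofReal_le_ofReal (by linarith)
    rw [prob_compl_eq_one_sub (hm1.union hm2), ENNReal.ofReal_sub _ hδ.le, ENNReal.ofReal_one]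
    gcongr
  · rw [Set.mem_compl_iff, Set.mem_union, not_or] at hw
    obtain ⟨hw1, hw2⟩ := hw
    refine ⟨fun h => ?_, fun h hhalt u hu hHu hu0 k hk ρ hρ h1 h2 => ?_⟩
    · by_contra hcon
      exact hw1 (Set.mem_iUnion.2 ⟨h, hcon⟩)
    · have hUw : U w = u := by
        rw [hu]
        simp only [hU, hhalt.firstIndex_eq]
      by_contra hcon
      apply hw2
      refine Set.mem_iUnion₂.2 ⟨k, Finset.mem_range.2 (by omega), ?_⟩
      have hLw : L k w = ρ := by
        rw [hρ]
        simp only [hL, hUw]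
      rw [Set.mem_ofPred_eq, hUw, hLw]
      exact ⟨⟨hHu, hu0⟩, ⟨h1, h2⟩, hcon⟩

end SOEC

end SFLS

/-! ### Correctness of the procedure when its calls are accurate. -/

namespace SFLS

namespace SOEC

variable {d m : ℕ} {Ξ : Fin (m + 1) → Type*} [∀ i, MeasurableSpace (Ξ i)] {S : SOEC d m Ξ}
  {r0 : ℝ}

/-- The procedure succeeds when all its calls are accurate. -/
lemma Standing.procedure_correct (hS : S.Standing r0) (hr : S.fstar < r0) {abar δ ε θ : ℝ}
    (ha : 0 < abar) (hε : 0 < ε) (hε1 : ε ≤ 1) (hθ : 1 < θ) (ξ₁ ξ₂ : ℕ → ℕ → ∀ i, Ξ i)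
    (hacc₁ : ∀ h, S.Accurate r0 (S.estLimit abar δ h) (estTol abar h) (ξ₁ h))
    (hacc₂ : ∀ h, StopsAt (S.estTest r0 abar δ θ ξ₁) h → ∀ U, U = S.estOutput r0 abar δ ξ₁ h →
      S.H r0 ≤ U → U < 0 → ∀ k ≤ levelCount (S.beta r0) θ ε,
      ∀ ρ, ρ = level (S.ovsmdOracle (S.limit δ (oracleError θ U ε)) ξ₂)
        r0 (oracleError θ U ε) δ θ k → S.fstar < ρ → ρ ≤ r0 →
        S.Accurate ρ (S.limit δ (oracleError θ U ε)) (oracleError θ U ε) (ξ₂ k)) :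
    ∃ h : ℕ, StopsAt (S.estTest r0 abar δ θ ξ₁) h ∧
      S.H r0 ≤ S.estOutput r0 abar δ ξ₁ h ∧ S.estOutput r0 abar δ ξ₁ h < 0 ∧
      -S.H r0 ≤ θ * -S.estOutput r0 abar δ ξ₁ h ∧
      (2 : ℝ) ^ h ≤ 1 + 4 * (θ + 1) * abar / ((θ - 1) * -S.H r0) ∧
      ∃ k ≤ levelCount (S.beta r0) θ ε,
        StopsAt (fun j => (levelCall (S.ovsmdOracle (S.limit δ
          (oracleError θ (S.estOutput r0 abar δ ξ₁ h) ε)) ξ₂) r0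
          (oracleError θ (S.estOutput r0 abar δ ξ₁ h) ε) δ θ j).1 ≥
            -optTol θ (S.estOutput r0 abar δ ξ₁ h) ε) k ∧
        (levelCall (S.ovsmdOracle (S.limit δ
          (oracleError θ (S.estOutput r0 abar δ ξ₁ h) ε)) ξ₂) r0
          (oracleError θ (S.estOutput r0 abar δ ξ₁ h) ε) δ θ k).2 ∈ S.feasible ∧
        (S.f 0 (levelCall (S.ovsmdOracle (S.limit δ
          (oracleError θ (S.estOutput r0 abar δ ξ₁ h) ε)) ξ₂) r0
          (oracleError θ (S.estOutput r0 abar δ ξ₁ h) ε) δ θ k).2 - S.fstar) / (r0 - S.fstar)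
            ≤ ε := by
  have hHneg := hS.H_neg hr
  have hβ := hS.beta_pos hr
  have hβ1 := hS.beta_le_one hr
  have hHβ := S.H_eq_beta hr
  have hD : 0 < r0 - S.fstar := sub_pos.2 hr
  have hθ0 : 0 < θ := by linarith
  obtain ⟨h, hhalt, hU1, hU2, hU3, hpow⟩ := estimation_stops (H := S.H r0) (abar := abar) (θ := θ)
    (v := fun h => S.estValue r0 abar δ ξ₁ h) hHneg hθ ha fun h =>
      ⟨(hS.H_le r0 (hS.xbar_mem r0 (ξ₁ h) _)).trans (hacc₁ h).1, (hacc₁ h).2⟩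
  refine ⟨h, hhalt, hU1, hU2, hU3, hpow, ?_⟩
  set U := S.estOutput r0 abar δ ξ₁ h with hUdef
  change S.H r0 ≤ U at hU1
  change U < 0 at hU2
  change -S.H r0 ≤ θ * -U at hU3
  set ea := oracleError θ U ε with hea
  set T := S.limit δ ea with hT
  set eo := optTol θ U ε with heo
  set 𝒜 := S.ovsmdOracle T ξ₂ with h𝒜
  have hcoef : ea = (θ - 1) / (2 * θ * (θ + 1)) * eo := by
    rw [hea, heo, oracleError, optTol]
    field_simp
  have heo0 : 0 < eo := by
    have : eo = 1 / θ * -U * ε := by rw [heo, optTol]; ring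
    rw [this]
    have := neg_pos.2 hU2
    positivity
  have hc0 : 0 < (θ - 1) / (2 * θ * (θ + 1)) := by
    have : 0 < θ - 1 := by linarith
    positivity
  have hea0 : 0 < ea := by rw [hcoef]; positivity
  -- Equivalent to `θ ^ 2 - 3 * θ + 4 ≥ 0`, that is, `(θ - 2) ^ 2 + θ ≥ 0`.
  have hc8 : 8 * ((θ - 1) / (2 * θ * (θ + 1))) ≤ 1 := by
    rw [← mul_div_assoc, div_le_one (by positivity)]
    nlinarith [sq_nonneg (θ - 2)]
  have heo8 : 8 * ea ≤ eo := by
    rw [hcoef]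
    nlinarith
  have heo1 : S.beta r0 * (r0 - S.fstar) * ε / θ ^ 2 ≤ eo := by
    have e1 : S.beta r0 * (r0 - S.fstar) = -S.H r0 := by rw [hHβ]; ring
    have e2 : eo = θ * -U * ε / θ ^ 2 := by rw [heo, optTol]; field_simp
    rw [e1, e2]
    gcongr
  have heo2 : eo + ea ≤ S.beta r0 * (r0 - S.fstar) * ε := by
    have e1 : S.beta r0 * (r0 - S.fstar) = -S.H r0 := by rw [hHβ]; ring
    have h1 : (1 + (θ - 1) / (2 * θ * (θ + 1))) / θ ≤ 1 := by
      rw [div_le_one hθ0, ← le_sub_iff_add_le', div_le_iff₀ (by positivity)]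
      nlinarith [mul_pos hθ0 hθ0]
    have e3 : eo + ea = (1 + (θ - 1) / (2 * θ * (θ + 1))) / θ * (-U * ε) := by
      rw [hcoef, heo, optTol]; ring
    rw [e1, e3]
    have h2 : 0 ≤ -U * ε := mul_nonneg (by linarith) hε.le
    calc _ ≤ 1 * (-U * ε) := by gcongr
      _ ≤ -S.H r0 * ε := by rw [one_mul]; gcongr
  obtain ⟨k, hkK, hks, hk1, hk2, hk3, hk4⟩ := level_updates_stop (H := S.H) (fs := S.fstar)
    (r0 := r0) (β := S.beta r0) (θ := θ) (ε := ε) (eo := eo) (ea := ea)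
    (r := fun k => level 𝒜 r0 ea δ θ k) (u := fun k => (levelCall 𝒜 r0 ea δ θ k).1)
    hr hβ hβ1 hθ hε hε1 hS.H_le_add (fun a ha => hS.neg_le_H ha)
    (fun a h1 h2 => hS.H_le_beta hr h1 h2) hea0 heo8 heo1 heo2 rfl (fun k => rfl)
    (fun k hk h1 h2 => by
      have := hacc₂ h hhalt U rfl hU1 hU2 k hk _ rfl h1 h2
      exact ⟨(hS.H_le _ (hS.xbar_mem _ _ _)).trans this.1, this.2⟩)
  refine ⟨k, hkK, hks, ?_⟩
  have hac := hacc₂ h hhalt U rfl hU1 hU2 k hkK _ rfl hk1 hk2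
  set ρ := level 𝒜 r0 ea δ θ k with hρ
  change (S.xbar ρ (ξ₂ k) T) ∈ S.feasible ∧ (S.f 0 (S.xbar ρ (ξ₂ k) T) - S.fstar) /
    (r0 - S.fstar) ≤ ε
  -- Accuracy gives `P ≤ û + ea ≤ H + 2 * ea`, and every visited level keeps `H ≤ -2 * ea`.
  have hP : S.P ρ (S.xbar ρ (ξ₂ k) T) ≤ 0 := by linarith [hac.1, hac.2]
  refine ⟨mem_feasible_of_P_nonpos (hS.xbar_mem _ _ _) hP, ?_⟩
  rw [div_le_iff₀ hD]
  have := S.f_zero_le ρ (S.xbar ρ (ξ₂ k) T)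
  linarith

/-! Iteration counts. -/

/-- The limit squares `x * log x`, which is negative and not monotone for small `x`. There its
absolute value is at most `1`. -/
lemma abs_mul_log_le {x y : ℝ} (hx : 0 < x) (hxy : x ≤ y) (hy : 3 ≤ y) :
    |x * Real.log x| ≤ y * Real.log y := by
  have hly : 1 ≤ Real.log y := by
    rw [Real.le_log_iff_exp_le (by linarith)]
    linarith [Real.exp_one_lt_d9]
  rcases le_or_gt 1 x with h | h
  · have h0 := Real.log_nonneg h
    rw [abs_of_nonneg (by positivity)]
    have := Real.log_le_log hx hxy
    gcongr
  · have h0 := Real.log_neg hx h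
    rw [abs_of_nonpos (mul_nonpos_of_nonneg_of_nonpos hx.le h0.le)]
    have h1 := Real.log_le_sub_one_of_pos (inv_pos.2 hx)
    rw [Real.log_inv] at h1
    have h2 : x * -Real.log x ≤ x * (x⁻¹ - 1) := by gcongr
    rw [mul_sub, mul_inv_cancel₀ hx.ne'] at h2
    nlinarith

lemma limit_add_one_le {δ ε y : ℝ} (hx : 0 < 8 * S.bigX δ / ε) (hxy : 8 * S.bigX δ / ε ≤ y)
    (hy : 3 ≤ y) : (S.limit δ ε : ℝ) + 1 ≤ 24 * y ^ 2 * Real.log y ^ 2 := by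
  have hly : 1 ≤ Real.log y := by
    rw [Real.le_log_iff_exp_le (by linarith)]
    linarith [Real.exp_one_lt_d9]
  set x := 8 * S.bigX δ / ε with hxd
  have h1 := abs_mul_log_le hx hxy hy
  have hyl : 3 ≤ y * Real.log y := by nlinarith
  have h2 : (x * Real.log x) ^ 2 ≤ (y * Real.log y) ^ 2 :=
    sq_le_sq' (by linarith [neg_abs_le (x * Real.log x)]) ((le_abs_self _).trans h1)
  have h3 : S.limitReal δ ε ≤ 6 + 4 * (y * Real.log y) ^ 2 := by
    rw [limitReal_eq]
    refine max_le (by nlinarith) ?_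
    rw [← hxd]
    have : (2 * x * Real.log x) ^ 2 = 4 * (x * Real.log x) ^ 2 := by ring
    linarith
  have h4 : (S.limit δ ε : ℝ) ≤ S.limitReal δ ε + 1 := by
    refine (Nat.ceil_lt_add_one ?_).le
    rw [limitReal_eq]
    exact le_trans (by norm_num) (le_max_left _ _)
  have h5 : (1 : ℝ) ≤ (y * Real.log y) ^ 2 := by nlinarith
  have h6 : y ^ 2 * Real.log y ^ 2 = (y * Real.log y) ^ 2 := by ring
  rw [mul_assoc, h6]
  linarith

lemma bigX_pos (hM : 0 < S.M) (hQ : 0 < S.Q) {δ : ℝ} (h0 : 0 < δ) (h1 : δ < 1) :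
    0 < S.bigX δ := by
  have := bigOmega_pos h0 h1
  unfold bigX
  positivity

lemma bigX_le (hM : 0 < S.M) (hQ : 0 < S.Q) {δ : ℝ} (h0 : 0 < δ) (h1 : δ < 1) :
    S.bigX δ ≤ 2 * (S.Q + 15 * S.M) * (4 + Real.log (1 / δ)) := by
  have hL3 := three_le_log h0 h1
  have hOm4 := bigOmega_pos h0 h1
  have hL : Real.log (24 / δ) ≤ 4 + Real.log (1 / δ) := by
    have e : (24 : ℝ) / δ = 24 * (1 / δ) := by ring
    rw [e, Real.log_mul (by norm_num) (by positivity)]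
    have : Real.log 24 ≤ 4 := by
      rw [Real.log_le_iff_le_exp (by norm_num)]
      have e4 : Real.exp 4 = Real.exp 1 ^ 4 := by rw [← Real.exp_nat_mul]; norm_num
      rw [e4]
      have := Real.exp_one_gt_d9
      calc (24 : ℝ) ≤ 2.7 ^ 4 := by norm_num
        _ ≤ Real.exp 1 ^ 4 := by gcongr; linarith
    linarith
  -- With `L = log (24 / δ)`, the inequality `√(12 * L) ≤ 2 * L` is exactly `L ≥ 3`.
  have hOm : bigOmega δ ≤ 2 * Real.log (24 / δ) := by
    refine max_le ?_ (by linarith)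
    refine Real.sqrt_le_iff.2 ⟨by linarith, by nlinarith⟩
  unfold bigX
  calc S.Q * bigOmega δ + 10 * S.M * bigOmega δ + 4.5 * S.M
      ≤ (S.Q + 15 * S.M) * bigOmega δ := by nlinarith
    _ ≤ (S.Q + 15 * S.M) * (2 * (4 + Real.log (1 / δ))) := by
        gcongr
        linarith
    _ = _ := by ring

lemma sum_four_pow_le (h : ℕ) : ∑ j ∈ Finset.range (h + 1), (4 : ℝ) ^ j ≤ 2 * 4 ^ h := by
  induction h with
  | zero => norm_num
  | succ h ih =>
    rw [Finset.sum_range_succ, pow_succ]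
    have : (0 : ℝ) < 4 ^ h := by positivity
    linarith

/-- Halving the tolerance multiplies the limit by about four, so the sum is comparable to its last
term. The summand `h` in the condition on `Y` pays for the shrinking probabilities `δ / 2 ^ (j +
1)`. -/
lemma estGradIters_le (hM : 0 < S.M) (hQ : 0 < S.Q) {abar δ Y : ℝ} (ha : 0 < abar) (h0 : 0 < δ)
    (h1 : δ < 1) (h : ℕ) (hY : 3 ≤ Y)
    (hXY : 16 * (S.Q + 15 * S.M) / abar * (5 + Real.log (1 / δ) + h) ≤ Y) :
    (S.estGradIters abar δ h : ℝ) ≤ 48 * Y ^ 2 * 4 ^ h * Real.log (Y * 2 ^ h) ^ 2 := by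
  unfold estGradIters
  push_cast
  have hlog : 0 ≤ Real.log (1 / δ) := Real.log_nonneg (by rw [le_div_iff₀ h0]; linarith)
  have hterm : ∀ j ∈ Finset.range (h + 1), (S.estLimit abar δ j : ℝ) + 1 ≤
      24 * Y ^ 2 * Real.log (Y * 2 ^ h) ^ 2 * 4 ^ j := by
    intro j hj
    have hjh : j ≤ h := by have := Finset.mem_range.1 hj; omega
    have h2j : (1 : ℝ) ≤ 2 ^ j := one_le_pow₀ (by norm_num)
    have h2j1 : (1 : ℝ) ≤ 2 ^ (j + 1) := one_le_pow₀ (by norm_num)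
    have hδj : 0 < δ / 2 ^ (j + 1) := by positivity
    have hδj1 : δ / 2 ^ (j + 1) < 1 := (div_le_self h0.le h2j1).trans_lt h1
    have hX := S.bigX_le hM hQ hδj hδj1
    have hX0 := S.bigX_pos hM hQ hδj hδj1
    have hα : 0 < estTol abar j := by unfold estTol; positivity
    have hlogj : Real.log (1 / (δ / 2 ^ (j + 1))) ≤ Real.log (1 / δ) + (h + 1) := by
      have e : 1 / (δ / 2 ^ (j + 1)) = 1 / δ * 2 ^ (j + 1) := by field_simp
      rw [e, Real.log_mul (by positivity) (by positivity), Real.log_pow]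
      have hl2 := Real.log_two_lt_d9
      have hl20 := Real.log_two_gt_d9
      have : ((j + 1 : ℕ) : ℝ) ≤ (h : ℝ) + 1 := by exact_mod_cast Nat.succ_le_succ hjh
      have hj0 : (0 : ℝ) ≤ ((j + 1 : ℕ) : ℝ) := Nat.cast_nonneg _
      nlinarith
    have hx : 8 * S.bigX (δ / 2 ^ (j + 1)) / estTol abar j ≤ Y * 2 ^ j := by
      have e : 8 * S.bigX (δ / 2 ^ (j + 1)) / estTol abar j =
          8 / abar * S.bigX (δ / 2 ^ (j + 1)) * 2 ^ j := by
        unfold estTol; field_simp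
      rw [e]
      gcongr
      refine le_trans ?_ hXY
      calc 8 / abar * S.bigX (δ / 2 ^ (j + 1)) ≤ 8 / abar * (2 * (S.Q + 15 * S.M) *
            (4 + (Real.log (1 / δ) + (h + 1)))) := by
            gcongr
            exact hX.trans (by gcongr)
        _ = _ := by ring
    have hYj : 3 ≤ Y * 2 ^ j := by nlinarith
    have key := S.limit_add_one_le (by positivity) hx hYj
    refine key.trans ?_
    have hl : Real.log (Y * 2 ^ j) ≤ Real.log (Y * 2 ^ h) := by
      refine Real.log_le_log (by positivity) ?_
      have : (2 : ℝ) ^ j ≤ 2 ^ h := pow_le_pow_right₀ (by norm_num) hjh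
      gcongr
    have hl0 : 0 ≤ Real.log (Y * 2 ^ j) := Real.log_nonneg (by linarith)
    have e4 : (Y * 2 ^ j) ^ 2 = Y ^ 2 * 4 ^ j := by
      rw [mul_pow, ← pow_mul, mul_comm j 2, pow_mul]; norm_num
    calc 24 * (Y * 2 ^ j) ^ 2 * Real.log (Y * 2 ^ j) ^ 2 ≤
        24 * (Y * 2 ^ j) ^ 2 * Real.log (Y * 2 ^ h) ^ 2 := by gcongr
      _ = _ := by rw [e4]; ring
  refine (Finset.sum_le_sum hterm).trans ?_
  rw [← Finset.mul_sum]
  calc 24 * Y ^ 2 * Real.log (Y * 2 ^ h) ^ 2 * ∑ j ∈ Finset.range (h + 1), (4 : ℝ) ^ j ≤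
      24 * Y ^ 2 * Real.log (Y * 2 ^ h) ^ 2 * (2 * 4 ^ h) := by
        gcongr
        exact sum_four_pow_le h
    _ = _ := by ring

end SOEC

end SFLS

/-! ### Call and iteration counts with constants of restricted dependence. -/

namespace SFLS

lemma levelCount_le {β θ ε : ℝ} (hβ : 0 < β) (hβ1 : β ≤ 1) (hθ : 1 < θ) (hε : 0 < ε)
    (hε1 : ε ≤ 1) :
    (levelCount β θ ε : ℝ) ≤ 3 * θ / β * Real.log (2 * θ ^ 2 / (β * ε)) + 1 := by
  refine (Nat.ceil_lt_add_one ?_).le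
  have : 1 ≤ 2 * θ ^ 2 / (β * ε) := by
    rw [le_div_iff₀ (by positivity)]
    nlinarith [mul_le_one₀ hβ1 hε.le hε1]
  have := Real.log_nonneg this
  have : 0 < θ := by linarith
  positivity

/-- Bound on the number of calls. -/
lemma calls_le {abar D β θ ε : ℝ} (ha : 0 < abar) (hD : 0 < D) (hβ : 0 < β) (hβ1 : β ≤ 1)
    (hθ : 1 < θ) (hε : 0 < ε) (hε1 : ε ≤ 1) {h k : ℕ}
    (hh : (2 : ℝ) ^ h ≤ 1 + 4 * (θ + 1) * abar / ((θ - 1) * (β * D)))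
    (hk : k ≤ levelCount β θ ε) :
    (((h + 1) + (k + 1) : ℕ) : ℝ) ≤
      (14 + 16 * abar / D) * (θ ^ 2 / β * Real.log (θ ^ 2 / ((θ - 1) * β * ε))) := by
  have hθ0 : 0 < θ := by linarith
  have hθ1 : 0 < θ - 1 := by linarith
  set w := θ ^ 2 / ((θ - 1) * β * ε) with hw
  set G := θ ^ 2 / β with hG
  have hw4 : 4 ≤ w := by
    rw [hw, le_div_iff₀ (by positivity)]
    have h1 : (θ - 1) * β * ε ≤ θ - 1 := by
      have := mul_le_one₀ hβ1 hε.le hε1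
      nlinarith
    nlinarith [sq_nonneg (θ - 2)]
  have hw0 : 0 < w := by linarith
  have hΛ : 1 ≤ Real.log w := by
    rw [Real.le_log_iff_exp_le hw0]
    linarith [Real.exp_one_lt_d9]
  have hG1 : 1 ≤ G := by
    rw [hG, le_div_iff₀ hβ]
    nlinarith
  have hGΛ : G ≤ G * Real.log w := by nlinarith
  have hΛG : Real.log w ≤ G * Real.log w := by nlinarith
  have hkb : (k : ℝ) ≤ 9 * (G * Real.log w) + 1 := by
    have h1 := levelCount_le hβ hβ1 hθ hε hε1
    have h2 : (k : ℝ) ≤ levelCount β θ ε := by exact_mod_cast hk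
    -- The final constant must not involve `θ`: the extra `log (2 * (θ - 1))` is bounded by `2 * θ`,
    -- which the prefactor turns into a multiple of `θ ^ 2 / β`.
    have h3 : Real.log (2 * θ ^ 2 / (β * ε)) ≤ 2 * θ + Real.log w := by
      have e : 2 * θ ^ 2 / (β * ε) = (2 * (θ - 1)) * w := by rw [hw]; field_simp
      rw [e, Real.log_mul (by positivity) hw0.ne']
      have := Real.log_le_sub_one_of_pos (by positivity : 0 < 2 * (θ - 1))
      linarith
    have h4 : 3 * θ / β * Real.log (2 * θ ^ 2 / (β * ε)) ≤ 9 * (G * Real.log w) := by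
      calc 3 * θ / β * Real.log (2 * θ ^ 2 / (β * ε)) ≤ 3 * θ / β * (2 * θ + Real.log w) := by
            gcongr
        _ = 6 * G + 3 * (θ / β * Real.log w) := by rw [hG]; ring
        _ ≤ 6 * (G * Real.log w) + 3 * (G * Real.log w) := by
            have : θ / β ≤ G := by
              rw [hG]
              gcongr
              nlinarith
            gcongr
        _ = _ := by ring
    linarith
  have hhb : (h : ℝ) ≤ 2 * (8 * (abar / D) + 1) * (G * Real.log w) := by
    have h1 : (2 : ℝ) ^ h ≤ (1 + 8 * (abar / D)) * w := by
      refine hh.trans ?_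
      have e : 4 * (θ + 1) * abar / ((θ - 1) * (β * D)) =
          4 * (θ + 1) * (abar / D) / ((θ - 1) * β) := by field_simp
      have h2 : 4 * (θ + 1) * (abar / D) / ((θ - 1) * β) ≤ 8 * (abar / D) * w := by
        rw [hw, show 8 * (abar / D) * (θ ^ 2 / ((θ - 1) * β * ε)) =
          (8 * (abar / D) * θ ^ 2) / ((θ - 1) * β * ε) by ring,
          div_le_div_iff₀ (by positivity) (by positivity)]
        have h3 : (θ + 1) * ε ≤ 2 * θ ^ 2 := by nlinarith
        calc 4 * (θ + 1) * (abar / D) * ((θ - 1) * β * ε) =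
            ((θ + 1) * ε) * (4 * (abar / D) * ((θ - 1) * β)) := by ring
          _ ≤ (2 * θ ^ 2) * (4 * (abar / D) * ((θ - 1) * β)) := by gcongr
          _ = _ := by ring
      rw [e]
      nlinarith
    have h2 := Real.log_le_log (by positivity) h1
    rw [Real.log_pow, Real.log_mul (by positivity) hw0.ne'] at h2
    have h3 := Real.log_le_sub_one_of_pos (by positivity : 0 < 1 + 8 * (abar / D))
    have h4 : (h : ℝ) * (1 / 2) ≤ h * Real.log 2 := by
      gcongr
      linarith [Real.log_two_gt_d9]
    have h5 : 0 ≤ abar / D := by positivity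
    have h6 : 8 * (abar / D) ≤ 8 * (abar / D) * (G * Real.log w) := by
      refine le_mul_of_one_le_right (by positivity) ?_
      linarith
    linarith
  push_cast
  have e : 16 * abar / D = 16 * (abar / D) := by ring
  rw [e]
  linarith

set_option maxHeartbeats 400000 in
/-- Bound on the number of iterations of the estimation phase, uniformly in the condition
measure. -/
lemma exists_estimation_bound {κ p : ℝ} (hκ : 0 < κ) (hκ1 : κ < 1) (M Q θ abar D : ℝ) :
    ∃ C : ℝ, 0 < M → 0 < Q → 1 < θ → 0 < abar → 0 < D → ∀ (β δ : ℝ) (h : ℕ) (N : ℝ),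
      0 < β → 0 < δ → β ≤ κ → δ ≤ κ → Real.log (1 / δ) ≤ (1 / β) ^ p →
      (2 : ℝ) ^ h ≤ 1 + 4 * (θ + 1) * abar / ((θ - 1) * (β * D)) →
      (∀ Y : ℝ, 3 ≤ Y → 16 * (Q + 15 * M) / abar * (5 + Real.log (1 / δ) + h) ≤ Y →
        N ≤ 48 * Y ^ 2 * 4 ^ h * Real.log (Y * 2 ^ h) ^ 2) →
      N ≤ C * (1 / β ^ 2 * Real.log (1 / β) ^ 4 * Real.log (1 / δ) ^ 2) := by
  set l := Real.log (1 / κ) with hl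
  set E := 1 + 4 * (θ + 1) * abar / ((θ - 1) * D) with hE
  set r := 16 * (Q + 15 * M) / abar with hr
  set ch := 2 * (Real.log E / l + 1) with hch
  set W := r * (5 / l ^ 2 + 1 / l + ch / l) + 3 / l ^ 2 with hW
  set cy := |Real.log W| / l + p + 1 + (Real.log E / l + 1) with hcy
  refine ⟨48 * W ^ 2 * E ^ 2 * cy ^ 2, ?_⟩
  intro hM hQ hθ ha hD β δ h N hβ hδ hβκ hδκ hlog hh hN
  have hl0 : 0 < l := Real.log_pos (by rw [lt_div_iff₀ hκ]; linarith)
  have hθ1 : 0 < θ - 1 := by linarith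
  have hθ0 : 0 < θ := by linarith
  have hE1 : 1 ≤ E := by
    have : 0 ≤ 4 * (θ + 1) * abar / ((θ - 1) * D) := by positivity
    linarith
  have hlE : 0 ≤ Real.log E := Real.log_nonneg hE1
  set b := Real.log (1 / β) with hb
  set D1 := Real.log (1 / δ) with hD1
  have hbl : l ≤ b := Real.log_le_log (by positivity) (by gcongr)
  have hDl : l ≤ D1 := Real.log_le_log (by positivity) (by gcongr)
  have hb0 : 0 < b := by linarith
  have hD10 : 0 < D1 := by linarith
  have hr0 : 0 < r := by positivity
  have hch0 : 0 ≤ ch := by positivity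
  have hW0 : 0 < W := by positivity
  clear_value cy W ch r E b D1 l
  -- In the regime considered, the logarithms of `1 / β` and `1 / δ` are at least `l = log (1 / κ)`,
  -- so additive constants can be absorbed as multiples of them.
  have hscale : ∀ c x : ℝ, 0 ≤ c → l ≤ x → c ≤ c / l * x := by
    intro c x hc hx
    rw [div_mul_eq_mul_div, le_div_iff₀ hl0]
    gcongr
  have hpow : (2 : ℝ) ^ h ≤ E / β := by
    refine hh.trans ?_
    have hβ1 : β ≤ 1 := by linarith
    have e : 4 * (θ + 1) * abar / ((θ - 1) * (β * D)) =
        4 * (θ + 1) * abar / ((θ - 1) * D) / β := by field_simp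
    rw [hE, add_div, e]
    gcongr
    rw [le_div_iff₀ hβ]; linarith
  have hhlog : h * Real.log 2 ≤ (Real.log E / l + 1) * b := by
    have h1 := Real.log_le_log (by positivity) hpow
    have e : E / β = E * (1 / β) := by ring
    rw [Real.log_pow, e, Real.log_mul (by positivity) (by positivity), ← hb] at h1
    have := hscale _ b hlE hbl
    linarith
  have hhb : (h : ℝ) ≤ ch * b := by
    have h4 : (h : ℝ) * (1 / 2) ≤ h * Real.log 2 := by
      gcongr
      linarith [Real.log_two_gt_d9]
    rw [hch]
    linarith
  have hprod : l ^ 2 ≤ D1 * b := by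
    rw [sq]
    exact mul_le_mul hDl hbl hl0.le hD10.le
  set Y := W * (D1 * b) with hY
  have h5 : (5 : ℝ) ≤ 5 / l ^ 2 * (D1 * b) := by
    rw [div_mul_eq_mul_div, le_div_iff₀ (by positivity)]
    gcongr
  have h3 : (3 : ℝ) ≤ 3 / l ^ 2 * (D1 * b) := by
    rw [div_mul_eq_mul_div, le_div_iff₀ (by positivity)]
    gcongr
  have h6 : D1 ≤ 1 / l * (D1 * b) := by
    have := hscale D1 b hD10.le hbl
    calc D1 ≤ D1 / l * b := this
      _ = _ := by ring
  have h7 : (h : ℝ) ≤ ch / l * (D1 * b) := by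
    have := hscale (ch * b) D1 (by positivity) hDl
    calc (h : ℝ) ≤ ch * b := hhb
      _ ≤ ch * b / l * D1 := this
      _ = _ := by ring
  have hrY : r * (5 + D1 + h) ≤ r * (5 / l ^ 2 + 1 / l + ch / l) * (D1 * b) := by
    rw [mul_assoc]
    refine mul_le_mul_of_nonneg_left ?_ hr0.le
    linarith
  have hr1 : 0 ≤ r * (5 / l ^ 2 + 1 / l + ch / l) * (D1 * b) := by positivity
  have hYsplit : Y = r * (5 / l ^ 2 + 1 / l + ch / l) * (D1 * b) + 3 / l ^ 2 * (D1 * b) := by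
    rw [hY, hW]; ring
  have hY3 : 3 ≤ Y := by linarith
  have hbound := hN Y hY3 (by linarith)
  have h2h : (1 : ℝ) ≤ 2 ^ h := one_le_pow₀ (by norm_num)
  have hlogY : Real.log (Y * 2 ^ h) ≤ cy * b := by
    -- The only use of `log (1 / δ) ≤ (1 / β) ^ p`: it turns the iterated logarithm of `1 / δ` into
    -- a multiple of `log (1 / β)`.
    have hlD : Real.log D1 ≤ p * b := by
      have := Real.log_le_log hD10 hlog
      rwa [Real.log_rpow (by positivity), ← hb] at this
    have hlb : Real.log b ≤ b := by
      have := Real.log_le_sub_one_of_pos hb0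
      linarith
    have hlW : Real.log W ≤ |Real.log W| / l * b :=
      (le_abs_self _).trans (hscale _ b (abs_nonneg _) hbl)
    rw [hY, Real.log_mul (by positivity) (by positivity), Real.log_mul hW0.ne' (by positivity),
      Real.log_mul hD10.ne' hb0.ne', Real.log_pow, hcy]
    linarith
  have hlogY0 : 0 ≤ Real.log (Y * 2 ^ h) := Real.log_nonneg (one_le_mul_of_one_le_of_one_le (by linarith only [hY3]) h2h)
  have h4h : (4 : ℝ) ^ h ≤ (E / β) ^ 2 := by
    have e : (4 : ℝ) ^ h = (2 ^ h) ^ 2 := by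
      rw [← pow_mul, mul_comm h 2, pow_mul]; norm_num
    rw [e]
    gcongr
  calc N ≤ 48 * Y ^ 2 * 4 ^ h * Real.log (Y * 2 ^ h) ^ 2 := hbound
    _ ≤ 48 * Y ^ 2 * (E / β) ^ 2 * (cy * b) ^ 2 := by gcongr
    _ = _ := by rw [hY]; ring

set_option maxHeartbeats 400000 in
/-- Bound on the total number of iterations for a fixed value of the level-set function. -/
lemma exists_total_bound {κ p : ℝ} (hκ : 0 < κ) (hκ1 : κ < 1) (M Q θ abar H0 : ℝ) :
    ∃ C : ℝ, 0 < M → 0 < Q → 1 < θ → 0 < abar → H0 < 0 →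
      ∀ (β δ ε : ℝ) (h k : ℕ) (N T : ℝ), 0 < β → β ≤ 1 → 0 < δ → δ ≤ κ → 0 < ε → ε ≤ κ →
      Real.log (1 / δ) ≤ (1 / ε) ^ p →
      (2 : ℝ) ^ h ≤ 1 + 4 * (θ + 1) * abar / ((θ - 1) * -H0) → k ≤ levelCount β θ ε →
      (∀ Y : ℝ, 3 ≤ Y → 16 * (Q + 15 * M) / abar * (5 + Real.log (1 / δ) + h) ≤ Y →
        N ≤ 48 * Y ^ 2 * 4 ^ h * Real.log (Y * 2 ^ h) ^ 2) →
      (∀ y : ℝ, 3 ≤ y → 16 * (Q + 15 * M) * (4 + Real.log (1 / δ)) /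
          ((θ - 1) / (2 * θ ^ 2 * (θ + 1)) * (-H0 / θ) * ε) ≤ y →
        T ≤ 24 * y ^ 2 * Real.log y ^ 2) →
      N + (k + 1) * T ≤ C * (1 / β ^ 2 * Real.log (1 / β) ^ 4 * Real.log (1 / δ) ^ 2 +
        θ ^ 2 / (β * ε ^ 2) * Real.log (θ ^ 2 / (β * ε)) *
          Real.log (1 / δ) ^ 2 * Real.log (1 / ε) ^ 2) := by
  set l := Real.log (1 / κ) with hl
  set E := 1 + 4 * (θ + 1) * abar / ((θ - 1) * -H0) with hE
  set r := 16 * (Q + 15 * M) / abar with hr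
  set W := r * ((5 + 2 * Real.log E) / l + 1) + 3 / l with hW
  set c1 := (|Real.log W| + Real.log E) / l + p with hc1
  set g := (θ - 1) / (2 * θ ^ 2 * (θ + 1)) * (-H0 / θ) with hg
  set W2 := 16 * (Q + 15 * M) / g * (4 / l + 1) + 3 / l with hW2
  set c2 := |Real.log W2| / l + p + 1 with hc2
  set ck := 3 * (1 / l + 1) + 2 / l with hck
  refine ⟨48 * W ^ 2 * E ^ 2 * c1 ^ 2 / l + ck * (24 * W2 ^ 2 * c2 ^ 2), ?_⟩
  intro hM hQ hθ ha hH0 β δ ε h k N T hβ hβ1 hδ hδκ hε hεκ hlog hpow hk hN hT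
  have hl0 : 0 < l := Real.log_pos (by rw [lt_div_iff₀ hκ]; linarith)
  have hθ1 : 0 < θ - 1 := by linarith
  have hθ0 : 0 < θ := by linarith
  have hH : 0 < -H0 := by linarith
  have hθsq : 1 ≤ θ ^ 2 := one_le_pow₀ hθ.le
  have hε1 : ε ≤ 1 := by linarith
  have hE1 : 1 ≤ E := by
    have : 0 ≤ 4 * (θ + 1) * abar / ((θ - 1) * -H0) := by positivity
    linarith
  have hlE : 0 ≤ Real.log E := Real.log_nonneg hE1
  set e := Real.log (1 / ε) with he
  set D1 := Real.log (1 / δ) with hD1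
  have hel : l ≤ e := Real.log_le_log (by positivity) (by gcongr)
  have hDl : l ≤ D1 := Real.log_le_log (by positivity) (by gcongr)
  have he0 : 0 < e := by linarith
  have hD10 : 0 < D1 := by linarith
  have hr0 : 0 < r := by positivity
  have hW0 : 0 < W := by positivity
  have hg0 : 0 < g := by positivity
  have hW20 : 0 < W2 := by positivity
  clear_value ck c2 W2 g c1 W r E e D1 l
  have hscale : ∀ c x : ℝ, 0 ≤ c → l ≤ x → c ≤ c / l * x := by
    intro c x hc hx
    rw [div_mul_eq_mul_div, le_div_iff₀ hl0]
    gcongr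
  have hlD : Real.log D1 ≤ p * e := by
    have := Real.log_le_log hD10 hlog
    rwa [Real.log_rpow (by positivity), ← he] at this
  have hhlog : h * Real.log 2 ≤ Real.log E := by
    have := Real.log_le_log (by positivity) hpow
    rwa [Real.log_pow] at this
  have hhb : (h : ℝ) ≤ 2 * Real.log E := by
    have h4 : (h : ℝ) * (1 / 2) ≤ h * Real.log 2 := by
      gcongr
      linarith [Real.log_two_gt_d9]
    linarith
  have h2h : (1 : ℝ) ≤ 2 ^ h := one_le_pow₀ (by norm_num)
  set Λ := Real.log (θ ^ 2 / (β * ε)) with hΛ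
  have hΛe : e ≤ Λ := by
    rw [he, hΛ]
    refine Real.log_le_log (by positivity) ?_
    rw [div_le_div_iff₀ hε (by positivity)]
    rw [one_mul]
    exact mul_le_mul_of_nonneg_right (hβ1.trans hθsq) hε.le
  have hΛ0 : 0 < Λ := by linarith
  set S2 := θ ^ 2 / (β * ε ^ 2) * Λ * D1 ^ 2 * e ^ 2 with hS2
  clear_value S2 Λ
  -- Only nonnegativity of the first summand is used. With `H0` fixed, `2 ^ h ≤ E` bounds `h` by a
  -- constant, and Phase 1 fits into the second summand; thus no restriction on `β` away from `1` is
  -- needed.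
  have hfirst : 0 ≤ 1 / β ^ 2 * Real.log (1 / β) ^ 4 * D1 ^ 2 := by positivity
  have hphase1 : N ≤ 48 * W ^ 2 * E ^ 2 * c1 ^ 2 / l * S2 := by
    have h5 := hscale (5 + 2 * Real.log E) D1 (by positivity) hDl
    have h3 := hscale 3 D1 (by norm_num) hDl
    have hrY : r * (5 + D1 + h) ≤ r * ((5 + 2 * Real.log E) / l + 1) * D1 := by
      rw [mul_assoc]
      refine mul_le_mul_of_nonneg_left ?_ hr0.le
      linarith
    have hr1 : 0 ≤ r * ((5 + 2 * Real.log E) / l + 1) * D1 := by positivity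
    have hYsplit : W * D1 = r * ((5 + 2 * Real.log E) / l + 1) * D1 + 3 / l * D1 := by
      rw [hW]; ring
    have hY3 : 3 ≤ W * D1 := by linarith
    have hbound := hN (W * D1) hY3 (by linarith)
    have hlogY : Real.log (W * D1 * 2 ^ h) ≤ c1 * e := by
      have h1 := hscale (|Real.log W| + Real.log E) e (by positivity) hel
      rw [Real.log_mul (by positivity) (by positivity), Real.log_mul hW0.ne' hD10.ne',
        Real.log_pow, hc1]
      linarith [le_abs_self (Real.log W)]
    have hlogY0 : 0 ≤ Real.log (W * D1 * 2 ^ h) := Real.log_nonneg (one_le_mul_of_one_le_of_one_le (by linarith only [hY3]) h2h)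
    have h4h : (4 : ℝ) ^ h ≤ E ^ 2 := by
      have e4 : (4 : ℝ) ^ h = (2 ^ h) ^ 2 := by
        rw [← pow_mul, mul_comm h 2, pow_mul]; norm_num
      rw [e4]
      gcongr
    have hS2l : l * (D1 ^ 2 * e ^ 2) ≤ S2 := by
      have h1 : 1 ≤ θ ^ 2 / (β * ε ^ 2) := by
        rw [le_div_iff₀ (by positivity)]
        have : β * ε ^ 2 ≤ 1 := mul_le_one₀ hβ1 (by positivity) (pow_le_one₀ hε.le hε1)
        rw [one_mul]
        exact this.trans hθsq
      calc l * (D1 ^ 2 * e ^ 2) ≤ (1 * Λ) * (D1 ^ 2 * e ^ 2) := by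
            gcongr
            linarith
        _ ≤ (θ ^ 2 / (β * ε ^ 2) * Λ) * (D1 ^ 2 * e ^ 2) := by gcongr
        _ = S2 := by rw [hS2]; ring
    calc N ≤ 48 * (W * D1) ^ 2 * 4 ^ h * Real.log (W * D1 * 2 ^ h) ^ 2 := hbound
      _ ≤ 48 * (W * D1) ^ 2 * E ^ 2 * (c1 * e) ^ 2 := by gcongr
      _ = 48 * W ^ 2 * E ^ 2 * c1 ^ 2 * (D1 ^ 2 * e ^ 2) := by ring
      _ = 48 * W ^ 2 * E ^ 2 * c1 ^ 2 / l * (l * (D1 ^ 2 * e ^ 2)) := by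
          rw [← mul_assoc _ l, div_mul_cancel₀ _ hl0.ne']
      _ ≤ _ := by gcongr
  have hTb : T ≤ 24 * W2 ^ 2 * c2 ^ 2 * (D1 ^ 2 * e ^ 2 / ε ^ 2) := by
    have h4 := hscale 4 D1 (by norm_num) hDl
    have h3 := hscale 3 D1 (by norm_num) hDl
    have hsplit : W2 * D1 / ε = 16 * (Q + 15 * M) / g * ((4 / l + 1) * D1) / ε +
        3 / l * D1 / ε := by rw [hW2]; ring
    have hpos1 : 0 ≤ 16 * (Q + 15 * M) / g * ((4 / l + 1) * D1) / ε := by positivity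
    have hpos2 : 0 ≤ 3 / l * D1 / ε := by positivity
    have h3ε : 3 ≤ 3 / l * D1 / ε := by
      rw [le_div_iff₀ hε]
      exact le_trans (by linarith only [hε1]) h3
    have hy3 : 3 ≤ W2 * D1 / ε := by linarith
    have hle : 16 * (Q + 15 * M) * (4 + D1) / (g * ε) ≤ W2 * D1 / ε := by
      have e1 : 16 * (Q + 15 * M) * (4 + D1) / (g * ε) =
          16 * (Q + 15 * M) / g * (4 + D1) / ε := by field_simp
      have h5 : 16 * (Q + 15 * M) / g * (4 + D1) / ε ≤
          16 * (Q + 15 * M) / g * ((4 / l + 1) * D1) / ε := by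
        gcongr
        linarith
      linarith
    have hbound := hT (W2 * D1 / ε) hy3 hle
    have hlogy : Real.log (W2 * D1 / ε) ≤ c2 * e := by
      have h1 := hscale |Real.log W2| e (abs_nonneg _) hel
      have e2 : W2 * D1 / ε = W2 * D1 * (1 / ε) := by ring
      rw [e2, Real.log_mul (by positivity) (by positivity), Real.log_mul hW20.ne' hD10.ne', hc2]
      linarith [le_abs_self (Real.log W2)]
    have hlogy0 : 0 ≤ Real.log (W2 * D1 / ε) := Real.log_nonneg (by linarith)
    calc T ≤ 24 * (W2 * D1 / ε) ^ 2 * Real.log (W2 * D1 / ε) ^ 2 := hbound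
      _ ≤ 24 * (W2 * D1 / ε) ^ 2 * (c2 * e) ^ 2 := by gcongr
      _ = _ := by field_simp
  have hkb : (k : ℝ) + 1 ≤ ck * (θ ^ 2 / β * Λ) := by
    have h1 := levelCount_le hβ hβ1 hθ hε hε1
    have h2 : (k : ℝ) ≤ levelCount β θ ε := by exact_mod_cast hk
    have hlΛ := hel.trans hΛe
    have h3 : Real.log (2 * θ ^ 2 / (β * ε)) ≤ (1 / l + 1) * Λ := by
      have e1 : 2 * θ ^ 2 / (β * ε) = 2 * (θ ^ 2 / (β * ε)) := by ring
      rw [e1, Real.log_mul (by norm_num) (by positivity)]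
      have := hscale 1 Λ (by norm_num) hlΛ
      linarith [Real.log_two_lt_d9]
    have h4 : 3 * θ / β * Real.log (2 * θ ^ 2 / (β * ε)) ≤
        3 * (1 / l + 1) * (θ ^ 2 / β * Λ) := by
      calc 3 * θ / β * Real.log (2 * θ ^ 2 / (β * ε)) ≤ 3 * θ / β * ((1 / l + 1) * Λ) := by
            gcongr
        _ ≤ 3 * θ ^ 2 / β * ((1 / l + 1) * Λ) := by
            gcongr
            exact le_self_pow₀ hθ.le two_ne_zero
        _ = _ := by ring
    have h5 : (2 : ℝ) ≤ 2 / l * (θ ^ 2 / β * Λ) := by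
      have h6 := hscale 2 Λ (by norm_num) hlΛ
      have h7 : 1 ≤ θ ^ 2 / β := by
        rw [le_div_iff₀ hβ, one_mul]
        exact hβ1.trans hθsq
      have h8 : Λ ≤ θ ^ 2 / β * Λ := le_mul_of_one_le_left hΛ0.le h7
      calc (2 : ℝ) ≤ 2 / l * Λ := h6
        _ ≤ _ := by gcongr
    rw [hck]
    linarith
  have hck0 : 0 ≤ ck := by rw [hck]; positivity
  have hphase2 : (k + 1) * T ≤ ck * (24 * W2 ^ 2 * c2 ^ 2) * S2 := by
    calc ((k : ℝ) + 1) * T ≤ (k + 1) * (24 * W2 ^ 2 * c2 ^ 2 * (D1 ^ 2 * e ^ 2 / ε ^ 2)) := by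
          gcongr
      _ ≤ ck * (θ ^ 2 / β * Λ) * (24 * W2 ^ 2 * c2 ^ 2 * (D1 ^ 2 * e ^ 2 / ε ^ 2)) := by gcongr
      _ = _ := by rw [hS2]; field_simp
  have hC0 : 0 ≤ 48 * W ^ 2 * E ^ 2 * c1 ^ 2 / l + ck * (24 * W2 ^ 2 * c2 ^ 2) := by positivity
  calc N + (k + 1) * T ≤ 48 * W ^ 2 * E ^ 2 * c1 ^ 2 / l * S2 +
      ck * (24 * W2 ^ 2 * c2 ^ 2) * S2 := add_le_add hphase1 hphase2
    _ = (48 * W ^ 2 * E ^ 2 * c1 ^ 2 / l + ck * (24 * W2 ^ 2 * c2 ^ 2)) * S2 := by ring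
    _ ≤ _ := by
        refine mul_le_mul_of_nonneg_left ?_ hC0
        linarith

end SFLS

/-! ### Assembly of the theorem. -/

namespace SFLS

namespace SOEC

variable {d m : ℕ} {Ξ : Fin (m + 1) → Type*} [∀ i, MeasurableSpace (Ξ i)] {S : SOEC d m Ξ}

/-- The iteration limit of the level-set phase, when the estimate `U` is within the factor `θ`
of the value `H0`. -/
lemma limit_oracleError_add_one_le (hM : 0 < S.M) (hQ : 0 < S.Q) {δ θ ε U H0 y : ℝ} (h0 : 0 < δ)
    (h1 : δ < 1) (hθ : 1 < θ) (hε : 0 < ε) (hH0 : H0 < 0) (hU : -H0 ≤ θ * -U) (hy : 3 ≤ y)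
    (hxy : 16 * (S.Q + 15 * S.M) * (4 + Real.log (1 / δ)) /
      ((θ - 1) / (2 * θ ^ 2 * (θ + 1)) * (-H0 / θ) * ε) ≤ y) :
    (S.limit δ (oracleError θ U ε) : ℝ) + 1 ≤ 24 * y ^ 2 * Real.log y ^ 2 := by
  have hθ1 : 0 < θ - 1 := by linarith
  have hθ0 : 0 < θ := by linarith
  have hH : 0 < -H0 := by linarith
  have hlower : (θ - 1) / (2 * θ ^ 2 * (θ + 1)) * (-H0 / θ) * ε ≤ oracleError θ U ε := by
    have e : oracleError θ U ε = (θ - 1) / (2 * θ ^ 2 * (θ + 1)) * -U * ε := by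
      unfold oracleError; ring
    rw [e]
    gcongr
    rw [div_le_iff₀ hθ0]
    linarith
  have hpos : 0 < (θ - 1) / (2 * θ ^ 2 * (θ + 1)) * (-H0 / θ) * ε := by positivity
  have hX0 := S.bigX_pos hM hQ h0 h1
  have hX := S.bigX_le hM hQ h0 h1
  refine S.limit_add_one_le (div_pos (by positivity) (hpos.trans_le hlower)) ?_ hy
  refine le_trans ?_ hxy
  exact div_le_div₀ (by linarith) (by linarith) hpos hlower

end SOEC

end SFLS

theorem theorem3 (κ p : ℝ) (hκ : 0 < κ) (hκ1 : κ < 1) (hp : 0 < p) :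
    -- `C₀` depends on `ᾱ, r⁰ - f^*`; `C₁` on `M, Q, θ, ᾱ, r⁰ - f^*`; `C₂` on `M, Q, θ, ᾱ, H(r⁰)`
    ∃ (C₀ : ℝ → ℝ → ℝ) (C₁ C₂ : ℝ → ℝ → ℝ → ℝ → ℝ → ℝ),
    ∀ (d m : ℕ) (Ξ : Fin (m + 1) → Type*) [∀ i, MeasurableSpace (Ξ i)] (S : SFLS.SOEC d m Ξ)
      (r0 : ℝ), S.Standing r0 → S.fstar < r0 →
    ∀ (Prb : Type*) [MeasurableSpace Prb] (μ : Measure Prb) [IsProbabilityMeasure μ]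
      -- sample of iteration `t` of call `k` in the estimation phase (`false`)
      -- and in the level-set phase (`true`)
      (ξ : Bool × ℕ × ℕ → Prb → ∀ i, Ξ i),
      (∀ j, Measurable (ξ j)) → (∀ j, μ.map (ξ j) = S.law) → iIndepFun ξ μ →
    ∀ (abar δ ε θ : ℝ), 0 < abar → 0 < δ → δ < 1 → 0 < ε → ε ≤ 1 → 1 < θ →
    ∃ A : Set Prb, MeasurableSet A ∧ ENNReal.ofReal (1 - δ) ≤ μ A ∧ ∀ w ∈ A,
      let ξ₁ : ℕ → ℕ → ∀ i, Ξ i := fun k t => ξ (false, k, t) w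
      let ξ₂ : ℕ → ℕ → ∀ i, Ξ i := fun k t => ξ (true, k, t) w
      let β := S.beta r0
      -- the estimation phase stops, after call `h`
      ∃ h : ℕ, SFLS.StopsAt (S.estTest r0 abar δ θ ξ₁) h ∧
        let U := S.estOutput r0 abar δ ξ₁ h
        S.H r0 ≤ U ∧ U < 0 ∧ |S.H r0| / |U| ≤ θ ∧
        let εA := SFLS.oracleError θ U ε
        let T := S.limit δ εA
        let out := SFLS.levelCall (S.ovsmdOracle T ξ₂) r0 εA δ θ
        -- the level-set method stops, after call `k`
        ∃ k : ℕ, SFLS.StopsAt (fun j => (out j).1 ≥ -SFLS.optTol θ U ε) k ∧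
          -- its output is feasible and relative `ε`-optimal
          (out k).2 ∈ S.feasible ∧
          (S.f 0 (out k).2 - S.fstar) / (r0 - S.fstar) ≤ ε ∧
          -- number of OVSMD calls
          (((h + 1) + (k + 1) : ℕ) : ℝ) ≤ C₀ abar (r0 - S.fstar) *
            (θ ^ 2 / β * Real.log (θ ^ 2 / ((θ - 1) * β * ε))) ∧
          -- number of gradient iterations
          (δ ≤ κ → ε ≤ κ → Real.log (1 / δ) ≤ (1 / ε) ^ p →
            ((S.estGradIters abar δ h + (k + 1) * (T + 1) : ℕ) : ℝ) ≤
              C₂ S.M S.Q θ abar (S.H r0) *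
                (1 / β ^ 2 * Real.log (1 / β) ^ 4 * Real.log (1 / δ) ^ 2 +
                  θ ^ 2 / (β * ε ^ 2) * Real.log (θ ^ 2 / (β * ε)) *
                    Real.log (1 / δ) ^ 2 * Real.log (1 / ε) ^ 2)) ∧
          -- number of gradient iterations of the estimation phase, uniformly in `β`
          (δ ≤ κ → β ≤ κ → Real.log (1 / δ) ≤ (1 / β) ^ p →
            (S.estGradIters abar δ h : ℝ) ≤ C₁ S.M S.Q θ abar (r0 - S.fstar) *
              (1 / β ^ 2 * Real.log (1 / β) ^ 4 * Real.log (1 / δ) ^ 2)) := by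
  -- The positivity hypotheses stand after the existential in both bounds, so the chosen constants
  -- are functions of the listed real parameters alone.
  choose c₁ hc₁ using SFLS.exists_estimation_bound (p := p) hκ hκ1
  choose c₂ hc₂ using SFLS.exists_total_bound (p := p) hκ hκ1
  refine ⟨fun abar D => 14 + 16 * abar / D, c₁, c₂, ?_⟩
  intro d m Ξ _ S r0 hS hr Prb _ μ _ ξ hξ hlaw hind abar δ ε θ ha hδ hδ1 hε hε1 hθ
  obtain ⟨A, hA, hAμ, hAcc⟩ :=
    hS.exists_accurate_event hξ hlaw hind hr ha hδ hδ1 hε hε1 hθ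
  refine ⟨A, hA, hAμ, fun w hw => ?_⟩
  intro ξ₁ ξ₂ β
  obtain ⟨hacc₁, hacc₂⟩ := hAcc w hw
  obtain ⟨h, hhalt, hHU, hU, hratio, hpow, k, hk, hhalt', hfeas, hopt⟩ :=
    hS.procedure_correct hr ha hε hε1 hθ ξ₁ ξ₂ hacc₁ hacc₂
  have hM := hS.M_pos
  have hQ := hS.Q_pos
  have hH := hS.H_neg hr
  have hβ : 0 < β := hS.beta_pos hr
  have hβ1 : β ≤ 1 := hS.beta_le_one hr
  have hD : 0 < r0 - S.fstar := sub_pos.2 hr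
  have hpow' : (2 : ℝ) ^ h ≤ 1 + 4 * (θ + 1) * abar / ((θ - 1) * (β * (r0 - S.fstar))) := by
    have e : -S.H r0 = β * (r0 - S.fstar) := by rw [S.H_eq_beta hr, neg_neg]
    rwa [e] at hpow
  have hN := fun Y => S.estGradIters_le hM hQ ha hδ hδ1 h (Y := Y)
  refine ⟨h, hhalt, hHU, hU, ?_, k, hhalt', hfeas, hopt, ?_, ?_, ?_⟩
  · rw [abs_of_neg hH, abs_of_neg hU, div_le_iff₀ (neg_pos.2 hU)]
    exact hratio
  · exact SFLS.calls_le ha hD hβ hβ1 hθ hε hε1 hpow' hk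
  · intro hδκ hεκ hlog
    push_cast
    exact hc₂ S.M S.Q θ abar (S.H r0) hM hQ hθ ha hH β δ ε h k _ _ hβ hβ1 hδ hδκ hε hεκ hlog hpow
      hk hN fun y hy hxy =>
        S.limit_oracleError_add_one_le hM hQ hδ hδ1 hθ hε hH hratio hy hxy
  · intro hδκ hβκ hlog
    exact hc₁ S.M S.Q θ abar (r0 - S.fstar) hM hQ hθ ha hD β δ h _ hβ hδ hβκ hδκ hlog hpow' hN
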